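/- Let $m>2$, $s>3$, $r>1$. Let $f:\mathbb R^2\to\mathbb C^2$ be continuous with $f\in H^{m,s}(\mathbb R^2)$, i.e. $\langle x\rangle^s f\in H^m(\mathbb R^2)$, where $\langle x\rangle=(1+|x|^2)^{1/2}$. Let $V:\mathbb R^2\to\mathbb R$ be continuous with $V\in H^r(\mathbb R^2)$, and let $z\in\mathbb C\setminus\mathbb R$. For $h>0$ let $-\Delta_{disc,h}$ be the difference operator $$-\Delta_{disc,h}=-\frac1{3h^2}\begin{pmatrix}-3&1+S_1^*+S_2^*\\ 1+S_1+S_2&-3\end{pmatrix},\qquad (S_ju)(n)=u(n-e_j),\quad (S_j^*u)(n)=u(n+e_j),$$ acting on functions $u:\mathbb Z^2\to\mathbb C^2$, i.e. the Hamiltonian of the hexagonal lattice shifted to the bottom of its spectrum and scaled by $1/h^2$. Its symbol is $$-\frac1{3h^2}\begin{pmatrix}-3&1+e^{ih\eta_1}+e^{ih\eta_2}\\ 1+e^{-ih\eta_1}+e^{-ih\eta_2}&-3\end{pmatrix}.$$ Put $f_h(n)=f(hn)$ and $(V_{disc,h}u)(n)=V(hn)u(n)$. For $u\in\ell^2(\mathbb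 Z^2;\mathbb C^2)$ let $$\widehat u(\xi)=\frac h{2\pi}\sum_{n\in\mathbb Z^2}e^{-ihn\cdot\xi}u(n)\ \text{ in } L^2([-\pi/h,\pi/h]^2),\qquad \widetilde u(x)=\frac h{2\pi}\int_{[-\pi/h,\pi/h]^2}e^{ix\cdot\xi}\,\widehat u(\xi)\,d\xi,\quad x\in\mathbb R^2$$ (the interpolation of $u$ from the mesh $h\mathbb Z^2$ to $\mathbb R^2$). Let $\Pi_0$ be the orthogonal projection of $\mathbb C^2$ onto the span of $(1,1)$, which is the eigenspace of the symbol at $\eta=0$ for its lowest eigenvalue $0$. Then for every $h>0$ the equation $$(-\Delta_{disc,h}+V_{disc,h}-z)u_h=f_h\quad\text{on }\mathbb Z^2$$ has a unique solution $u_h\in\ell^2(\mathbb Z^2;\mathbb C^2)$. The continuum Schrödinger equation $$\Big(-\frac19\big(\partial_1^2-\partial_1\partial_2+\partial_2^2\big)+V(x)-z\Big)u=\Pi_0f\quad\text{on }\mathbb R^2$$ has, in the sense of distributions, a unique solution $u\in L^2(\mathbb R^2;\mathbb C^2)$; it has a continuous representative and satisfies $\Pi_0u=u$. As $h\to0^+$,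 the interpolated solutions $\widetilde u_h$ converge to $u$ in $L^{2,-\sigma}(\mathbb R^2)$ for every $0<\sigma<1/2$, i.e. $\|\langle x\rangle^{-\sigma}(\widetilde u_h-u)\|_{L^2(\mathbb R^2)}\to0$, and locally uniformly on $\mathbb R^2$. In particular, for $f=(g,g)$ with $g$ scalar, $u=(v,v)$, where $v$ is the $L^2$-solution of $\big(-\frac19(\partial_1^2-\partial_1\partial_2+\partial_2^2)+V-z\big)v=g$. -/

import Mathlib

open MeasureTheory Filter Topology
open scoped ContDiff

noncomputable section

namespace HexLattice

/-- The plane `ℝ²` with its Euclidean norm. -/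
abbrev Plane : Type := EuclideanSpace ℝ (Fin 2)

/-- The values `(f₁, f₂) ∈ ℂ²` of a function on the hexagonal lattice in one fundamental cell. -/
abbrev Spinor : Type := EuclideanSpace ℂ (Fin 2)

/-- The group `ℤ²` that labels the fundamental cells. -/
abbrev Cell : Type := Fin 2 → ℤ

/-- The point `h n` of `ℝ²`. -/
def node (h : ℝ) (n : Cell) : Plane := WithLp.toLp 2 (fun j => h * (n j : ℝ))

/-! ### The lattice Hamiltonian -/

/-- The shift `(S_j u)(n) = u(n - e_j)`. -/
def shift (j : Fin 2) (u : Cell → Spinor) : Cell → Spinor :=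
  fun n => u (n - Pi.single j 1)

/-- The adjoint shift `(S_j^* u)(n) = u(n + e_j)`. -/
def shiftStar (j : Fin 2) (u : Cell → Spinor) : Cell → Spinor :=
  fun n => u (n + Pi.single j 1)

/-- The operator `-Δ_{disc,h}`, i.e. `-(3h²)⁻¹` times the matrix of difference operators
`[[-3, 1 + S₁^* + S₂^*], [1 + S₁ + S₂, -3]]`. -/
def negLaplacian (h : ℝ) (u : Cell → Spinor) : Cell → Spinor := fun n =>
  WithLp.toLp 2
    ![-(1 / (3 * (h : ℂ) ^ 2)) *
        (-3 * u n 0 + (u n 1 + shiftStar 0 u n 1 + shiftStar 1 u n 1)),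
      -(1 / (3 * (h : ℂ) ^ 2)) *
        ((u n 0 + shift 0 u n 0 + shift 1 u n 0) + -3 * u n 1)]

/-- The symbol of `-Δ_{disc,h}`. -/
def symbol (h : ℝ) (η : Plane) : Matrix (Fin 2) (Fin 2) ℂ :=
  (-(1 / (3 * (h : ℂ) ^ 2))) •
    !![-3,
        1 + Complex.exp (Complex.I * (h * η 0 : ℝ)) + Complex.exp (Complex.I * (h * η 1 : ℝ));
      1 + Complex.exp (-(Complex.I * (h * η 0 : ℝ))) + Complex.exp (-(Complex.I * (h * η 1 : ℝ))),
        -3]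

/-- On the plane wave `n ↦ e^{i h n·η} c` the operator acts as multiplication by its symbol. -/
theorem negLaplacian_planeWave (h : ℝ) (η : Plane) (c : Spinor) (n : Cell) :
    negLaplacian h (fun k => Complex.exp (Complex.I * (inner ℝ (node h k) η : ℝ)) • c) n =
      Complex.exp (Complex.I * (inner ℝ (node h n) η : ℝ)) •
        WithLp.toLp 2 (Matrix.mulVec (symbol h η) c) := by
  ext i
  fin_cases i
  · simp [negLaplacian, shiftStar, symbol, node, PiLp.inner_apply, Fin.sum_univ_two,
      dotProduct, mul_add, add_mul, Complex.exp_add]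
    ring_nf
  · simp [negLaplacian, shift, symbol, node, PiLp.inner_apply, Fin.sum_univ_two,
      dotProduct, mul_add, add_mul, mul_sub, Complex.exp_add,
      Complex.exp_sub, Complex.exp_neg]
    ring_nf

/-- `u` is an `L²`-solution of `(-Δ_{disc,h} + V_{disc,h} - z) u = f_h` on the lattice, where
`(V_{disc,h} u)(n) = V(hn) u(n)` and `f_h(n) = f(hn)`. -/
def IsLatticeSolution (h : ℝ) (V : Plane → ℝ) (f : Plane → Spinor) (z : ℂ)
    (u : Cell → Spinor) : Prop :=
  Summable (fun n => ‖u n‖ ^ 2) ∧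
    ∀ n, negLaplacian h u n + (V (node h n) : ℂ) • u n - z • u n = f (node h n)

/-! ### Fourier series and interpolation -/

/-- The torus `𝕋²_h = [-π/h, π/h]²`. -/
def torus (h : ℝ) : Set Plane := {ξ | ∀ j, ξ j ∈ Set.Icc (-(Real.pi / h)) (Real.pi / h)}

/-- The mode `ξ ↦ (h/2π) e^{-i h n·ξ} c`. -/
def mode (h : ℝ) (n : Cell) (c : Spinor) : Plane → Spinor := fun ξ =>
  (((h / (2 * Real.pi) : ℝ) : ℂ) * Complex.exp (-Complex.I * (inner ℝ (node h n) ξ : ℝ))) • c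

theorem isCompact_torus (h : ℝ) : IsCompact (torus h) := by
  have : torus h = (EuclideanSpace.equiv (Fin 2) ℝ).toHomeomorph ⁻¹'
      (Set.univ.pi fun _ : Fin 2 => Set.Icc (-(Real.pi / h)) (Real.pi / h)) := by
    ext ξ
    exact ⟨fun hξ j _ => hξ j, fun hξ j => hξ j (Set.mem_univ j)⟩
  rw [this, Homeomorph.isCompact_preimage]
  exact isCompact_univ_pi fun _ => isCompact_Icc

theorem memLp_mode (h : ℝ) (n : Cell) (c : Spinor) :
    MemLp (mode h n c) 2 (volume.restrict (torus h)) := by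
  have hc : Continuous (mode h n c) := by
    unfold mode
    fun_prop
  have : IsFiniteMeasure (volume.restrict (torus h)) :=
    ⟨by simpa using (isCompact_torus h).measure_lt_top⟩
  obtain ⟨C, hC⟩ := (isCompact_torus h).exists_bound_of_continuousOn hc.continuousOn
  refine MemLp.of_bound hc.aestronglyMeasurable C ?_
  filter_upwards [ae_restrict_mem (isCompact_torus h).measurableSet] with x hx
  exact hC x hx

/-- The Fourier series `û_h(ξ) = (h/2π) ∑ₙ e^{-i h n·ξ} u_h(n)`, summed in `L²(𝕋²_h)`. -/
def fourierSeries (h : ℝ) (u : Cell → Spinor) : Lp Spinor 2 (volume.restrict (torus h)) :=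
  ∑' n, (memLp_mode h n (u n)).toLp (mode h n (u n))

/-- The interpolation `ũ_h(x) = (h/2π) ∫_{𝕋²_h} e^{i x·ξ} û_h(ξ) dξ`. -/
def interpolation (h : ℝ) (u : Cell → Spinor) : Plane → Spinor := fun x =>
  ((h / (2 * Real.pi) : ℝ) : ℂ) •
    ∫ ξ in torus h, Complex.exp (Complex.I * (inner ℝ x ξ : ℝ)) • fourierSeries h u ξ

/-! ### Function spaces -/

/-- The power `⟨x⟩^s` of the Japanese bracket `⟨x⟩ = (1 + |x|²)^{1/2}`. -/
def bracketPow (s : ℝ) (x : Plane) : ℝ := (1 + ‖x‖ ^ 2) ^ (s / 2)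

/-- The function `f` belongs to the Sobolev space `H^m(ℝ²)`. -/
def MemH {F : Type*} [NormedAddCommGroup F] [NormedSpace ℂ F] [CompleteSpace F]
    (m : ℝ) (f : Plane → F) : Prop :=
  ∃ hf : MemLp f 2 (volume : Measure Plane),
    TemperedDistribution.MemSobolev m 2 (Lp.toTemperedDistribution (hf.toLp f))

/-- The function `f` belongs to the weighted Sobolev space `H^{m,s}(ℝ²)`: `⟨x⟩^s f ∈ H^m`. -/
def MemWeightedH {F : Type*} [NormedAddCommGroup F] [NormedSpace ℂ F] [CompleteSpace F]
    (m s : ℝ) (f : Plane → F) : Prop :=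
  MemH m (fun x => (bracketPow s x : ℂ) • f x)

/-! ### The continuum equation -/

/-- The partial derivative `∂φ/∂x_j`. -/
def partialDeriv (j : Fin 2) (φ : Plane → ℂ) : Plane → ℂ :=
  fun x => fderiv ℝ φ x (EuclideanSpace.single j 1)

/-- The operator `P(D) = -(1/9)(∂₁² - ∂₁∂₂ + ∂₂²)`. -/
def contHamiltonian (φ : Plane → ℂ) : Plane → ℂ := fun x =>
  -(1 / 9) * (partialDeriv 0 (partialDeriv 0 φ) x - partialDeriv 0 (partialDeriv 1 φ) x +
    partialDeriv 1 (partialDeriv 1 φ) x)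

/-- The orthogonal projection `Π₀` of `ℂ²` onto the span of `(1, 1)`, which is the eigenspace of
the symbol at `η = 0` for its lowest characteristic root `0`. -/
def groundProj (c : Spinor) : Spinor := WithLp.toLp 2 ![(c 0 + c 1) / 2, (c 0 + c 1) / 2]

/-- `u ∈ L²(ℝ²; ℂ²)` satisfies `(P(D) + V - z) u = g` in the sense of distributions
(`P(D)` has constant real coefficients and even order, so it is its own transpose). -/
def IsContinuumSolution (V : Plane → ℝ) (g : Plane → Spinor) (z : ℂ) (u : Plane → Spinor) : Prop :=
  MemLp u 2 (volume : Measure Plane) ∧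
    ∀ φ : Plane → ℂ, ContDiff ℝ ∞ φ → HasCompactSupport φ →
      ∫ x, (contHamiltonian φ x + ((V x : ℂ) - z) * φ x) • u x = ∫ x, φ x • g x

end HexLattice

end

/-! The proof is stability plus consistency, followed by a gain of regularity on the Fourier side.

Stability: if `A` is self-adjoint then `|Im z| ‖u‖ ≤ ‖(A - z)u‖` (`isSelfAdjoint_im_mul_norm_le`),
uniformly in `h`. The real spectrum of the lattice operator makes the lattice equation uniquely
solvable. In the continuum the same bound holds for weak solutions
(`WeakHamiltonian.im_mul_norm_le`), because the symbol of `P(D)` is real. It gives uniqueness, then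
density of the range of `P(D) + V - z` on test functions, and so existence. Density also supplies
test functions `φ` close to the solution `v` whose image is close to `(f₀ + f₁)/2`.

Consistency: such a `φ` is transplanted to the lattice (`ansatz`). Sampling `(φ, φ)` is not enough.
The two vertices of a cell occupy different positions, which costs an error of order `1/h`; the
opposite corrections `±(h/6)(∂₁ + ∂₂)φ` put each vertex at the barycentre of its neighbours.
Moreover the component of `f` orthogonal to `(1, 1)` sees the upper branch of the symbol, of size
`2/h²`; it is balanced by a corrector `h² q` with `q = (f₀ - f₁)/2`, which vanishes in the limit.
This is why only `Π₀ f` survives. The residual then tends to `(P(D)φ + (V - z)φ - (f₀ + f₁)/2)(1,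
1)` (`residual_zero`), which is small.

Conclusion: the Fourier transform `spec` of the interpolation has `L²` norm `h‖u‖`, so stability and
convergence of Riemann sums give `L²` convergence of the transforms (`tendsto_eLpNorm_spec_sub`),
hence of the interpolations by Plancherel. The symbol is bounded below by a multiple of `|η|²`
(`symbol_lower_bound`), which gives bounds uniform in `h` on `(1 + |η|²) spec`. In dimension two
these bounds and `L²` convergence force `L¹` convergence of the transforms
(`tendsto_integral_norm_of_weighted`), and so uniform convergence of the interpolations. -/

noncomputable section

namespace HexLattice

/-! ### The lattice Hamiltonian on `ℓ²` -/

/-- The Hilbert space `ℓ²(ℤ²; ℂ²)`. -/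
abbrev SqSum : Type := lp (fun _ : Cell => Spinor) 2

theorem memℓp_two_iff {u : Cell → Spinor} : Memℓp u 2 ↔ Summable fun n => ‖u n‖ ^ 2 := by
  rw [memℓp_gen_iff (by norm_num)]
  simp

theorem SqSum.hasSum_norm_sq (u : SqSum) : HasSum (fun n => ‖u n‖ ^ 2) (‖u‖ ^ 2) := by
  simpa using lp.hasSum_norm (p := 2) (by norm_num) u

theorem memℓp_translate (a : Cell) {u : Cell → Spinor} (hu : Memℓp u 2) :
    Memℓp (fun n => u (n + a)) 2 := by
  rw [memℓp_two_iff] at *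
  exact (Equiv.addRight a).summable_iff.2 hu

/-- The translation `u ↦ u(· + a)` of `ℓ²`. -/
def translate (a : Cell) : SqSum →L[ℂ] SqSum :=
  LinearMap.mkContinuous
    { toFun := fun u => (⟨fun n => u (n + a), memℓp_translate a (lp.memℓp u)⟩ : SqSum)
      map_add' := fun _ _ => rfl
      map_smul' := fun _ _ => rfl } 1 fun u => by
    rw [one_mul]
    refine (sq_le_sq₀ (norm_nonneg _) (norm_nonneg _)).1 ?_
    have h1 := SqSum.hasSum_norm_sq u
    have h2 := SqSum.hasSum_norm_sq ⟨fun n => u (n + a), memℓp_translate a (lp.memℓp u)⟩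
    exact (h2.unique ((Equiv.addRight a).hasSum_iff.2 h1)).le

@[simp]
theorem translate_apply (a : Cell) (u : SqSum) (n : Cell) : translate a u n = u (n + a) := rfl

theorem memℓp_fiberwise {B : Cell → Spinor →L[ℂ] Spinor} {C : ℝ} (hB : ∀ n, ‖B n‖ ≤ C)
    {u : Cell → Spinor} (hu : Memℓp u 2) : Memℓp (fun n => B n (u n)) 2 := by
  rw [memℓp_two_iff] at *
  refine (hu.mul_left (C ^ 2)).of_nonneg_of_le (fun n => by positivity) fun n => ?_
  rw [← mul_pow]
  exact pow_le_pow_left₀ (norm_nonneg _) ((B n).le_of_opNorm_le (hB n) _) 2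

/-- The operator on `ℓ²` that acts in the cell `n` as `B n`. -/
def fiberwise (B : Cell → Spinor →L[ℂ] Spinor) {C : ℝ} (hB : ∀ n, ‖B n‖ ≤ C) :
    SqSum →L[ℂ] SqSum :=
  LinearMap.mkContinuous
    { toFun := fun u => (⟨fun n => B n (u n), memℓp_fiberwise hB (lp.memℓp u)⟩ : SqSum)
      map_add' := fun u v => by
        ext n : 2
        exact (B n).map_add (u n) (v n)
      map_smul' := fun c u => by
        ext n : 2
        exact (B n).map_smul c (u n) } C fun u => by
    have hC : 0 ≤ C := (norm_nonneg _).trans (hB 0)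
    refine (sq_le_sq₀ (norm_nonneg _) (by positivity)).1 ?_
    have h1 := (SqSum.hasSum_norm_sq u).mul_left (C ^ 2)
    have h2 := SqSum.hasSum_norm_sq ⟨fun n => B n (u n), memℓp_fiberwise hB (lp.memℓp u)⟩
    rw [mul_pow]
    refine hasSum_le (fun n => ?_) h2 h1
    rw [← mul_pow]
    exact pow_le_pow_left₀ (norm_nonneg _) ((B n).le_of_opNorm_le (hB n) _) 2

@[simp]
theorem fiberwise_apply (B : Cell → Spinor →L[ℂ] Spinor) {C : ℝ} (hB : ∀ n, ‖B n‖ ≤ C)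
    (u : SqSum) (n : Cell) : fiberwise B hB u n = B n (u n) := rfl

theorem adjoint_translate (a : Cell) :
    ContinuousLinearMap.adjoint (translate a) = translate (-a) := by
  symm
  rw [ContinuousLinearMap.eq_adjoint_iff]
  intro u v
  rw [lp.inner_eq_tsum, lp.inner_eq_tsum, ← (Equiv.addRight a).tsum_eq]
  simp

theorem adjoint_fiberwise (B B' : Cell → Spinor →L[ℂ] Spinor) {C C' : ℝ} (hB : ∀ n, ‖B n‖ ≤ C)
    (hB' : ∀ n, ‖B' n‖ ≤ C') (h : ∀ n, B' n = ContinuousLinearMap.adjoint (B n)) :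
    ContinuousLinearMap.adjoint (fiberwise B hB) = fiberwise B' hB' := by
  symm
  rw [ContinuousLinearMap.eq_adjoint_iff]
  intro u v
  rw [lp.inner_eq_tsum, lp.inner_eq_tsum]
  simp [h, ContinuousLinearMap.adjoint_inner_left]

/-- The matrix unit `(c₀, c₁) ↦ (c₁, 0)`. -/
def raising : Spinor →L[ℂ] Spinor :=
  LinearMap.toContinuousLinearMap
    { toFun := fun c => WithLp.toLp 2 ![c 1, 0]
      map_add' := fun c d => by ext i; fin_cases i <;> simp
      map_smul' := fun a c => by ext i; fin_cases i <;> simp }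

@[simp]
theorem raising_apply (c : Spinor) : raising c = WithLp.toLp 2 ![c 1, 0] := rfl

/-- The matrix unit `(c₀, c₁) ↦ (0, c₀)`. -/
def lowering : Spinor →L[ℂ] Spinor :=
  LinearMap.toContinuousLinearMap
    { toFun := fun c => WithLp.toLp 2 ![0, c 0]
      map_add' := fun c d => by ext i; fin_cases i <;> simp
      map_smul' := fun a c => by ext i; fin_cases i <;> simp }

@[simp]
theorem lowering_apply (c : Spinor) : lowering c = WithLp.toLp 2 ![0, c 0] := rfl

theorem lowering_eq_adjoint : lowering = ContinuousLinearMap.adjoint raising := by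
  rw [ContinuousLinearMap.eq_adjoint_iff]
  intro c d
  simp [PiLp.inner_apply, Fin.sum_univ_two]

/-- The hopping from the second sublattice to the first. -/
def hopping : SqSum →L[ℂ] SqSum :=
  fiberwise (fun _ => raising) (fun _ => le_rfl) ∘L
    (1 + translate (Pi.single 0 1) + translate (Pi.single 1 1))

/-- `laplacianL2` is built from `T + T*`, which makes its self-adjointness immediate; this formula
recovers the second row of the matrix, with the shifts `S_j`, from `T*`. -/
theorem adjoint_hopping : ContinuousLinearMap.adjoint hopping =
    (1 + translate (-Pi.single 0 1) + translate (-Pi.single 1 1)) ∘L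
      fiberwise (fun _ => lowering) (fun _ => le_rfl) := by
  rw [hopping, ContinuousLinearMap.adjoint_comp,
    adjoint_fiberwise _ (fun _ => lowering) _ (fun _ => le_rfl) fun _ => lowering_eq_adjoint,
    map_add, map_add, adjoint_translate, adjoint_translate]
  congr 3
  exact (ContinuousLinearMap.star_eq_adjoint _).symm.trans (star_one _)

/-- The bounded operator `-Δ_{disc,h}` on `ℓ²`. -/
def laplacianL2 (h : ℝ) : SqSum →L[ℂ] SqSum :=
  ((-(1 / (3 * h ^ 2)) : ℝ) : ℂ) •
    (((-3 : ℝ) : ℂ) • (1 : SqSum →L[ℂ] SqSum) +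
      (hopping + ContinuousLinearMap.adjoint hopping))

theorem laplacianL2_apply (h : ℝ) (u : SqSum) (n : Cell) :
    laplacianL2 h u n = negLaplacian h u n := by
  have key : laplacianL2 h u n = ((-(1 / (3 * h ^ 2)) : ℝ) : ℂ) • (((-3 : ℝ) : ℂ) • u n +
      (raising (u n + u (n + Pi.single 0 1) + u (n + Pi.single 1 1)) +
        (lowering (u n) + lowering (u (n + -Pi.single 0 1)) +
          lowering (u (n + -Pi.single 1 1))))) := by
    rw [laplacianL2, adjoint_hopping]
    rfl
  rw [key]
  ext i
  fin_cases i
  · simp [negLaplacian, shiftStar]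
    ring
  · simp [negLaplacian, shift, sub_eq_add_neg]
    ring

theorem isSelfAdjoint_laplacianL2 (h : ℝ) : IsSelfAdjoint (laplacianL2 h) := by
  refine IsSelfAdjoint.smul (Complex.conj_ofReal _) ?_
  refine IsSelfAdjoint.add (IsSelfAdjoint.smul (Complex.conj_ofReal _) (IsSelfAdjoint.one _)) ?_
  rw [← ContinuousLinearMap.star_eq_adjoint]
  exact IsSelfAdjoint.add_star_self _

/-- The multiplication operator by a bounded real sequence. -/
def potentialL2 (v : Cell → ℝ) {C : ℝ} (hv : ∀ n, |v n| ≤ C) : SqSum →L[ℂ] SqSum :=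
  fiberwise (fun n => (v n : ℂ) • (1 : Spinor →L[ℂ] Spinor)) (C := C) fun n => by
    rw [norm_smul]
    simpa using hv n

theorem isSelfAdjoint_potentialL2 (v : Cell → ℝ) {C : ℝ} (hv : ∀ n, |v n| ≤ C) :
    IsSelfAdjoint (potentialL2 v hv) := by
  rw [ContinuousLinearMap.isSelfAdjoint_iff']
  refine adjoint_fiberwise _ _ _ _ fun n => ?_
  rw [← ContinuousLinearMap.star_eq_adjoint, star_smul, star_one]
  congr 1
  exact (Complex.conj_ofReal _).symm

/-! ### The resolvent bound for bounded self-adjoint operators. -/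

section

variable {H : Type*} [NormedAddCommGroup H] [InnerProductSpace ℂ H] [CompleteSpace H]

theorem isSelfAdjoint_bijective_sub_smul {A : H →L[ℂ] H} (hA : IsSelfAdjoint A) {z : ℂ}
    (hz : z.im ≠ 0) : Function.Bijective fun u => A u - z • u := by
  have h1 : z ∉ spectrum ℂ A := fun h => hz (hA.im_eq_zero_of_mem_spectrum h)
  rw [spectrum.notMem_iff, ← IsUnit.neg_iff, ContinuousLinearMap.isUnit_iff_bijective] at h1
  convert h1 using 2 with u
  simp [Algebra.algebraMap_eq_smul_one]

/-- Since `⟨u, Au⟩` is real, the imaginary part of `⟨u, (A - z)u⟩` is `-Im z ‖u‖²`; Cauchy-Schwarz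
does the rest. The constant does not see the norm of `A`, which grows like `1/h²` in the
application. -/
theorem isSelfAdjoint_im_mul_norm_le {A : H →L[ℂ] H} (hA : IsSelfAdjoint A) (z : ℂ) (u : H) :
    |z.im| * ‖u‖ ≤ ‖A u - z • u‖ := by
  rcases eq_or_ne u 0 with rfl | hu
  · simp
  have h0 : (inner ℂ u (A u)).im = 0 := by
    have h := hA.isSymmetric.coe_re_inner_self_apply u
    have h' := inner_conj_symm (𝕜 := ℂ) u (A u)
    have h'' := hA.isSymmetric u u
    simp only [ContinuousLinearMap.coe_coe] at h''
    rw [h''] at h'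
    have := congrArg Complex.im h'
    simp only [Complex.conj_im] at this
    linarith
  have h1 : (inner ℂ u (A u - z • u)).im = -(z.im * ‖u‖ ^ 2) := by
    have h2 : inner ℂ u u = ((‖u‖ ^ 2 : ℝ) : ℂ) := by
      rw [inner_self_eq_norm_sq_to_K]
      norm_cast
    rw [inner_sub_right, inner_smul_right, h2, Complex.sub_im, h0, Complex.mul_im,
      Complex.ofReal_re, Complex.ofReal_im]
    ring
  have h2 : |z.im| * ‖u‖ ^ 2 ≤ ‖u‖ * ‖A u - z • u‖ := by
    calc |z.im| * ‖u‖ ^ 2 = |(inner ℂ u (A u - z • u)).im| := by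
          rw [h1, abs_neg, abs_mul, abs_of_nonneg (sq_nonneg ‖u‖)]
      _ ≤ ‖inner ℂ u (A u - z • u)‖ := Complex.abs_im_le_norm _
      _ ≤ _ := norm_inner_le_norm _ _
  have h3 : 0 < ‖u‖ := norm_pos_iff.2 hu
  nlinarith

end

/-- The bounded operator `-Δ_{disc,h} + v` on `ℓ²`. -/
def schrodingerL2 (h : ℝ) (v : Cell → ℝ) {C : ℝ} (hv : ∀ n, |v n| ≤ C) : SqSum →L[ℂ] SqSum :=
  laplacianL2 h + potentialL2 v hv

theorem schrodingerL2_apply (h : ℝ) (v : Cell → ℝ) {C : ℝ} (hv : ∀ n, |v n| ≤ C) (u : SqSum)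
    (n : Cell) : schrodingerL2 h v hv u n = negLaplacian h u n + (v n : ℂ) • u n := by
  rw [← laplacianL2_apply]
  rfl

theorem isSelfAdjoint_schrodingerL2 (h : ℝ) (v : Cell → ℝ) {C : ℝ} (hv : ∀ n, |v n| ≤ C) :
    IsSelfAdjoint (schrodingerL2 h v hv) :=
  (isSelfAdjoint_laplacianL2 h).add (isSelfAdjoint_potentialL2 v hv)

theorem isLatticeSolution_iff {h : ℝ} {V : Plane → ℝ} {C : ℝ} (hV : ∀ x, |V x| ≤ C)
    {f : Plane → Spinor} (hf : Memℓp (fun n => f (node h n)) 2) {z : ℂ} (u : SqSum) :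
    IsLatticeSolution h V f z u ↔
      schrodingerL2 h (fun n => V (node h n)) (fun _ => hV _) u - z • u =
        ⟨fun n => f (node h n), hf⟩ := by
  constructor
  · intro hu
    ext n : 2
    exact (congrArg (· - z • u n) (schrodingerL2_apply h _ _ u n)).trans (hu.2 n)
  · refine fun hu => ⟨memℓp_two_iff.1 (lp.memℓp u), fun n => ?_⟩
    rw [← schrodingerL2_apply h (fun n => V (node h n)) (fun _ => hV _)]
    exact congrFun (congrArg (fun w : SqSum => (w : Cell → Spinor)) hu) n

theorem existsUnique_isLatticeSolution {h : ℝ} {V : Plane → ℝ} {C : ℝ} (hV : ∀ x, |V x| ≤ C)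
    {f : Plane → Spinor} (hf : Memℓp (fun n => f (node h n)) 2) {z : ℂ} (hz : z.im ≠ 0) :
    ∃! u, IsLatticeSolution h V f z u := by
  obtain ⟨u, hu, huniq⟩ := (isSelfAdjoint_bijective_sub_smul
    (isSelfAdjoint_schrodingerL2 h (fun n => V (node h n)) (fun _ => hV _)) hz).existsUnique
    ⟨fun n => f (node h n), hf⟩
  refine ⟨u, (isLatticeSolution_iff hV hf u).2 hu, fun w hw => ?_⟩
  have := huniq ⟨w, memℓp_two_iff.2 hw.1⟩ ((isLatticeSolution_iff hV hf _).1 hw)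
  exact congrArg (fun w : SqSum => (w : Cell → Spinor)) this

/-! ### The Fourier series as an isometry -/

theorem measurableSet_torus (h : ℝ) : MeasurableSet (torus h) :=
  (isCompact_torus h).measurableSet

theorem torus_eq_preimage (h : ℝ) : torus h = (WithLp.ofLp : Plane → Fin 2 → ℝ) ⁻¹'
    (Set.univ.pi fun _ : Fin 2 => Set.Icc (-(Real.pi / h)) (Real.pi / h)) := by
  ext ξ
  exact ⟨fun hξ j _ => hξ j, fun hξ j => hξ j (Set.mem_univ j)⟩

theorem integral_torus_prod (h : ℝ) (g : Fin 2 → ℝ → ℂ) :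
    ∫ ξ in torus h, ∏ j, g j (ξ j) =
      ∏ j, ∫ t in Set.Icc (-(Real.pi / h)) (Real.pi / h), g j t := by
  rw [torus_eq_preimage, (PiLp.volume_preserving_ofLp (Fin 2)).setIntegral_preimage_emb
    (MeasurableEquiv.toLp 2 (Fin 2 → ℝ)).symm.measurableEmbedding (fun y => ∏ j, g j (y j)),
    volume_pi, Measure.restrict_pi_pi, integral_fintype_prod_eq_prod]

theorem integral_exp_int_mul {h : ℝ} (hh : 0 < h) (k : ℤ) :
    ∫ t in Set.Icc (-(Real.pi / h)) (Real.pi / h), Complex.exp (Complex.I * (h * k * t : ℝ)) =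
      if k = 0 then ((2 * Real.pi / h : ℝ) : ℂ) else 0 := by
  have hle : -(Real.pi / h) ≤ Real.pi / h := by
    have : 0 < Real.pi / h := by positivity
    linarith
  rw [integral_Icc_eq_integral_Ioc, ← intervalIntegral.integral_of_le hle]
  split_ifs with hk
  · subst hk
    simp
    ring
  · have hc : Complex.I * h * k ≠ 0 := by
      simp [hh.ne', hk]
    have e : ∀ t : ℝ, Complex.exp (Complex.I * (h * k * t : ℝ)) =
        Complex.exp (Complex.I * h * k * t) := fun t => by
      push_cast
      ring_nf
    simp_rw [e]
    rw [integral_exp_mul_complex hc, div_eq_zero_iff]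
    left
    -- The exponents at the two endpoints differ by `2πik`, so the primitive takes equal values
    -- there.
    have h1 : Complex.I * h * k * ((Real.pi / h : ℝ) : ℂ) =
        Complex.I * h * k * ((-(Real.pi / h) : ℝ) : ℂ) + k * (2 * Real.pi * Complex.I) := by
      have : (h : ℂ) ≠ 0 := by exact_mod_cast hh.ne'
      push_cast
      field_simp
      ring
    rw [h1, Complex.exp_add, Complex.exp_int_mul_two_pi_mul_I, mul_one, sub_self]

theorem integral_torus_exp {h : ℝ} (hh : 0 < h) (n : Cell) :
    ∫ ξ in torus h, Complex.exp (Complex.I * (inner ℝ (node h n) ξ : ℝ)) =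
      if n = 0 then (((2 * Real.pi / h) ^ 2 : ℝ) : ℂ) else 0 := by
  have e : ∀ ξ : Plane, Complex.exp (Complex.I * (inner ℝ (node h n) ξ : ℝ)) =
      ∏ j, Complex.exp (Complex.I * (h * n j * ξ j : ℝ)) := fun ξ => by
    rw [← Complex.exp_sum]
    congr 1
    simp [node, PiLp.inner_apply, Fin.sum_univ_two]
    ring
  simp_rw [e]
  rw [integral_torus_prod h fun j t => Complex.exp (Complex.I * (h * n j * t : ℝ))]
  simp_rw [integral_exp_int_mul hh]
  rw [Fin.prod_univ_two]
  by_cases hn : n = 0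
  · subst hn
    simp [sq]
  · rw [if_neg hn]
    by_cases h0 : n 0 = 0
    · have h1 : n 1 ≠ 0 := fun h1 => hn (by ext j; fin_cases j <;> simp [h0, h1])
      simp [h1]
    · simp [h0]

theorem node_sub (h : ℝ) (n m : Cell) : node h (n - m) = node h n - node h m := by
  ext j
  simp [node, mul_sub]

/-- Orthogonality of characters; the prefactor `h/2π` is exactly what normalizes them, the torus
having area `(2π/h)²`. -/
theorem inner_mode {h : ℝ} (hh : 0 < h) (n m : Cell) (c d : Spinor) :
    inner ℂ ((memLp_mode h n c).toLp (mode h n c)) ((memLp_mode h m d).toLp (mode h m d)) =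
      if n = m then inner ℂ c d else 0 := by
  rw [L2.inner_def]
  have e : ∀ᵐ ξ ∂(volume.restrict (torus h)),
      inner ℂ ((memLp_mode h n c).toLp (mode h n c) ξ) ((memLp_mode h m d).toLp (mode h m d) ξ) =
        (((h / (2 * Real.pi)) ^ 2 : ℝ) : ℂ) * inner ℂ c d *
          Complex.exp (Complex.I * (inner ℝ (node h (n - m)) ξ : ℝ)) := by
    filter_upwards [(memLp_mode h n c).coeFn_toLp, (memLp_mode h m d).coeFn_toLp] with ξ h1 h2
    rw [h1, h2, mode, mode, inner_smul_left, inner_smul_right, node_sub, inner_sub_left,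
      map_mul, ← Complex.exp_conj, map_mul, map_neg, Complex.conj_I, Complex.conj_ofReal,
      Complex.conj_ofReal]
    rw [Complex.ofReal_sub, mul_sub, Complex.exp_sub, neg_neg, neg_mul, Complex.exp_neg]
    push_cast
    ring
  rw [integral_congr_ae e, integral_const_mul, integral_torus_exp hh]
  simp only [sub_eq_zero]
  split_ifs
  · rw [mul_right_comm, ← Complex.ofReal_mul]
    have : (h / (2 * Real.pi)) ^ 2 * (2 * Real.pi / h) ^ 2 = 1 := by
      have := Real.pi_ne_zero
      field_simp
    rw [this, Complex.ofReal_one, one_mul]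
  · simp

/-- The isometric embedding `c ↦ mode h n c` of `ℂ²` into `L²` of the torus. -/
def modeIsometry {h : ℝ} (hh : 0 < h) (n : Cell) :
    Spinor →ₗᵢ[ℂ] Lp Spinor 2 (volume.restrict (torus h)) where
  toFun c := (memLp_mode h n c).toLp (mode h n c)
  map_add' c d := by
    rw [← MemLp.toLp_add]
    congr 1
    ext1 ξ
    simp [mode]
  map_smul' a c := by
    rw [RingHom.id_apply, ← MemLp.toLp_const_smul]
    congr 1
    ext1 ξ
    simp only [mode, Pi.smul_apply]
    rw [smul_comm]
  norm_map' c := by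
    have h1 := inner_mode hh n n c c
    rw [if_pos rfl, inner_self_eq_norm_sq_to_K, inner_self_eq_norm_sq_to_K] at h1
    refine (sq_eq_sq₀ (norm_nonneg _) (norm_nonneg _)).1 ?_
    exact_mod_cast h1

theorem orthogonalFamily_mode {h : ℝ} (hh : 0 < h) :
    OrthogonalFamily ℂ (fun _ : Cell => Spinor) (modeIsometry hh) := fun n m hnm c d =>
  (inner_mode hh n m c d).trans (if_neg hnm)

/-- The Fourier series as an isometry of `ℓ²` into `L²` of the torus. -/
def seriesL2 {h : ℝ} (hh : 0 < h) : SqSum →ₗᵢ[ℂ] Lp Spinor 2 (volume.restrict (torus h)) :=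
  (orthogonalFamily_mode hh).linearIsometry

theorem seriesL2_apply {h : ℝ} (hh : 0 < h) (u : SqSum) : seriesL2 hh u = fourierSeries h u :=
  (orthogonalFamily_mode hh).linearIsometry_apply u

theorem seriesL2_single {h : ℝ} (hh : 0 < h) (n : Cell) (c : Spinor) :
    seriesL2 hh (lp.single 2 n c) = (memLp_mode h n c).toLp (mode h n c) :=
  (orthogonalFamily_mode hh).linearIsometry_apply_single c

/-- The sequences supported in one cell span a dense subspace, so identities between bounded
operators need checking only there. -/
theorem SqSum.clm_ext {X : Type*} [NormedAddCommGroup X] [NormedSpace ℂ X] {A B : SqSum →L[ℂ] X}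
    (h : ∀ n c, A (lp.single 2 n c) = B (lp.single 2 n c)) : A = B := by
  ext u
  have hu := lp.hasSum_single (p := 2) (by norm_num) u
  refine (hu.mapL A).unique ?_
  simp_rw [h]
  exact hu.mapL B

/-- The character `ξ ↦ e^{i h a·ξ}`. -/
def phase (h : ℝ) (a : Cell) (ξ : Plane) : ℂ := Complex.exp (Complex.I * (inner ℝ (node h a) ξ : ℝ))

theorem norm_phase (h : ℝ) (a : Cell) (ξ : Plane) : ‖phase h a ξ‖ = 1 := by
  rw [phase, mul_comm]
  exact Complex.norm_exp_ofReal_mul_I _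

theorem memLp_phase (h : ℝ) (a : Cell) : MemLp (phase h a) ⊤ (volume.restrict (torus h)) := by
  have hc : Continuous (phase h a) := by
    unfold phase
    fun_prop
  exact memLp_top_of_bound hc.aestronglyMeasurable 1 (.of_forall fun ξ => (norm_phase h a ξ).le)

/-- Multiplication by the bounded function `phase` is written as a continuous operator on `L²`
(`holderL`), so that both sides are continuous in `u` and the claim reduces to a shift of a single
mode. -/
theorem seriesL2_translate {h : ℝ} (hh : 0 < h) (a : Cell) (u : SqSum) :
    seriesL2 hh (translate a u) =ᵐ[volume.restrict (torus h)]
      fun ξ => phase h a ξ • seriesL2 hh u ξ := by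
  have key : (seriesL2 hh).toContinuousLinearMap ∘L translate a =
      (ContinuousLinearMap.lsmul ℂ ℂ).holderL (volume.restrict (torus h)) ⊤ 2 2
        ((memLp_phase h a).toLp _) ∘L (seriesL2 hh).toContinuousLinearMap := by
    refine SqSum.clm_ext fun n c => ?_
    have e : translate a (lp.single 2 n c) = lp.single 2 (n - a) c := by
      ext m : 2
      rw [translate_apply, lp.single_apply, lp.single_apply]
      by_cases hm : m + a = n
      · have : m = n - a := eq_sub_of_add_eq hm
        subst this
        simp
      · have : m ≠ n - a := fun h' => hm (by rw [h', sub_add_cancel])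
        simp [Pi.single_eq_of_ne hm, Pi.single_eq_of_ne this]
    simp only [ContinuousLinearMap.comp_apply, LinearIsometry.coe_toContinuousLinearMap, e,
      seriesL2_single]
    refine Lp.ext ?_
    filter_upwards [(memLp_mode h n c).coeFn_toLp, (memLp_mode h (n - a) c).coeFn_toLp,
      (memLp_phase h a).coeFn_toLp, ContinuousLinearMap.coeFn_holder (r := 2)
        (ContinuousLinearMap.lsmul ℂ ℂ) ((memLp_phase h a).toLp _)
        ((memLp_mode h n c).toLp (mode h n c))] with ξ h1 h2 h3 h4
    rw [h2]
    refine Eq.trans ?_ h4.symm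
    rw [h1, h3]
    simp only [ContinuousLinearMap.lsmul_apply, mode, phase, smul_smul, node_sub, inner_sub_left]
    congr 1
    rw [Complex.ofReal_sub, mul_sub, Complex.exp_sub, neg_mul, neg_mul, Complex.exp_neg,
      Complex.exp_neg]
    field_simp
  have h1 := congrArg (fun A : SqSum →L[ℂ] Lp Spinor 2 (volume.restrict (torus h)) => A u) key
  simp only [ContinuousLinearMap.comp_apply, LinearIsometry.coe_toContinuousLinearMap] at h1
  rw [h1]
  filter_upwards [(memLp_phase h a).coeFn_toLp, ContinuousLinearMap.coeFn_holder (r := 2)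
    (ContinuousLinearMap.lsmul ℂ ℂ) ((memLp_phase h a).toLp _) (seriesL2 hh u)] with ξ h3 h4
  refine h4.trans ?_
  rw [h3]
  rfl

theorem seriesL2_fiberwise {h : ℝ} (hh : 0 < h) (B : Spinor →L[ℂ] Spinor) {C : ℝ}
    (hB : ∀ _ : Cell, ‖B‖ ≤ C) (u : SqSum) :
    seriesL2 hh (fiberwise (fun _ => B) hB u) =ᵐ[volume.restrict (torus h)]
      fun ξ => B (seriesL2 hh u ξ) := by
  have key : (seriesL2 hh).toContinuousLinearMap ∘L fiberwise (fun _ => B) hB =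
      B.compLpL 2 (volume.restrict (torus h)) ∘L (seriesL2 hh).toContinuousLinearMap := by
    refine SqSum.clm_ext fun n c => ?_
    have e : fiberwise (fun _ => B) hB (lp.single 2 n c) = lp.single 2 n (B c) := by
      ext m : 2
      rw [fiberwise_apply, lp.single_apply, lp.single_apply]
      by_cases hm : m = n
      · subst hm
        simp
      · simp [Pi.single_eq_of_ne hm]
    simp only [ContinuousLinearMap.comp_apply, LinearIsometry.coe_toContinuousLinearMap, e,
      seriesL2_single]
    refine Lp.ext ?_
    filter_upwards [(memLp_mode h n c).coeFn_toLp, (memLp_mode h n (B c)).coeFn_toLp,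
      B.coeFn_compLpL ((memLp_mode h n c).toLp (mode h n c))] with ξ h1 h2 h3
    rw [h2, h3, h1, mode, mode, map_smul]
  have h1 := congrArg (fun A : SqSum →L[ℂ] Lp Spinor 2 (volume.restrict (torus h)) => A u) key
  simp only [ContinuousLinearMap.comp_apply, LinearIsometry.coe_toContinuousLinearMap] at h1
  rw [h1]
  exact B.coeFn_compLpL _

/-! ### The symbol -/

theorem seriesL2_laplacianL2 {h : ℝ} (hh : 0 < h) (u : SqSum) :
    seriesL2 hh (laplacianL2 h u) =ᵐ[volume.restrict (torus h)]
      fun ξ => WithLp.toLp 2 (Matrix.mulVec (symbol h ξ) (seriesL2 hh u ξ)) := by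
  set F := seriesL2 hh with hF
  set X := fiberwise (fun _ => raising) (fun _ => le_rfl) with hX
  set Y := fiberwise (fun _ => lowering) (fun _ => le_rfl) with hY
  have e : laplacianL2 h u = ((-(1 / (3 * h ^ 2)) : ℝ) : ℂ) • (((-3 : ℝ) : ℂ) • u +
      (X (u + translate (Pi.single 0 1) u + translate (Pi.single 1 1) u) +
        (Y u + translate (-Pi.single 0 1) (Y u) + translate (-Pi.single 1 1) (Y u)))) := by
    rw [laplacianL2, adjoint_hopping]
    rfl
  rw [e]
  simp only [map_add, map_smul]
  filter_upwards [Lp.coeFn_smul ((-(1 / (3 * h ^ 2)) : ℝ) : ℂ) (((-3 : ℝ) : ℂ) • F u +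
      (F (X u) + F (X (translate (Pi.single 0 1) u)) + F (X (translate (Pi.single 1 1) u)) +
        (F (Y u) + F (translate (-Pi.single 0 1) (Y u)) +
          F (translate (-Pi.single 1 1) (Y u))))),
    Lp.coeFn_add (((-3 : ℝ) : ℂ) • F u)
      (F (X u) + F (X (translate (Pi.single 0 1) u)) + F (X (translate (Pi.single 1 1) u)) +
        (F (Y u) + F (translate (-Pi.single 0 1) (Y u)) +
          F (translate (-Pi.single 1 1) (Y u)))),
    Lp.coeFn_smul ((-3 : ℝ) : ℂ) (F u),
    Lp.coeFn_add (F (X u) + F (X (translate (Pi.single 0 1) u)) +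
      F (X (translate (Pi.single 1 1) u))) (F (Y u) + F (translate (-Pi.single 0 1) (Y u)) +
          F (translate (-Pi.single 1 1) (Y u))),
    Lp.coeFn_add (F (X u) + F (X (translate (Pi.single 0 1) u)))
      (F (X (translate (Pi.single 1 1) u))),
    Lp.coeFn_add (F (X u)) (F (X (translate (Pi.single 0 1) u))),
    Lp.coeFn_add (F (Y u) + F (translate (-Pi.single 0 1) (Y u)))
      (F (translate (-Pi.single 1 1) (Y u))),
    Lp.coeFn_add (F (Y u)) (F (translate (-Pi.single 0 1) (Y u))),
    seriesL2_fiberwise hh raising (fun _ => le_rfl) u,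
    seriesL2_fiberwise hh raising (fun _ => le_rfl) (translate (Pi.single 0 1) u),
    seriesL2_fiberwise hh raising (fun _ => le_rfl) (translate (Pi.single 1 1) u),
    seriesL2_translate hh (Pi.single 0 1) u, seriesL2_translate hh (Pi.single 1 1) u,
    seriesL2_fiberwise hh lowering (fun _ => le_rfl) u,
    seriesL2_translate hh (-Pi.single 0 1) (Y u), seriesL2_translate hh (-Pi.single 1 1) (Y u)]
    with ξ h1 h2 h3 h4 h5 h6 h7 h8 h9 h10 h11 h12 h13 h14 h15 h16
  simp only [h1, h2, h3, h4, h5, h6, h7, h8, Pi.add_apply, Pi.smul_apply]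
  rw [h9, h10, h11, h12, h13, h15, h16, h14, ← hF]
  ext i
  fin_cases i
  · simp [symbol, phase, node, PiLp.inner_apply, Fin.sum_univ_two, Matrix.vecHead, Matrix.vecTail]
    ring_nf
  · simp [symbol, phase, node, PiLp.inner_apply, Fin.sum_univ_two, Matrix.vecHead, Matrix.vecTail]
    ring_nf

/-- With `a` the sum of the three phases, `|a|² = 3 + 2cos α + 2cos β + 2cos(α - β)`, and the last
cosine is bounded by `1`. The bound `cos x ≤ 1 - 2x²/π²` then controls `9 - |a|²`, and dividing by
`3 + |a| ≤ 6` gives the constant. -/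
theorem hopping_symbol_gap {α β : ℝ} (hα : |α| ≤ Real.pi) (hβ : |β| ≤ Real.pi) :
    2 / (3 * Real.pi ^ 2) * (α ^ 2 + β ^ 2) ≤
      3 - ‖1 + Complex.exp (Complex.I * α) + Complex.exp (Complex.I * β)‖ := by
  set a := 1 + Complex.exp (Complex.I * α) + Complex.exp (Complex.I * β) with ha
  have h1 : ‖a‖ ^ 2 ≤ 5 + 2 * Real.cos α + 2 * Real.cos β := by
    rw [Complex.sq_norm, Complex.normSq_apply]
    have hre : a.re = 1 + Real.cos α + Real.cos β := by
      simp [ha, mul_comm Complex.I, Complex.exp_ofReal_mul_I_re]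
    have him : a.im = Real.sin α + Real.sin β := by
      simp [ha, mul_comm Complex.I, Complex.exp_ofReal_mul_I_im]
    rw [hre, him]
    nlinarith [Real.sin_sq_add_cos_sq α, Real.sin_sq_add_cos_sq β,
      sq_nonneg (Real.cos α - Real.cos β), sq_nonneg (Real.sin α - Real.sin β)]
  have h2 := Real.cos_le_one_sub_mul_cos_sq hα
  have h3 := Real.cos_le_one_sub_mul_cos_sq hβ
  have h4 : ‖a‖ ≤ 3 := by
    have := Real.cos_le_one α
    have := Real.cos_le_one β
    exact abs_le_of_sq_le_sq' (by linarith) (by norm_num) |>.2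
  have h5 : 2 / (3 * Real.pi ^ 2) * (α ^ 2 + β ^ 2) =
      (2 / Real.pi ^ 2 * α ^ 2 + 2 / Real.pi ^ 2 * β ^ 2) / 3 := by
    have := Real.pi_ne_zero
    field_simp
  rw [h5]
  nlinarith [norm_nonneg a]

theorem norm_sq_eq (ξ : Plane) : ‖ξ‖ ^ 2 = ξ 0 ^ 2 + ξ 1 ^ 2 := by
  simp [EuclideanSpace.norm_sq_eq, Fin.sum_univ_two]

/-- The symbol is `(3 - N)/(3h²)` with `N` off-diagonal and `|Nc| = |a||c|`, so `hopping_symbol_gap`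
at the angles `hξ` bounds it below. The powers of `h` cancel: this is a discrete ellipticity
estimate uniform in `h` on the whole torus. -/
theorem symbol_lower_bound {h : ℝ} (hh : 0 < h) {ξ : Plane} (hξ : ξ ∈ torus h) (c : Spinor) :
    2 / (9 * Real.pi ^ 2) * ‖ξ‖ ^ 2 * ‖c‖ ≤
      ‖(WithLp.toLp 2 (Matrix.mulVec (symbol h ξ) c) : Spinor)‖ := by
  set a := 1 + Complex.exp (Complex.I * (h * ξ 0 : ℝ)) + Complex.exp (Complex.I * (h * ξ 1 : ℝ))
    with ha
  have hb : 1 + Complex.exp (-(Complex.I * (h * ξ 0 : ℝ))) +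
      Complex.exp (-(Complex.I * (h * ξ 1 : ℝ))) = (starRingEnd ℂ) a := by
    rw [ha, map_add, map_add, map_one, ← Complex.exp_conj, ← Complex.exp_conj, map_mul, map_mul,
      Complex.conj_I, Complex.conj_ofReal, Complex.conj_ofReal, neg_mul, neg_mul]
  have e : (WithLp.toLp 2 (Matrix.mulVec (symbol h ξ) c) : Spinor) =
      ((1 / (3 * h ^ 2) : ℝ) : ℂ) • ((3 : ℂ) • c -
        WithLp.toLp 2 ![a * c 1, (starRingEnd ℂ) a * c 0]) := by
    rw [symbol, hb, ← ha]
    ext i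
    fin_cases i
    · simp [Matrix.vecHead, Matrix.vecTail]
      ring
    · simp [Matrix.vecHead, Matrix.vecTail]
      ring
  have h1 : ‖(WithLp.toLp 2 ![a * c 1, (starRingEnd ℂ) a * c 0] : Spinor)‖ = ‖a‖ * ‖c‖ := by
    rw [← sq_eq_sq₀ (norm_nonneg _) (by positivity), mul_pow, EuclideanSpace.norm_sq_eq,
      EuclideanSpace.norm_sq_eq, Fin.sum_univ_two, Fin.sum_univ_two]
    simp
    ring
  have habs : ∀ j, |h * ξ j| ≤ Real.pi := fun j => by
    have h2 := hξ j
    rw [Set.mem_Icc, ← abs_le, le_div_iff₀ hh] at h2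
    rwa [abs_mul, abs_of_pos hh, mul_comm]
  have hgap := hopping_symbol_gap (habs 0) (habs 1)
  rw [← ha] at hgap
  have h3 : ‖(3 : ℂ) • c‖ = 3 * ‖c‖ := by
    rw [norm_smul]
    norm_num
  have h4 : (3 - ‖a‖) * ‖c‖ ≤
      ‖(3 : ℂ) • c - WithLp.toLp 2 ![a * c 1, (starRingEnd ℂ) a * c 0]‖ := by
    have := norm_sub_norm_le ((3 : ℂ) • c) (WithLp.toLp 2 ![a * c 1, (starRingEnd ℂ) a * c 0])
    rw [h1, h3] at this
    linarith
  rw [e, norm_smul, Complex.norm_real, Real.norm_of_nonneg (by positivity)]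
  calc 2 / (9 * Real.pi ^ 2) * ‖ξ‖ ^ 2 * ‖c‖
      = 1 / (3 * h ^ 2) * (2 / (3 * Real.pi ^ 2) * ((h * ξ 0) ^ 2 + (h * ξ 1) ^ 2) * ‖c‖) := by
        rw [norm_sq_eq]
        have := Real.pi_ne_zero
        field_simp
        ring
    _ ≤ 1 / (3 * h ^ 2) * ((3 - ‖a‖) * ‖c‖) := by gcongr
    _ ≤ _ := by gcongr

/-! ### The spectral function of the interpolation -/

/-- The Fourier transform of the interpolation, in the normalization `∫ e^{-2πi x·η} u(x) dx`. -/
def spec (h : ℝ) (u : Cell → Spinor) : Plane → Spinor := fun η =>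
  (torus h).indicator (fun ξ => ((2 * Real.pi * h : ℝ) : ℂ) • fourierSeries h u ξ)
    ((2 * Real.pi) • η)

theorem lintegral_comp_two_pi_smul (g : Plane → ENNReal) :
    ∫⁻ η : Plane, g ((2 * Real.pi) • η) = ENNReal.ofReal (1 / (2 * Real.pi) ^ 2) * ∫⁻ ξ, g ξ := by
  have h0 : 2 * Real.pi ≠ 0 := by positivity
  rw [← smul_eq_mul (ENNReal.ofReal _), ← lintegral_smul_measure]
  have h1 := Measure.map_addHaar_smul (volume : Measure Plane) h0
  have h2 : |((2 * Real.pi) ^ Module.finrank ℝ Plane)⁻¹| = 1 / (2 * Real.pi) ^ 2 := by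
    rw [finrank_euclideanSpace_fin, abs_of_nonneg (by positivity), one_div]
  rw [h2] at h1
  rw [← h1]
  exact (lintegral_map_equiv g (Homeomorph.smulOfNeZero _ h0).toMeasurableEquiv).symm

theorem ae_comp_two_pi_smul {h : ℝ} {P : Plane → Prop}
    (hP : ∀ᵐ ξ ∂(volume.restrict (torus h)), P ξ) :
    ∀ᵐ η : Plane, (2 * Real.pi) • η ∈ torus h → P ((2 * Real.pi) • η) := by
  have h0 : 2 * Real.pi ≠ 0 := by positivity
  rw [ae_restrict_iff' (measurableSet_torus h)] at hP
  rw [ae_iff] at hP ⊢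
  have h1 := Measure.addHaar_preimage_smul (volume : Measure Plane) h0
    {ξ | ¬(ξ ∈ torus h → P ξ)}
  rw [hP, mul_zero] at h1
  exact h1

theorem spec_of_mem {h : ℝ} (u : Cell → Spinor) {η : Plane} (hη : (2 * Real.pi) • η ∈ torus h) :
    spec h u η = ((2 * Real.pi * h : ℝ) : ℂ) • fourierSeries h u ((2 * Real.pi) • η) :=
  Set.indicator_of_mem hη _

theorem spec_of_notMem {h : ℝ} (u : Cell → Spinor) {η : Plane}
    (hη : (2 * Real.pi) • η ∉ torus h) : spec h u η = 0 :=
  Set.indicator_of_notMem hη _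

theorem aestronglyMeasurable_spec (h : ℝ) (u : Cell → Spinor) :
    AEStronglyMeasurable (spec h u) (volume : Measure Plane) := by
  have h1 : StronglyMeasurable (fourierSeries h u) := Lp.stronglyMeasurable _
  have h2 : StronglyMeasurable ((torus h).indicator
      (fun ξ => ((2 * Real.pi * h : ℝ) : ℂ) • fourierSeries h u ξ)) :=
    (h1.const_smul ((2 * Real.pi * h : ℝ) : ℂ)).indicator (measurableSet_torus h)
  exact (h2.comp_measurable (measurable_const_smul (2 * Real.pi))).aestronglyMeasurable

/-- The factor `(2πh)²` of `spec` against the Jacobian `(2π)⁻²` leaves `h²`: the square norm is the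
Riemann sum of `|u|²` over the mesh. -/
theorem lintegral_spec_sq {h : ℝ} (hh : 0 < h) (u : SqSum) :
    ∫⁻ η, ‖spec h u η‖ₑ ^ 2 = ENNReal.ofReal (h ^ 2 * ‖u‖ ^ 2) := by
  have h1 : ∀ ξ, ‖(torus h).indicator (fun ξ => ((2 * Real.pi * h : ℝ) : ℂ) •
      fourierSeries h u ξ) ξ‖ₑ ^ 2 = (torus h).indicator
        (fun ξ => ENNReal.ofReal ((2 * Real.pi * h) ^ 2) * ‖fourierSeries h u ξ‖ₑ ^ 2) ξ := by
    intro ξ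
    by_cases hξ : ξ ∈ torus h
    · rw [Set.indicator_of_mem hξ, Set.indicator_of_mem hξ, enorm_smul, mul_pow]
      congr 1
      rw [← ofReal_norm, Complex.norm_real, Real.norm_of_nonneg (by positivity),
        ENNReal.ofReal_pow (by positivity)]
    · simp [Set.indicator_of_notMem hξ]
  have h2 : ∫⁻ ξ in torus h, ‖fourierSeries h u ξ‖ₑ ^ 2 = ENNReal.ofReal (‖u‖ ^ 2) := by
    rw [← (seriesL2 hh).norm_map u, seriesL2_apply, Lp.norm_def,
      eLpNorm_eq_lintegral_rpow_enorm_toReal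
      (by norm_num) (by norm_num), ENNReal.toReal_ofNat, ← ENNReal.toReal_pow,
      ENNReal.ofReal_toReal, ← ENNReal.rpow_natCast, ← ENNReal.rpow_mul]
    · norm_num
    · have := (Lp.memLp (fourierSeries h u)).eLpNorm_lt_top
      rw [eLpNorm_eq_lintegral_rpow_enorm_toReal
        (by norm_num) (by norm_num), ENNReal.toReal_ofNat] at this
      exact ENNReal.pow_ne_top this.ne
  unfold spec
  rw [lintegral_comp_two_pi_smul fun ξ => ‖(torus h).indicator (fun ξ =>
    ((2 * Real.pi * h : ℝ) : ℂ) • fourierSeries h u ξ) ξ‖ₑ ^ 2]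
  simp_rw [h1]
  rw [lintegral_indicator (measurableSet_torus h), lintegral_const_mul' _ _ (by simp), h2,
    ← ENNReal.ofReal_mul (by positivity), ← ENNReal.ofReal_mul (by positivity)]
  congr 1
  have := Real.pi_ne_zero
  field_simp

theorem eLpNorm_two_eq {α E : Type*} [MeasurableSpace α] {μ : Measure α} [NormedAddCommGroup E]
    (g : α → E) : eLpNorm g 2 μ = (∫⁻ x, ‖g x‖ₑ ^ 2 ∂μ) ^ (1 / 2 : ℝ) := by
  rw [eLpNorm_eq_lintegral_rpow_enorm_toReal (by norm_num) (by norm_num)]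
  simp

theorem eLpNorm_spec {h : ℝ} (hh : 0 < h) (u : SqSum) :
    eLpNorm (spec h u) 2 volume = ENNReal.ofReal (h * ‖u‖) := by
  rw [eLpNorm_two_eq, lintegral_spec_sq hh, ← mul_pow,
    ENNReal.ofReal_rpow_of_nonneg (by positivity) (by norm_num), ← Real.sqrt_eq_rpow,
    Real.sqrt_sq (by positivity)]

theorem memLp_spec {h : ℝ} (hh : 0 < h) (u : SqSum) : MemLp (spec h u) 2 volume :=
  ⟨aestronglyMeasurable_spec h u, by
    rw [eLpNorm_spec hh]
    exact ENNReal.ofReal_lt_top⟩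

theorem spec_sub {h : ℝ} (hh : 0 < h) (u w : SqSum) :
    spec h (u - w : SqSum) =ᵐ[volume] spec h u - spec h w := by
  have h1 : ∀ᵐ ξ ∂(volume.restrict (torus h)), fourierSeries h (u - w : SqSum) ξ =
      fourierSeries h u ξ - fourierSeries h w ξ := by
    simp_rw [← seriesL2_apply hh]
    rw [map_sub]
    exact Lp.coeFn_sub _ _
  filter_upwards [ae_comp_two_pi_smul h1] with η hη
  by_cases hm : (2 * Real.pi) • η ∈ torus h
  · rw [Pi.sub_apply, spec_of_mem _ hm, spec_of_mem _ hm, spec_of_mem _ hm, hη hm, smul_sub]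
  · rw [Pi.sub_apply, spec_of_notMem _ hm, spec_of_notMem _ hm, spec_of_notMem _ hm, sub_zero]

/-- This is `symbol_lower_bound` at `ξ = 2πη`, whence `8/9 = (2π)² · 2/(9π²)`. -/
theorem norm_spec_laplacianL2_ge {h : ℝ} (hh : 0 < h) (u : SqSum) :
    ∀ᵐ η : Plane, 8 / 9 * ‖η‖ ^ 2 * ‖spec h u η‖ ≤ ‖spec h (laplacianL2 h u : SqSum) η‖ := by
  filter_upwards [ae_comp_two_pi_smul (seriesL2_laplacianL2 hh u)] with η hη
  by_cases hm : (2 * Real.pi) • η ∈ torus h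
  · have h1 := hη hm
    rw [seriesL2_apply, seriesL2_apply] at h1
    rw [spec_of_mem _ hm, spec_of_mem _ hm, h1, norm_smul, norm_smul]
    have h2 := symbol_lower_bound hh hm (fourierSeries h u ((2 * Real.pi) • η))
    rw [norm_smul, mul_pow, Real.norm_of_nonneg (by positivity)] at h2
    have h3 : 2 / (9 * Real.pi ^ 2) * ((2 * Real.pi) ^ 2 * ‖η‖ ^ 2) = 8 / 9 * ‖η‖ ^ 2 := by
      have := Real.pi_ne_zero
      field_simp
      ring
    rw [h3] at h2
    calc _ = ‖((2 * Real.pi * h : ℝ) : ℂ)‖ *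
          (8 / 9 * ‖η‖ ^ 2 * ‖fourierSeries h u ((2 * Real.pi) • η)‖) := by ring
      _ ≤ _ := by gcongr
  · rw [spec_of_notMem _ hm, norm_zero, mul_zero]
    exact norm_nonneg _

open FourierTransform in
theorem interpolation_eq_fourierInv {h : ℝ} (u : Cell → Spinor) (x : Plane) :
    interpolation h u x = 𝓕⁻ (spec h u) x := by
  rw [Real.fourierInv_eq']
  have e : ∀ η : Plane, Complex.exp (((2 * Real.pi * inner ℝ η x : ℝ) : ℂ) * Complex.I) • spec h u η
      = (fun ξ => (torus h).indicator (fun ξ => ((2 * Real.pi * h : ℝ) : ℂ) •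
        (Complex.exp (Complex.I * (inner ℝ x ξ : ℝ)) • fourierSeries h u ξ)) ξ)
          ((2 * Real.pi) • η) := by
    intro η
    by_cases hm : (2 * Real.pi) • η ∈ torus h
    · simp only [spec_of_mem _ hm, Set.indicator_of_mem hm]
      rw [smul_comm, inner_smul_right, real_inner_comm, mul_comm Complex.I]
    · simp only [spec_of_notMem _ hm, Set.indicator_of_notMem hm, smul_zero]
  simp_rw [e]
  rw [Measure.integral_comp_smul (volume : Measure Plane) (fun ξ => (torus h).indicator (fun ξ =>
    ((2 * Real.pi * h : ℝ) : ℂ) •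
        (Complex.exp (Complex.I * (inner ℝ x ξ : ℝ)) • fourierSeries h u ξ)) ξ),
    integral_indicator (measurableSet_torus h), integral_smul, interpolation,
    finrank_euclideanSpace_fin, ← Complex.coe_smul, smul_smul, ← Complex.ofReal_mul]
  congr 2
  rw [abs_of_nonneg (by positivity)]
  have := Real.pi_ne_zero
  field_simp

/-! ### Riemann sums over the mesh -/

/-- The index of the cell of the mesh `h ℤ²` that contains `x`. -/
def cellIndex (h : ℝ) (x : Plane) : Cell := fun j => ⌊x j / h⌋

theorem measurable_cellIndex (h : ℝ) : Measurable (cellIndex h) := by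
  refine measurable_pi_lambda _ fun j => Int.measurable_floor.comp ?_
  have : Continuous fun x : Plane => x j / h := by fun_prop
  exact this.measurable

/-- Each cell of the mesh has area `h²`. Lattice sums thereby become integrals of step functions
over the plane, to which dominated convergence applies. -/
theorem map_cellIndex {h : ℝ} (hh : 0 < h) :
    (volume : Measure Plane).map (cellIndex h) = ENNReal.ofReal (h ^ 2) • Measure.count := by
  refine Measure.ext_of_singleton fun n => ?_
  rw [Measure.map_apply (measurable_cellIndex h) (measurableSet_singleton n)]
  have h1 : cellIndex h ⁻¹' {n} = (WithLp.ofLp : Plane → Fin 2 → ℝ) ⁻¹'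
      (Set.univ.pi fun j => Set.Ico (h * n j) (h * (n j + 1))) := by
    ext x
    simp only [cellIndex, Set.mem_preimage, Set.mem_singleton_iff, funext_iff, Int.floor_eq_iff,
      Set.mem_pi, Set.mem_univ, forall_const, Set.mem_Ico, le_div_iff₀ hh, div_lt_iff₀ hh,
      mul_comm h]
  rw [h1, (PiLp.volume_preserving_ofLp (Fin 2)).measure_preimage
    (MeasurableSet.univ_pi fun _ => measurableSet_Ico).nullMeasurableSet, volume_pi_pi]
  simp [Real.volume_Ico, mul_add, ENNReal.ofReal_pow hh.le]

section

variable {E : Type*} [NormedAddCommGroup E]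

theorem integrable_comp_cellIndex_iff {h : ℝ} (hh : 0 < h) {g : Cell → E} :
    Integrable (fun x => g (cellIndex h x)) (volume : Measure Plane) ↔
      Summable fun n => ‖g n‖ := by
  have h1 : AEStronglyMeasurable g ((volume : Measure Plane).map (cellIndex h)) :=
    (StronglyMeasurable.of_discrete).aestronglyMeasurable
  rw [← integrable_count_iff,
    ← integrable_smul_measure (μ := Measure.count) (c := ENNReal.ofReal (h ^ 2))
      (by simp [hh.ne']) (by simp),
    ← map_cellIndex hh]
  exact (integrable_map_measure h1 (measurable_cellIndex h).aemeasurable).symm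

theorem integral_comp_cellIndex [NormedSpace ℝ E] [CompleteSpace E] {h : ℝ} (hh : 0 < h)
    {g : Cell → E} (hg : Summable fun n => ‖g n‖) :
    ∫ x : Plane, g (cellIndex h x) = h ^ 2 • ∑' n, g n := by
  have h1 : AEStronglyMeasurable g ((volume : Measure Plane).map (cellIndex h)) :=
    (StronglyMeasurable.of_discrete).aestronglyMeasurable
  rw [← integral_map (measurable_cellIndex h).aemeasurable h1, map_cellIndex hh,
    integral_smul_measure, ENNReal.toReal_ofReal (by positivity),
    integral_countable (integrable_count_iff.2 hg)]
  simp [Measure.real]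

end

theorem norm_sub_node_cellIndex_le {h : ℝ} (hh : 0 < h) (x : Plane) :
    ‖x - node h (cellIndex h x)‖ ≤ 2 * h := by
  have h1 : ∀ j, |x j - h * ⌊x j / h⌋| ≤ h := fun j => by
    have e : x j - h * ⌊x j / h⌋ = h * Int.fract (x j / h) := by
      rw [Int.fract]
      field_simp
    rw [e, abs_of_nonneg (mul_nonneg hh.le (Int.fract_nonneg _))]
    exact mul_le_of_le_one_right hh.le (Int.fract_lt_one _).le
  rw [EuclideanSpace.norm_eq, Fin.sum_univ_two]
  refine Real.sqrt_le_iff.2 ⟨by positivity, ?_⟩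
  have h2 := h1 0
  have h3 := h1 1
  simp only [node, cellIndex, PiLp.sub_apply, Real.norm_eq_abs, sq_abs]
  have h4 := sq_le_sq' (abs_le.1 h2).1 (abs_le.1 h2).2
  have h5 := sq_le_sq' (abs_le.1 h3).1 (abs_le.1 h3).2
  nlinarith [sq_nonneg h]

theorem tendsto_node_cellIndex (x : Plane) :
    Tendsto (fun h => node h (cellIndex h x)) (𝓝[>] 0) (𝓝 x) := by
  rw [tendsto_iff_norm_sub_tendsto_zero]
  have h1 : Tendsto (fun h : ℝ => 2 * h) (𝓝[>] 0) (𝓝 0) :=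
    (Continuous.tendsto' (by fun_prop) 0 0 (by simp)).mono_left nhdsWithin_le_nhds
  refine squeeze_zero' (.of_forall fun _ => norm_nonneg _) ?_ h1
  filter_upwards [self_mem_nhdsWithin] with h hh
  rw [norm_sub_rev]
  exact norm_sub_node_cellIndex_le hh x

/-! ### Weights, uniformly decaying families and their Riemann sums. -/

theorem bracketPow_nonneg (s : ℝ) (x : Plane) : 0 ≤ bracketPow s x := by
  unfold bracketPow
  positivity

theorem bracketPow_pos (s : ℝ) (x : Plane) : 0 < bracketPow s x := by
  unfold bracketPow
  positivity

theorem continuous_bracketPow (s : ℝ) : Continuous (bracketPow s) := by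
  unfold bracketPow
  exact (by fun_prop : Continuous fun x : Plane => 1 + ‖x‖ ^ 2).rpow_const
    fun x => Or.inl (by positivity)

theorem bracketPow_mul_bracketPow (s t : ℝ) (x : Plane) :
    bracketPow s x * bracketPow t x = bracketPow (s + t) x := by
  unfold bracketPow
  rw [← Real.rpow_add (by positivity), add_div]

/-- A Peetre-type inequality, from `1 + |x|² ≤ 2(1 + ρ²)(1 + |y|²)`: moving a point a bounded
distance changes the weight by a bounded factor. It transfers decay from a node to its whole cell.
-/
theorem bracketPow_neg_le {t ρ : ℝ} (ht : 0 ≤ t) {x y : Plane} (hxy : ‖x - y‖ ≤ ρ) :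
    bracketPow (-t) y ≤ (2 * (1 + ρ ^ 2)) ^ (t / 2) * bracketPow (-t) x := by
  unfold bracketPow
  have hρ : 0 ≤ ρ := (norm_nonneg _).trans hxy
  have h1 : ‖x‖ ≤ ‖y‖ + ρ := by
    calc ‖x‖ = ‖y + (x - y)‖ := by abel_nf
      _ ≤ ‖y‖ + ‖x - y‖ := norm_add_le _ _
      _ ≤ _ := by linarith
  have h2 : 1 + ‖x‖ ^ 2 ≤ 2 * (1 + ρ ^ 2) * (1 + ‖y‖ ^ 2) := by
    have := pow_le_pow_left₀ (norm_nonneg x) h1 2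
    nlinarith [sq_nonneg (‖y‖ - ρ), sq_nonneg (ρ * ‖y‖)]
  rw [neg_div, Real.rpow_neg (by positivity), Real.rpow_neg (by positivity), inv_eq_one_div,
    ← div_eq_mul_inv, div_le_div_iff₀ (by positivity) (by positivity), one_mul,
    ← Real.mul_rpow (by positivity) (by positivity)]
  exact Real.rpow_le_rpow (by positivity) h2 (by positivity)

theorem integrable_bracketPow {t : ℝ} (ht : 2 < t) :
    Integrable (bracketPow (-t)) (volume : Measure Plane) := by
  have := integrable_rpow_neg_one_add_norm_sq (E := Plane) (μ := volume) (r := t)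
    (by simpa using ht)
  exact this

section

variable {E : Type*} [NormedAddCommGroup E]

theorem norm_le_bracketPow_cellIndex {t C h : ℝ} (ht : 0 ≤ t) (hC : 0 ≤ C) (hh : 0 < h)
    {g : Plane → E} (hg : ∀ x, ‖g x‖ ≤ C * bracketPow (-t) x) (x : Plane) :
    ‖g (node h (cellIndex h x))‖ ≤
      C * (2 * (1 + (2 * h) ^ 2)) ^ (t / 2) * bracketPow (-t) x := by
  refine (hg _).trans ?_
  rw [mul_assoc]
  exact mul_le_mul_of_nonneg_left (bracketPow_neg_le ht (norm_sub_node_cellIndex_le hh x)) hC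

theorem summable_norm_node {t C h : ℝ} (ht : 2 < t) (hh : 0 < h)
    {g : Plane → E} (hg : ∀ x, ‖g x‖ ≤ C * bracketPow (-t) x) :
    Summable fun n => ‖g (node h n)‖ := by
  have hC : 0 ≤ C := nonneg_of_mul_nonneg_left ((norm_nonneg _).trans (hg 0)) (bracketPow_pos _ _)
  rw [← integrable_comp_cellIndex_iff hh (g := fun n => g (node h n))]
  refine ((integrable_bracketPow ht).const_mul
    (C * (2 * (1 + (2 * h) ^ 2)) ^ (t / 2))).mono' ?_ (.of_forall fun x => ?_)
  · exact ((StronglyMeasurable.of_discrete (f := fun n => g (node h n))).comp_measurable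
      (measurable_cellIndex h)).aestronglyMeasurable
  · exact norm_le_bracketPow_cellIndex (by linarith) hC hh hg x

/-- A continuous family of functions that decays like `⟨x⟩^{-t}`, uniformly in the parameter. -/
def Decays (t : ℝ) (G : ℝ → Plane → E) : Prop :=
  Continuous (fun p : ℝ × Plane => G p.1 p.2) ∧
    ∃ C, ∀ h, |h| ≤ 1 → ∀ x, ‖G h x‖ ≤ C * bracketPow (-t) x

theorem Decays.continuous_apply {t : ℝ} {G : ℝ → Plane → E} (hG : Decays t G) (h : ℝ) :
    Continuous (G h) :=
  hG.1.comp (by fun_prop : Continuous fun x : Plane => (h, x))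

/-- The integrand may itself depend on `h`, as the residual does. Joint continuity gives pointwise
convergence of the step functions, and `t > 2` makes the weight integrable in the plane. -/
theorem Decays.tendsto_riemannSum [NormedSpace ℝ E] [CompleteSpace E] {t : ℝ} (ht : 2 < t)
    {G : ℝ → Plane → E} (hG : Decays t G) :
    Tendsto (fun h => h ^ 2 • ∑' n, G h (node h n)) (𝓝[>] 0) (𝓝 (∫ x, G 0 x)) := by
  obtain ⟨hc, C, hC⟩ := hG
  have hC0 : 0 ≤ C := nonneg_of_mul_nonneg_left
    ((norm_nonneg _).trans (hC 0 (by simp) 0)) (bracketPow_pos _ _)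
  have hsmall : ∀ᶠ h : ℝ in 𝓝[>] 0, 0 < h ∧ h ≤ 1 := by
    filter_upwards [Ioc_mem_nhdsGT (zero_lt_one' ℝ)] with h hh using hh
  have h1 : ∀ᶠ h : ℝ in 𝓝[>] 0,
      ∫ x, G h (node h (cellIndex h x)) = h ^ 2 • ∑' n, G h (node h n) := by
    filter_upwards [hsmall] with h hh
    exact integral_comp_cellIndex hh.1 (g := fun n => G h (node h n))
      (summable_norm_node ht hh.1 (hC h (by rw [abs_of_pos hh.1]; exact hh.2)))
  refine Tendsto.congr' h1 ?_
  refine tendsto_integral_filter_of_dominated_convergence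
    -- The constant of `norm_le_bracketPow_cellIndex` increases with `h`; its value at `h = 1`
    -- serves for all smaller meshes.
    (fun x => C * (2 * (1 + (2 * 1) ^ 2)) ^ (t / 2) * bracketPow (-t) x) ?_ ?_ ?_ ?_
  · refine .of_forall fun h => ?_
    exact ((StronglyMeasurable.of_discrete (f := fun n => G h (node h n))).comp_measurable
      (measurable_cellIndex h)).aestronglyMeasurable
  · filter_upwards [hsmall] with h hh
    refine .of_forall fun x => (norm_le_bracketPow_cellIndex (by linarith) hC0 hh.1
      (hC h (by rw [abs_of_pos hh.1]; exact hh.2)) x).trans ?_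
    refine mul_le_mul_of_nonneg_right (mul_le_mul_of_nonneg_left ?_ hC0) (bracketPow_nonneg _ _)
    refine Real.rpow_le_rpow (by nlinarith) ?_ (by linarith)
    nlinarith
  · exact (integrable_bracketPow ht).const_mul _
  · refine .of_forall fun x => ?_
    have h2 : Tendsto (fun h : ℝ => (h, node h (cellIndex h x))) (𝓝[>] 0) (𝓝 (0, x)) :=
      (tendsto_id.mono_left nhdsWithin_le_nhds).prodMk_nhds (tendsto_node_cellIndex x)
    exact (hc.tendsto (0, x)).comp h2

theorem Decays.norm_sq {t : ℝ} {G : ℝ → Plane → E} (hG : Decays t G) :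
    Decays (2 * t) fun h x => ‖G h x‖ ^ 2 := by
  obtain ⟨hc, C, hC⟩ := hG
  refine ⟨by fun_prop, C ^ 2, fun h hh x => ?_⟩
  have e : bracketPow (-(2 * t)) x = bracketPow (-t) x ^ 2 := by
    rw [sq, bracketPow_mul_bracketPow]
    ring_nf
  rw [Real.norm_of_nonneg (by positivity), e, ← mul_pow]
  exact pow_le_pow_left₀ (norm_nonneg _) (hC h hh x) 2

theorem Decays.tendsto_riemannSum_norm_sq {t : ℝ} (ht : 1 < t) {G : ℝ → Plane → E}
    (hG : Decays t G) :
    Tendsto (fun h => h ^ 2 * ∑' n, ‖G h (node h n)‖ ^ 2) (𝓝[>] 0) (𝓝 (∫ x, ‖G 0 x‖ ^ 2)) :=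
  hG.norm_sq.tendsto_riemannSum (by linarith)

theorem Decays.summable_norm_sq {t : ℝ} (ht : 1 < t) {G : ℝ → Plane → E}
    (hG : Decays t G) {h : ℝ} (h0 : 0 < h) (h1 : h ≤ 1) :
    Summable fun n => ‖G h (node h n)‖ ^ 2 := by
  obtain ⟨-, C, hC⟩ := hG.norm_sq
  simpa using summable_norm_node (by linarith) h0 (hC h (by rwa [abs_of_pos h0]))

theorem Decays.integrable {t : ℝ} (ht : 2 < t) {G : ℝ → Plane → E}
    (hG : Decays t G) {h : ℝ} (hh : |h| ≤ 1) : Integrable (G h) := by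
  obtain ⟨C, hC⟩ := hG.2
  exact ((integrable_bracketPow ht).const_mul C).mono' (hG.continuous_apply h).aestronglyMeasurable
    (.of_forall (hC h hh))

theorem Decays.memLp_two {t : ℝ} (ht : 1 < t) {G : ℝ → Plane → E}
    (hG : Decays t G) {h : ℝ} (hh : |h| ≤ 1) : MemLp (G h) 2 := by
  rw [memLp_two_iff_integrable_sq_norm (hG.continuous_apply h).aestronglyMeasurable]
  exact hG.norm_sq.integrable (by linarith) hh

end

/-! ### The Fourier transform on `L¹` and `L²` -/

section FourierTools

open FourierTransform SchwartzMap

variable {F : Type*} [NormedAddCommGroup F]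

theorem ae_eq_of_integral_schwartz_smul_eq [NormedSpace ℂ F] [CompleteSpace F] {v w : Plane → F}
    (hv : LocallyIntegrable v) (hw : LocallyIntegrable w)
    (h : ∀ ψ : 𝓢(Plane, ℂ), ∫ x, ψ x • v x = ∫ x, ψ x • w x) : v =ᵐ[volume] w := by
  refine ae_eq_of_integral_contDiff_smul_eq hv hw fun g hg hgc => ?_
  have h1 : HasCompactSupport (Complex.ofRealCLM ∘ g) := hgc.comp_left rfl
  have h2 : ContDiff ℝ ∞ (Complex.ofRealCLM ∘ g) := by fun_prop
  simpa using h (h1.toSchwartzMap h2)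

/-- Fubini; this links the pointwise integral `𝓕⁻ g` with the transform defined by duality on
tempered distributions. -/
theorem integral_fourierInv_schwartz_smul [NormedSpace ℂ F] [CompleteSpace F] (ψ : 𝓢(Plane, ℂ))
    {g : Plane → F} (hg : Integrable g) :
    ∫ x, (𝓕⁻ ψ : 𝓢(Plane, ℂ)) x • g x = ∫ x, ψ x • 𝓕⁻ g x := by
  rw [SchwartzMap.fourierInv_coe]
  have h1 := VectorFourier.integral_fourierIntegral_smul_eq_flip (e := Real.fourierChar)
    (μ := (volume : Measure Plane)) (ν := (volume : Measure Plane)) (L := -innerₗ Plane)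
    (f := ψ) (g := g) Real.continuous_fourierChar
    (by
      have : Continuous fun p : Plane × Plane => -(inner ℝ p.1 p.2 : ℝ) := by fun_prop
      exact this) ψ.integrable hg
  have h2 : (-innerₗ Plane).flip = -innerₗ Plane := by
    ext x y
    simp [real_inner_comm]
  rw [h2] at h1
  exact h1

theorem continuous_fourierInv [NormedSpace ℂ F] [CompleteSpace F] {g : Plane → F}
    (hg : Integrable g) : Continuous (𝓕⁻ g) := by
  rw [← Real.Lp.fourierTransformInv_toLp (memLp_one_iff_integrable.2 hg)]
  exact BoundedContinuousFunction.continuous _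

theorem norm_fourierInv_le [NormedSpace ℂ F] (g : Plane → F) (x : Plane) :
    ‖𝓕⁻ g x‖ ≤ ∫ η, ‖g η‖ :=
  VectorFourier.norm_fourierIntegral_le_integral_norm _ _ _ _ _

/-- A continuous function in `H^m(ℝ²)` with `m > 1` is bounded. -/
theorem MemH.exists_bound [InnerProductSpace ℂ F] [CompleteSpace F] {m : ℝ} (hm : 1 < m)
    {f : Plane → F} (hf : MemH m f) (hc : Continuous f) : ∃ C, ∀ x, ‖f x‖ ≤ C := by
  obtain ⟨hf2, hs⟩ := hf
  -- Sobolev embedding: `m` exceeds half the dimension, so the Fourier transform of `f` is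
  -- integrable and `f` is the inverse transform of an `L¹` function.
  obtain ⟨v, hv⟩ := hs.fourier_memL1 (by simp; linarith)
  have hvi : Integrable (v : Plane → F) := L1.integrable_coeFn v
  have h1 : f =ᵐ[volume] 𝓕⁻ (v : Plane → F) := by
    refine ae_eq_of_integral_schwartz_smul_eq hc.locallyIntegrable
      (continuous_fourierInv hvi).locallyIntegrable fun ψ => ?_
    rw [← integral_fourierInv_schwartz_smul ψ hvi, ← Lp.toTemperedDistribution_apply, ← hv,
      TemperedDistribution.fourier_apply, FourierTransform.fourier_fourierInv_eq,
      Lp.toTemperedDistribution_apply]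
    refine integral_congr_ae ?_
    filter_upwards [hf2.coeFn_toLp] with x hx
    rw [hx]
  have h2 : f = 𝓕⁻ (v : Plane → F) :=
    (Continuous.ae_eq_iff_eq volume hc (continuous_fourierInv hvi)).1 h1
  exact ⟨∫ η, ‖v η‖, fun x => by
    rw [h2]
    exact norm_fourierInv_le _ x⟩

/-- Both inverse transforms have the same pairing with every Schwartz function. Hence the integral
formula inherits Plancherel, and the `L²` solution acquires a continuous representative. -/
theorem coeFn_fourierInv_toLp [InnerProductSpace ℂ F] [CompleteSpace F] {g : Plane → F}
    (h1 : Integrable g) (h2 : MemLp g 2) :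
    (𝓕⁻ (h2.toLp g) : Lp F 2 (volume : Measure Plane)) =ᵐ[volume] 𝓕⁻ g := by
  refine ae_eq_of_integral_schwartz_smul_eq ((Lp.memLp _).locallyIntegrable (by norm_num))
    (continuous_fourierInv h1).locallyIntegrable fun ψ => ?_
  rw [← integral_fourierInv_schwartz_smul ψ h1, ← Lp.toTemperedDistribution_apply,
    ← Lp.fourierInv_toTemperedDistribution_eq, TemperedDistribution.fourierInv_apply,
    Lp.toTemperedDistribution_apply]
  refine integral_congr_ae ?_
  filter_upwards [h2.coeFn_toLp] with x hx
  rw [hx]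

theorem eLpNorm_fourierInv [InnerProductSpace ℂ F] [CompleteSpace F] {g : Plane → F}
    (h1 : Integrable g) (h2 : MemLp g 2) :
    eLpNorm (𝓕⁻ g) 2 volume = eLpNorm g 2 volume := by
  rw [← eLpNorm_congr_ae (coeFn_fourierInv_toLp h1 h2), ← eLpNorm_congr_ae h2.coeFn_toLp,
    ← Lp.enorm_def, ← Lp.enorm_def, ← ofReal_norm, ← ofReal_norm]
  congr 1
  exact (Lp.fourierTransformₗᵢ Plane F).symm.norm_map _

end FourierTools

/-! ### Calculus of partial derivatives -/

theorem contDiff_partialDeriv {φ : Plane → ℂ} (hφ : ContDiff ℝ ∞ φ) (j : Fin 2) :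
    ContDiff ℝ ∞ (partialDeriv j φ) :=
  (hφ.fderiv_right (m := ∞) le_rfl).clm_apply contDiff_const

theorem hasCompactSupport_partialDeriv {φ : Plane → ℂ} (hφ : HasCompactSupport φ) (j : Fin 2) :
    HasCompactSupport (partialDeriv j φ) :=
  hφ.fderiv_apply ℝ _

theorem ContDiff.differentiable_infty {φ : Plane → ℂ} (hφ : ContDiff ℝ ∞ φ) :
    Differentiable ℝ φ := hφ.differentiable (by simp)

theorem partialDeriv_mul {a b : Plane → ℂ} (ha : ContDiff ℝ ∞ a) (hb : ContDiff ℝ ∞ b)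
    (j : Fin 2) : partialDeriv j (fun x => a x * b x) =
      fun x => a x * partialDeriv j b x + partialDeriv j a x * b x := by
  ext x
  have h1 := (ContDiff.differentiable_infty ha x)
  have h2 := (ContDiff.differentiable_infty hb x)
  simp only [partialDeriv]
  rw [fderiv_fun_mul h1 h2]
  simp
  ring

theorem partialDeriv_add {a b : Plane → ℂ} (ha : ContDiff ℝ ∞ a) (hb : ContDiff ℝ ∞ b)
    (j : Fin 2) : partialDeriv j (fun x => a x + b x) =
      fun x => partialDeriv j a x + partialDeriv j b x := by
  ext x
  simp only [partialDeriv]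
  rw [fderiv_fun_add (ContDiff.differentiable_infty ha x) (ContDiff.differentiable_infty hb x)]
  simp

theorem partialDeriv_const_mul {a : Plane → ℂ} (ha : ContDiff ℝ ∞ a) (c : ℂ)
    (j : Fin 2) : partialDeriv j (fun x => c * a x) = fun x => c * partialDeriv j a x := by
  rw [partialDeriv_mul contDiff_const ha]
  ext x
  simp [partialDeriv]

theorem partialDeriv_comp_smul {a : Plane → ℂ} (ha : ContDiff ℝ ∞ a) (δ : ℝ) (j : Fin 2) :
    partialDeriv j (fun x => a (δ • x)) = fun x => (δ : ℂ) * partialDeriv j a (δ • x) := by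
  ext x
  have h1 : HasFDerivAt (fun x : Plane => δ • x) (δ • ContinuousLinearMap.id ℝ Plane) x :=
    (hasFDerivAt_id x).const_smul δ
  have h2 := ((ContDiff.differentiable_infty ha (δ • x)).hasFDerivAt).comp x h1
  simp only [partialDeriv]
  rw [show (fun x => a (δ • x)) = a ∘ fun x => δ • x from rfl, h2.fderiv]
  simp

theorem partialDeriv_comm {φ : Plane → ℂ} (hφ : ContDiff ℝ ∞ φ) (i j : Fin 2) :
    partialDeriv i (partialDeriv j φ) = partialDeriv j (partialDeriv i φ) := by
  ext x
  have h1 : IsSymmSndFDerivAt ℝ φ x := hφ.contDiffAt.isSymmSndFDerivAt (by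
    rw [minSmoothness_of_isRCLikeNormedField]
    exact WithTop.coe_le_coe.2 (le_top : ((2 : ℕ) : ℕ∞) ≤ ⊤))
  have h2 : DifferentiableAt ℝ (fderiv ℝ φ) x :=
    (hφ.fderiv_right (m := ∞) le_rfl).differentiable (by simp) x
  have h3 : ∀ k l : Fin 2, partialDeriv k (partialDeriv l φ) x =
      fderiv ℝ (fderiv ℝ φ) x (EuclideanSpace.single k 1) (EuclideanSpace.single l 1) :=
    fun k l => by
      change fderiv ℝ (fun y => fderiv ℝ φ y (EuclideanSpace.single l 1)) x
        (EuclideanSpace.single k 1) = _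
      rw [fderiv_clm_apply h2 (differentiableAt_const _)]
      simp
  rw [h3, h3]
  exact h1.eq _ _

theorem contDiff_contHamiltonian {φ : Plane → ℂ} (hφ : ContDiff ℝ ∞ φ) :
    ContDiff ℝ ∞ (contHamiltonian φ) := by
  have h := fun i j => contDiff_partialDeriv (contDiff_partialDeriv hφ i) j
  exact contDiff_const.mul (((h 0 0).sub (h 1 0)).add (h 1 1))

theorem hasCompactSupport_contHamiltonian {φ : Plane → ℂ} (hφ : HasCompactSupport φ) :
    HasCompactSupport (contHamiltonian φ) := by
  have h := fun i j => hasCompactSupport_partialDeriv (hasCompactSupport_partialDeriv hφ i) j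
  exact (((h 0 0).sub (h 1 0)).add (h 1 1)).mul_left

theorem contHamiltonian_mul {a b : Plane → ℂ} (ha : ContDiff ℝ ∞ a) (hb : ContDiff ℝ ∞ b)
    (x : Plane) : contHamiltonian (fun x => a x * b x) x =
      a x * contHamiltonian b x + contHamiltonian a x * b x -
        1 / 9 * ((2 * partialDeriv 0 a x - partialDeriv 1 a x) * partialDeriv 0 b x +
          (2 * partialDeriv 1 a x - partialDeriv 0 a x) * partialDeriv 1 b x) := by
  have ha' := contDiff_partialDeriv ha
  have hb' := contDiff_partialDeriv hb
  simp only [contHamiltonian]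
  rw [partialDeriv_mul ha hb, partialDeriv_mul ha hb]
  rw [partialDeriv_add (ha.mul (hb' 0)) ((ha' 0).mul hb),
    partialDeriv_add (ha.mul (hb' 1)) ((ha' 1).mul hb),
    partialDeriv_add (ha.mul (hb' 1)) ((ha' 1).mul hb),
    partialDeriv_mul ha (hb' 0), partialDeriv_mul (ha' 0) hb,
    partialDeriv_mul ha (hb' 1), partialDeriv_mul (ha' 1) hb,
    partialDeriv_mul ha (hb' 1), partialDeriv_mul (ha' 1) hb]
  ring

theorem contHamiltonian_comp_smul {a : Plane → ℂ} (ha : ContDiff ℝ ∞ a) (δ : ℝ) (x : Plane) :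
    contHamiltonian (fun x => a (δ • x)) x = (δ : ℂ) ^ 2 * contHamiltonian a (δ • x) := by
  have ha' := contDiff_partialDeriv ha
  have hs : ∀ j, ContDiff ℝ ∞ fun x => partialDeriv j a (δ • x) := fun j =>
    (ha' j).comp (contDiff_const_smul δ)
  simp only [contHamiltonian]
  rw [partialDeriv_comp_smul ha, partialDeriv_comp_smul ha, partialDeriv_const_mul (hs 0),
    partialDeriv_const_mul (hs 1), partialDeriv_const_mul (hs 1), partialDeriv_comp_smul (ha' 0),
    partialDeriv_comp_smul (ha' 1), partialDeriv_comp_smul (ha' 1)]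
  ring

theorem contHamiltonian_add {a b : Plane → ℂ} (ha : ContDiff ℝ ∞ a) (hb : ContDiff ℝ ∞ b)
    (x : Plane) : contHamiltonian (fun x => a x + b x) x =
      contHamiltonian a x + contHamiltonian b x := by
  have ha' := contDiff_partialDeriv ha
  have hb' := contDiff_partialDeriv hb
  simp only [contHamiltonian]
  rw [partialDeriv_add ha hb, partialDeriv_add ha hb, partialDeriv_add (ha' 0) (hb' 0),
    partialDeriv_add (ha' 1) (hb' 1), partialDeriv_add (ha' 1) (hb' 1)]
  ring

theorem contHamiltonian_const_mul {a : Plane → ℂ} (ha : ContDiff ℝ ∞ a) (c : ℂ)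
    (x : Plane) : contHamiltonian (fun x => c * a x) x = c * contHamiltonian a x := by
  have ha' := contDiff_partialDeriv ha
  simp only [contHamiltonian]
  rw [partialDeriv_const_mul ha, partialDeriv_const_mul ha, partialDeriv_const_mul (ha' 0),
    partialDeriv_const_mul (ha' 1), partialDeriv_const_mul (ha' 1)]
  ring

section

open SchwartzMap LineDeriv

/-- The operator `P(D)` on Schwartz functions. -/
def schwartzHamiltonian (ψ : 𝓢(Plane, ℂ)) : 𝓢(Plane, ℂ) :=
  (-(1 / 9 : ℂ)) • (∂_{EuclideanSpace.single (0 : Fin 2) (1 : ℝ)}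
      (∂_{EuclideanSpace.single (0 : Fin 2) (1 : ℝ)} ψ) -
    ∂_{EuclideanSpace.single (0 : Fin 2) (1 : ℝ)}
      (∂_{EuclideanSpace.single (1 : Fin 2) (1 : ℝ)} ψ) +
    ∂_{EuclideanSpace.single (1 : Fin 2) (1 : ℝ)}
      (∂_{EuclideanSpace.single (1 : Fin 2) (1 : ℝ)} ψ))

theorem schwartzHamiltonian_apply (ψ : 𝓢(Plane, ℂ)) (x : Plane) :
    schwartzHamiltonian ψ x = contHamiltonian ψ x := rfl

theorem contDiff_schwartz (ψ : 𝓢(Plane, ℂ)) : ContDiff ℝ ∞ ψ := ψ.smooth ⊤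

end

/-! ### The weak form of `P(D) v = w` -/

/-- `P(D) v = w` in the sense of distributions. -/
def WeakHamiltonian {F : Type*} [NormedAddCommGroup F] [NormedSpace ℂ F] (v w : Plane → F) :
    Prop :=
  ∀ φ : Plane → ℂ, ContDiff ℝ ∞ φ → HasCompactSupport φ →
    ∫ x, contHamiltonian φ x • v x = ∫ x, φ x • w x

section

open SchwartzMap FourierTransform

variable {F : Type*} [NormedAddCommGroup F] [InnerProductSpace ℂ F]

theorem exists_cutoff : ∃ χ : Plane → ℂ, ContDiff ℝ ∞ χ ∧ HasCompactSupport χ ∧ χ 0 = 1 := by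
  let b : ContDiffBump (0 : Plane) := ⟨1, 2, one_pos, one_lt_two⟩
  refine ⟨fun x => (b x : ℂ), Complex.ofRealCLM.contDiff.comp b.contDiff,
    b.hasCompactSupport.comp_left (g := fun t : ℝ => (t : ℂ)) Complex.ofReal_zero, ?_⟩
  have : b (0 : Plane) = 1 := b.one_of_mem_closedBall (by simp [b])
  simp [this]

theorem exists_bound_of_hasCompactSupport {a : Plane → ℂ} (ha : Continuous a)
    (hc : HasCompactSupport a) : ∃ M, 0 ≤ M ∧ ∀ x, ‖a x‖ ≤ M := by
  obtain ⟨M, hM⟩ := hc.exists_bound_of_continuous ha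
  exact ⟨M, (norm_nonneg _).trans (hM 0), hM⟩

theorem memLp_schwartz (ψ : 𝓢(Plane, ℂ)) : MemLp ψ 2 (volume : Measure Plane) := ψ.memLp 2 _

theorem integrable_smul_of_memLp_two {a : Plane → ℂ} {v : Plane → F}
    (ha : MemLp a 2 (volume : Measure Plane)) (hv : MemLp v 2 (volume : Measure Plane)) :
    Integrable (fun x => a x • v x) :=
  memLp_one_iff_integrable.1 (hv.smul ha)

/-- The test function `χ(δx)ψ(x)` has compact support. By Leibniz every term in which a derivative
falls on `χ` carries a factor `δ` or `δ²`, so dominated convergence as `δ → 0` leaves the identity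
for `ψ`. -/
theorem WeakHamiltonian.schwartz {v w : Plane → F} (hv : MemLp v 2 (volume : Measure Plane))
    (hw : MemLp w 2 (volume : Measure Plane)) (h : WeakHamiltonian v w) (ψ : 𝓢(Plane, ℂ)) :
    ∫ x, schwartzHamiltonian ψ x • v x = ∫ x, ψ x • w x := by
  obtain ⟨χ, hχ, hχc, hχ0⟩ := exists_cutoff
  have hχ' := contDiff_partialDeriv hχ
  have hψ := contDiff_schwartz ψ
  obtain ⟨M, hM0, hM⟩ := exists_bound_of_hasCompactSupport hχ.continuous hχc
  obtain ⟨M₂, hM₂0, hM₂⟩ := exists_bound_of_hasCompactSupport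
    (contDiff_contHamiltonian hχ).continuous (hasCompactSupport_contHamiltonian hχc)
  obtain ⟨M₃, hM₃0, hM₃⟩ := exists_bound_of_hasCompactSupport
    (a := fun x => 1 / 9 * (2 * partialDeriv 0 χ x - partialDeriv 1 χ x))
    (contDiff_const.mul ((contDiff_const.mul (hχ' 0)).sub (hχ' 1))).continuous
    (((hasCompactSupport_partialDeriv hχc 0).mul_left).sub
      (hasCompactSupport_partialDeriv hχc 1)).mul_left
  obtain ⟨M₄, hM₄0, hM₄⟩ := exists_bound_of_hasCompactSupport
    (a := fun x => 1 / 9 * (2 * partialDeriv 1 χ x - partialDeriv 0 χ x))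
    (contDiff_const.mul ((contDiff_const.mul (hχ' 1)).sub (hχ' 0))).continuous
    (((hasCompactSupport_partialDeriv hχc 1).mul_left).sub
      (hasCompactSupport_partialDeriv hχc 0)).mul_left
  let δ : ℕ → ℝ := fun n => 1 / ((n : ℝ) + 1)
  have hδ0 : ∀ n, 0 < δ n := fun n => by positivity
  have hδ1 : ∀ n, δ n ≤ 1 := fun n => by
    rw [div_le_one (by positivity)]
    linarith [n.cast_nonneg (α := ℝ)]
  have hδlim : Tendsto δ atTop (𝓝 0) := tendsto_one_div_add_atTop_nhds_zero_nat
  have hδx : ∀ x : Plane, Tendsto (fun n => δ n • x) atTop (𝓝 0) := fun x => by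
    simpa using hδlim.smul_const x
  let d₀ : 𝓢(Plane, ℂ) := LineDeriv.lineDerivOp (EuclideanSpace.single (0 : Fin 2) (1 : ℝ)) ψ
  let d₁ : 𝓢(Plane, ℂ) := LineDeriv.lineDerivOp (EuclideanSpace.single (1 : Fin 2) (1 : ℝ)) ψ
  have hsm : ∀ n, ContDiff ℝ ∞ fun x : Plane => χ (δ n • x) := fun n =>
    hχ.comp (contDiff_const_smul (δ n))
  have hcs : ∀ n, HasCompactSupport fun x : Plane => χ (δ n • x) := fun n =>
    hχc.comp_homeomorph (Homeomorph.smulOfNeZero (δ n) (hδ0 n).ne')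
  have key : ∀ n, ∫ x, contHamiltonian (fun x => χ (δ n • x) * ψ x) x • v x =
      ∫ x, (χ (δ n • x) * ψ x) • w x := fun n =>
    h _ ((hsm n).mul hψ) (hcs n).mul_right
  have hexp : ∀ n x, contHamiltonian (fun x => χ (δ n • x) * ψ x) x =
      χ (δ n • x) * schwartzHamiltonian ψ x +
        (δ n : ℂ) ^ 2 * contHamiltonian χ (δ n • x) * ψ x -
        ((δ n : ℂ) * (1 / 9 * (2 * partialDeriv 0 χ (δ n • x) - partialDeriv 1 χ (δ n • x))) *
            d₀ x +
          (δ n : ℂ) * (1 / 9 * (2 * partialDeriv 1 χ (δ n • x) - partialDeriv 0 χ (δ n • x))) *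
            d₁ x) := fun n x => by
    have e0 : d₀ x = partialDeriv 0 ψ x := rfl
    have e1 : d₁ x = partialDeriv 1 ψ x := rfl
    rw [contHamiltonian_mul (hsm n) hψ, contHamiltonian_comp_smul hχ, partialDeriv_comp_smul hχ,
      partialDeriv_comp_smul hχ, schwartzHamiltonian_apply, e0, e1]
    ring
  have hlim1 : Tendsto (fun n => ∫ x, (χ (δ n • x) * ψ x) • w x) atTop
      (𝓝 (∫ x, ψ x • w x)) := by
    refine tendsto_integral_of_dominated_convergence (fun x => M * ‖ψ x • w x‖) (fun n => ?_)
      ((integrable_smul_of_memLp_two (memLp_schwartz ψ) hw).norm.const_mul M)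
      (fun n => .of_forall fun x => ?_) (.of_forall fun x => ?_)
    · exact (((hsm n).mul hψ).continuous.aestronglyMeasurable).smul hw.1
    · rw [mul_smul, norm_smul]
      gcongr
      exact hM _
    · have h1 := (hχ.continuous.tendsto 0).comp (hδx x)
      rw [hχ0] at h1
      simpa using (h1.mul_const (ψ x)).smul_const (w x)
  have hlim2 : Tendsto (fun n => ∫ x, contHamiltonian (fun x => χ (δ n • x) * ψ x) x • v x) atTop
      (𝓝 (∫ x, schwartzHamiltonian ψ x • v x)) := by
    refine tendsto_integral_of_dominated_convergence (fun x =>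
      M * ‖schwartzHamiltonian ψ x • v x‖ + M₂ * ‖ψ x • v x‖ +
        (M₃ * ‖d₀ x • v x‖ + M₄ * ‖d₁ x • v x‖)) (fun n => ?_) ?_
      (fun n => .of_forall fun x => ?_) (.of_forall fun x => ?_)
    · exact ((contDiff_contHamiltonian ((hsm n).mul hψ)).continuous.aestronglyMeasurable).smul hv.1
    · have hi := fun θ : 𝓢(Plane, ℂ) =>
        (integrable_smul_of_memLp_two (memLp_schwartz θ) hv).norm
      exact (((hi _).const_mul M).add ((hi _).const_mul M₂)).add
        (((hi _).const_mul M₃).add ((hi _).const_mul M₄))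
    · rw [hexp, norm_smul, norm_smul, norm_smul, norm_smul, norm_smul]
      have hn : ‖(δ n : ℂ)‖ ≤ 1 := by
        rw [Complex.norm_real, Real.norm_of_nonneg (hδ0 n).le]
        exact hδ1 n
      have t1 : ‖χ (δ n • x) * schwartzHamiltonian ψ x‖ ≤ M * ‖schwartzHamiltonian ψ x‖ := by
        rw [norm_mul]
        gcongr
        exact hM _
      have t2 : ‖(δ n : ℂ) ^ 2 * contHamiltonian χ (δ n • x) * ψ x‖ ≤ M₂ * ‖ψ x‖ := by
        rw [norm_mul, norm_mul, norm_pow]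
        gcongr
        calc _ ≤ 1 ^ 2 * M₂ := by
              gcongr
              exact hM₂ _
          _ = M₂ := by ring
      have t3 : ‖(δ n : ℂ) * (1 / 9 * (2 * partialDeriv 0 χ (δ n • x) -
          partialDeriv 1 χ (δ n • x))) * d₀ x‖ ≤ M₃ * ‖d₀ x‖ := by
        rw [norm_mul, norm_mul]
        gcongr
        calc _ ≤ 1 * M₃ := mul_le_mul hn (hM₃ _) (norm_nonneg _) zero_le_one
          _ = M₃ := by ring
      have t4 : ‖(δ n : ℂ) * (1 / 9 * (2 * partialDeriv 1 χ (δ n • x) -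
          partialDeriv 0 χ (δ n • x))) * d₁ x‖ ≤ M₄ * ‖d₁ x‖ := by
        rw [norm_mul, norm_mul]
        gcongr
        calc _ ≤ 1 * M₄ := mul_le_mul hn (hM₄ _) (norm_nonneg _) zero_le_one
          _ = M₄ := by ring
      have t := (norm_sub_le (χ (δ n • x) * schwartzHamiltonian ψ x +
        (δ n : ℂ) ^ 2 * contHamiltonian χ (δ n • x) * ψ x) _).trans
        (add_le_add ((norm_add_le _ _).trans (add_le_add t1 t2))
          ((norm_add_le _ _).trans (add_le_add t3 t4)))
      calc _ ≤ _ := mul_le_mul_of_nonneg_right t (norm_nonneg (v x))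
        _ = _ := by ring
    · simp_rw [hexp]
      have hδc : Tendsto (fun n => (δ n : ℂ)) atTop (𝓝 0) := by
        rw [← Complex.ofReal_zero]
        exact (Complex.continuous_ofReal.tendsto 0).comp hδlim
      have hc : ∀ {a : Plane → ℂ}, ContDiff ℝ ∞ a →
          Tendsto (fun n => a (δ n • x)) atTop (𝓝 (a 0)) := fun ha =>
        (ha.continuous.tendsto 0).comp (hδx x)
      have l1 := (hc hχ).mul_const (schwartzHamiltonian ψ x)
      have l2 := ((hδc.pow 2).mul (hc (contDiff_contHamiltonian hχ))).mul_const (ψ x)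
      have l3 := (hδc.mul (((hc (hχ' 0)).const_mul 2).sub (hc (hχ' 1)) |>.const_mul
        (1 / 9))).mul_const
        (d₀ x)
      have l4 := (hδc.mul (((hc (hχ' 1)).const_mul 2).sub (hc (hχ' 0)) |>.const_mul
        (1 / 9))).mul_const
        (d₁ x)
      have l := ((l1.add l2).sub (l3.add l4)).smul_const (v x)
      simpa [hχ0] using l
  refine tendsto_nhds_unique hlim2 ?_
  simp_rw [key]
  exact hlim1

/-- The symbol of `P(D)` in the normalization `e^{2πi x·η}`. -/
def contSymbol (η : Plane) : ℝ := 4 * Real.pi ^ 2 / 9 * (η 0 ^ 2 - η 0 * η 1 + η 1 ^ 2)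

theorem continuous_contSymbol : Continuous contSymbol := by
  unfold contSymbol
  fun_prop

/-- Each `∂_j` turns into multiplication by `-2πiη_j` under the transform; being quadratic, the
symbol stays real and the sign is immaterial. Asking for `θ` as a Schwartz function lets the
identity be transposed to distributions. -/
theorem exists_schwartzHamiltonian_fourier (ψ : 𝓢(Plane, ℂ)) : ∃ θ : 𝓢(Plane, ℂ),
    schwartzHamiltonian (𝓕 ψ) = 𝓕 θ ∧ ∀ η, θ η = contSymbol η * ψ η := by
  have hg : ∀ m : Plane, (inner ℝ · m : Plane → ℝ).HasTemperateGrowth := fun m => by fun_prop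
  let T : Fin 2 → 𝓢(Plane, ℂ) → 𝓢(Plane, ℂ) := fun j θ =>
    (-(2 * Real.pi * Complex.I)) •
      SchwartzMap.smulLeftCLM ℂ (inner ℝ · (EuclideanSpace.single j (1 : ℝ)) : Plane → ℝ) θ
  have hT : ∀ j θ, LineDeriv.lineDerivOp (EuclideanSpace.single j (1 : ℝ)) (𝓕 θ) = 𝓕 (T j θ) :=
    fun j θ => SchwartzMap.lineDerivOp_fourier_eq θ _
  have hTa : ∀ j θ η, T j θ η = -(2 * Real.pi * Complex.I) * (η j * θ η) := fun j θ η => by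
    simp only [T, smul_apply]
    rw [SchwartzMap.smulLeftCLM_apply_apply (hg _)]
    simp [EuclideanSpace.inner_single_right]
  clear_value T
  refine ⟨(-(1 / 9 : ℂ)) • (T 0 (T 0 ψ) - T 0 (T 1 ψ) + T 1 (T 1 ψ)), ?_, ?_⟩
  · unfold schwartzHamiltonian
    rw [hT, hT, hT, hT, hT, FourierTransform.fourier_smul, FourierTransform.fourier_add,
      sub_eq_add_neg, sub_eq_add_neg, FourierTransform.fourier_add, FourierTransform.fourier_neg]
  · intro η
    simp only [smul_apply, add_apply, sub_apply, hTa,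
      contSymbol, smul_eq_mul]
    push_cast
    linear_combination (-(4 * Real.pi ^ 2 / 9) * (η 0 ^ 2 - η 0 * η 1 + η 1 ^ 2) * ψ η : ℂ) *
      Complex.I_sq

variable [CompleteSpace F]

theorem WeakHamiltonian.fourier {v w : Lp F 2 (volume : Measure Plane)}
    (h : WeakHamiltonian (v : Plane → F) w) :
    ∀ᵐ η : Plane, (𝓕 w : Lp F 2 (volume : Measure Plane)) η =
      (contSymbol η : ℂ) • (𝓕 v : Lp F 2 (volume : Measure Plane)) η := by
  have hl : ∀ g : Lp F 2 (volume : Measure Plane), LocallyIntegrable (g : Plane → F) := fun g =>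
    (Lp.memLp g).locallyIntegrable (by norm_num)
  refine ae_eq_of_integral_schwartz_smul_eq (hl _) ((hl _).continuous_smul
    (Complex.continuous_ofReal.comp continuous_contSymbol)) fun ψ => ?_
  obtain ⟨θ, h1, h2⟩ := exists_schwartzHamiltonian_fourier ψ
  have h3 := h.schwartz (Lp.memLp v) (Lp.memLp w) (𝓕 ψ)
  rw [h1, ← Lp.toTemperedDistribution_apply, ← Lp.toTemperedDistribution_apply,
    ← TemperedDistribution.fourier_apply, ← TemperedDistribution.fourier_apply,
    Lp.fourier_toTemperedDistribution_eq, Lp.fourier_toTemperedDistribution_eq,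
    Lp.toTemperedDistribution_apply, Lp.toTemperedDistribution_apply] at h3
  rw [← h3]
  refine integral_congr_ae (.of_forall fun η => ?_)
  simp only [h2, smul_smul]
  rw [mul_comm]

/-- On the Fourier side the inner product is the integral of the real symbol against `|v̂|²`. This
plays the part of self-adjointness for the unbounded operator `P(D)`, with no domain to describe. -/
theorem WeakHamiltonian.im_inner_eq_zero {v w : Lp F 2 (volume : Measure Plane)}
    (h : WeakHamiltonian (v : Plane → F) w) : (inner ℂ v w).im = 0 := by
  rw [← Lp.inner_fourier_eq, L2.inner_def]
  have h1 : ∀ᵐ η : Plane, inner ℂ ((𝓕 v : Lp F 2 (volume : Measure Plane)) η)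
      ((𝓕 w : Lp F 2 (volume : Measure Plane)) η) =
        ((contSymbol η * ‖(𝓕 v : Lp F 2 (volume : Measure Plane)) η‖ ^ 2 : ℝ) : ℂ) := by
    filter_upwards [h.fourier] with η hη
    rw [hη, inner_smul_right, inner_self_eq_norm_sq_to_K]
    push_cast
    rfl
  rw [integral_congr_ae h1, integral_complex_ofReal]
  exact Complex.ofReal_im _

end

/-! ### The continuum equation -/

section

open SchwartzMap FourierTransform

variable {F : Type*} [NormedAddCommGroup F] [InnerProductSpace ℂ F]

theorem memLp_bounded_smul {V : Plane → ℂ} (hVc : Continuous V) {C : ℝ} (hV : ∀ x, ‖V x‖ ≤ C)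
    {v : Plane → F} (hv : MemLp v 2 (volume : Measure Plane)) :
    MemLp (fun x => V x • v x) 2 (volume : Measure Plane) := by
  have : MemLp V ⊤ (volume : Measure Plane) :=
    memLp_top_of_bound hVc.aestronglyMeasurable C (.of_forall hV)
  exact hv.smul this

theorem memLp_two_of_contDiff {φ : Plane → ℂ} (hφ : ContDiff ℝ ∞ φ) (hc : HasCompactSupport φ) :
    MemLp φ 2 (volume : Measure Plane) :=
  hφ.continuous.memLp_of_hasCompactSupport hc

/-- Because `V` is bounded, `V v` lies in `L²` and the potential can be moved to the right side,
where only the constant-coefficient operator remains to be Fourier transformed. -/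
theorem weakHamiltonian_iff {V : Plane → ℝ} (hVc : Continuous V) {C : ℝ} (hV : ∀ x, |V x| ≤ C)
    {z : ℂ} {v g : Plane → F} (hv : MemLp v 2 (volume : Measure Plane))
    (hg : MemLp g 2 (volume : Measure Plane)) :
    WeakHamiltonian v (fun x => z • v x - (V x : ℂ) • v x + g x) ↔
      ∀ φ : Plane → ℂ, ContDiff ℝ ∞ φ → HasCompactSupport φ →
        ∫ x, (contHamiltonian φ x + ((V x : ℂ) - z) * φ x) • v x = ∫ x, φ x • g x := by
  have hVv : MemLp (fun x => (V x : ℂ) • v x) 2 (volume : Measure Plane) :=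
    memLp_bounded_smul (Complex.continuous_ofReal.comp hVc) (by simpa using hV) hv
  refine forall₃_congr fun φ hφ hc => ?_
  have hφ2 := memLp_two_of_contDiff hφ hc
  have i1 := integrable_smul_of_memLp_two (memLp_two_of_contDiff (contDiff_contHamiltonian hφ)
    (hasCompactSupport_contHamiltonian hc)) hv
  have hsub : MemLp (fun x => z • v x - (V x : ℂ) • v x) 2 (volume : Measure Plane) :=
    (hv.const_smul z).sub hVv
  have i2 := integrable_smul_of_memLp_two hφ2 hsub
  have i3 := integrable_smul_of_memLp_two hφ2 hg
  have e1 : ∫ x, (contHamiltonian φ x + ((V x : ℂ) - z) * φ x) • v x =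
      (∫ x, contHamiltonian φ x • v x) - ∫ x, φ x • (z • v x - (V x : ℂ) • v x) := by
    rw [← integral_sub i1 i2]
    refine integral_congr_ae (.of_forall fun x => ?_)
    simp only [add_smul, smul_sub, smul_smul, sub_mul, sub_smul]
    rw [mul_comm (φ x), mul_comm (φ x)]
    abel
  have e2 : ∫ x, φ x • (z • v x - (V x : ℂ) • v x + g x) =
      (∫ x, φ x • (z • v x - (V x : ℂ) • v x)) + ∫ x, φ x • g x := by
    rw [← integral_add i2 i3]
    simp only [smul_add]
  rw [e1, e2]
  constructor
  · intro h
    rw [h]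
    abel
  · intro h
    rw [← h]
    abel

theorem WeakHamiltonian.congr {v v' w w' : Plane → F} (h : WeakHamiltonian v w)
    (hv : v =ᵐ[volume] v') (hw : w =ᵐ[volume] w') : WeakHamiltonian v' w' := fun φ hφ hc => by
  have e1 : ∫ x, contHamiltonian φ x • v x = ∫ x, contHamiltonian φ x • v' x :=
    integral_congr_ae (hv.mono fun x hx => by simp only [hx])
  have e2 : ∫ x, φ x • w x = ∫ x, φ x • w' x :=
    integral_congr_ae (hw.mono fun x hx => by simp only [hx])
  rw [← e1, ← e2]
  exact h φ hφ hc

theorem im_inner_real_smul (v : Lp F 2 (volume : Measure Plane)) {V : Plane → ℝ}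
    (w : Lp F 2 (volume : Measure Plane)) (hw : w =ᵐ[volume] fun x => (V x : ℂ) • v x) :
    (inner ℂ v w).im = 0 := by
  rw [L2.inner_def]
  have h1 : ∀ᵐ x : Plane, inner ℂ (v x) (w x) = ((V x * ‖v x‖ ^ 2 : ℝ) : ℂ) := by
    filter_upwards [hw] with x hx
    rw [hx, inner_smul_right, inner_self_eq_norm_sq_to_K]
    push_cast
    rfl
  rw [integral_congr_ae h1, integral_complex_ofReal]
  exact Complex.ofReal_im _

variable [CompleteSpace F]

/-- Take imaginary parts in `⟨v, P(D)v⟩ = z‖v‖² - ⟨v, Vv⟩ + ⟨v, g⟩`: the terms with `P(D)` and `V`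
are real, so `Im z ‖v‖² = -Im ⟨v, g⟩`. -/
theorem WeakHamiltonian.im_mul_norm_le {V : Plane → ℝ} (hVc : Continuous V) {C : ℝ}
    (hV : ∀ x, |V x| ≤ C) {z : ℂ} {v g : Plane → F} (hv : MemLp v 2 (volume : Measure Plane))
    (hg : MemLp g 2 (volume : Measure Plane))
    (h : WeakHamiltonian v (fun x => z • v x - (V x : ℂ) • v x + g x)) :
    |z.im| * ‖hv.toLp v‖ ≤ ‖hg.toLp g‖ := by
  have hVv : MemLp (fun x => (V x : ℂ) • v x) 2 (volume : Measure Plane) :=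
    memLp_bounded_smul (Complex.continuous_ofReal.comp hVc) (by simpa using hV) hv
  set v' := hv.toLp v
  set g' := hg.toLp g
  set w' := hVv.toLp _
  have h1 : WeakHamiltonian (v' : Plane → F) (z • v' - w' + g' : Lp F 2 volume) := by
    refine h.congr hv.coeFn_toLp.symm ?_
    filter_upwards [Lp.coeFn_add (z • v' - w') g', Lp.coeFn_sub (z • v') w', Lp.coeFn_smul z v',
      hv.coeFn_toLp, hg.coeFn_toLp, hVv.coeFn_toLp] with x h1 h2 h3 h4 h5 h6
    rw [h1, Pi.add_apply, h2, Pi.sub_apply, h3, Pi.smul_apply, h4, h5, h6]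
  have h2 := h1.im_inner_eq_zero
  have h3 : (inner ℂ v' w').im = 0 := by
    refine im_inner_real_smul v' (V := V) w' ?_
    filter_upwards [hv.coeFn_toLp, hVv.coeFn_toLp] with x h1 h2
    rw [h1, h2]
  have h4 : inner ℂ v' v' = ((‖v'‖ ^ 2 : ℝ) : ℂ) := by
    rw [inner_self_eq_norm_sq_to_K]
    norm_cast
  rw [inner_add_right, inner_sub_right, inner_smul_right, h4, Complex.add_im, Complex.sub_im, h3,
    Complex.mul_im, Complex.ofReal_re, Complex.ofReal_im, mul_zero, zero_add, sub_zero] at h2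
  have h5 : |z.im| * ‖v'‖ ^ 2 ≤ ‖v'‖ * ‖g'‖ := by
    calc |z.im| * ‖v'‖ ^ 2 = |z.im * ‖v'‖ ^ 2| := by
          rw [abs_mul, abs_of_nonneg (sq_nonneg ‖v'‖)]
      _ = |(inner ℂ v' g').im| := by rw [eq_neg_of_add_eq_zero_left h2, abs_neg]
      _ ≤ ‖inner ℂ v' g'‖ := Complex.abs_im_le_norm _
      _ ≤ _ := norm_inner_le_norm _ _
  rcases (norm_nonneg v').eq_or_lt with h6 | h6
  · rw [← h6, mul_zero]
    exact norm_nonneg _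
  · nlinarith

theorem ae_eq_zero_of_weak {V : Plane → ℝ} (hVc : Continuous V) {C : ℝ}
    (hV : ∀ x, |V x| ≤ C) {z : ℂ} (hz : z.im ≠ 0) {v : Plane → F}
    (hv : MemLp v 2 (volume : Measure Plane))
    (h : ∀ φ : Plane → ℂ, ContDiff ℝ ∞ φ → HasCompactSupport φ →
        ∫ x, (contHamiltonian φ x + ((V x : ℂ) - z) * φ x) • v x = 0) : v =ᵐ[volume] 0 := by
  have hg : MemLp (0 : Plane → F) 2 (volume : Measure Plane) := MemLp.zero
  have h1 := ((weakHamiltonian_iff hVc hV hv hg).2 fun φ hφ hc => by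
    rw [h φ hφ hc]
    simp).im_mul_norm_le hVc hV hv hg
  have h2 : hg.toLp 0 = 0 := by exact MemLp.toLp_zero _
  rw [h2, norm_zero] at h1
  have h3 : ‖hv.toLp v‖ = 0 := by
    have := abs_pos.2 hz
    exact le_antisymm (by nlinarith [norm_nonneg (hv.toLp v)]) (norm_nonneg _)
  exact hv.coeFn_toLp.symm.trans (Lp.eq_zero_iff_ae_eq_zero.1 (norm_eq_zero.1 h3))

end

/-! ### Existence of the continuum solution and its approximation by test functions. -/

section

open SchwartzMap LineDeriv

theorem integral_schwartzHamiltonian_mul (ψ φ : 𝓢(Plane, ℂ)) :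
    ∫ x, schwartzHamiltonian ψ x * φ x = ∫ x, ψ x * schwartzHamiltonian φ x := by
  set d : Fin 2 → 𝓢(Plane, ℂ) → 𝓢(Plane, ℂ) := fun j θ =>
    ∂_{EuclideanSpace.single j (1 : ℝ)} θ with hd
  have hparts : ∀ j (θ ρ : 𝓢(Plane, ℂ)), ∫ x, d j θ x * ρ x = -∫ x, θ x * d j ρ x := fun j θ ρ => by
    rw [SchwartzMap.integral_mul_lineDerivOp_right_eq_neg_left θ ρ, neg_neg]
  have hparts2 : ∀ i j (θ ρ : 𝓢(Plane, ℂ)), ∫ x, d i (d j θ) x * ρ x = ∫ x, θ x * d j (d i ρ) x :=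
    fun i j θ ρ => by rw [hparts, hparts, neg_neg]
  have hi : ∀ θ ρ : 𝓢(Plane, ℂ), Integrable fun x => θ x * ρ x := fun θ ρ =>
    integrable_smul_of_memLp_two (memLp_schwartz θ) (memLp_schwartz ρ)
  have hcomm : d 0 (d 1 φ) = d 1 (d 0 φ) := by
    ext x
    exact congrFun (partialDeriv_comm (contDiff_schwartz φ) 0 1) x
  have e1 : ∀ x, schwartzHamiltonian ψ x * φ x =
      -(1 / 9) * (d 0 (d 0 ψ) x * φ x - d 0 (d 1 ψ) x * φ x + d 1 (d 1 ψ) x * φ x) := fun x => by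
    have : schwartzHamiltonian ψ x =
      -(1 / 9) * (d 0 (d 0 ψ) x - d 0 (d 1 ψ) x + d 1 (d 1 ψ) x) := rfl
    rw [this]
    ring
  have e2 : ∀ x, ψ x * schwartzHamiltonian φ x =
      -(1 / 9) * (ψ x * d 0 (d 0 φ) x - ψ x * d 1 (d 0 φ) x + ψ x * d 1 (d 1 φ) x) := fun x => by
    have : schwartzHamiltonian φ x =
      -(1 / 9) * (d 0 (d 0 φ) x - d 0 (d 1 φ) x + d 1 (d 1 φ) x) := rfl
    rw [this, hcomm]
    ring
  simp_rw [e1, e2]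
  have hi2 : ∀ θ ρ θ' ρ' : 𝓢(Plane, ℂ), Integrable fun x => θ x * ρ x - θ' x * ρ' x :=
    fun _ _ _ _ => (hi _ _).sub (hi _ _)
  rw [integral_const_mul, integral_const_mul, integral_add (hi2 _ _ _ _) (hi _ _),
    integral_sub (hi _ _) (hi _ _), integral_add (hi2 _ _ _ _) (hi _ _),
    integral_sub (hi _ _) (hi _ _), hparts2, hparts2, hparts2]

variable {V : Plane → ℝ}

theorem memLp_schrodinger (hVc : Continuous V) {C : ℝ} (hV : ∀ x, |V x| ≤ C) (z : ℂ)
    (ψ : 𝓢(Plane, ℂ)) :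
    MemLp (fun x => contHamiltonian ψ x + ((V x : ℂ) - z) * ψ x) 2 (volume : Measure Plane) := by
  refine (memLp_schwartz (schwartzHamiltonian ψ)).add (memLp_bounded_smul
    (V := fun x => (V x : ℂ) - z) ?_ (C := C + ‖z‖) (fun x => ?_) (memLp_schwartz ψ))
  · exact (Complex.continuous_ofReal.comp hVc).sub continuous_const
  · refine (norm_sub_le _ _).trans ?_
    gcongr
    simpa using hV x

/-- A Schwartz function is a weak solution of the equation whose right side is its own image, by
integration by parts. -/
theorem schwartz_im_mul_norm_le (hVc : Continuous V) {C : ℝ} (hV : ∀ x, |V x| ≤ C) (z : ℂ)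
    (ψ : 𝓢(Plane, ℂ)) :
    |z.im| * ‖(memLp_schwartz ψ).toLp ψ‖ ≤ ‖(memLp_schrodinger hVc hV z ψ).toLp _‖ := by
  refine WeakHamiltonian.im_mul_norm_le hVc hV (memLp_schwartz ψ) (memLp_schrodinger hVc hV z ψ)
    fun φ hφ hc => ?_
  have e : ∀ x, z • ψ x - (V x : ℂ) • ψ x + (contHamiltonian ψ x + ((V x : ℂ) - z) * ψ x) =
      schwartzHamiltonian ψ x := fun x => by
    rw [schwartzHamiltonian_apply, smul_eq_mul, smul_eq_mul]
    ring
  simp_rw [e]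
  exact integral_schwartzHamiltonian_mul (hc.toSchwartzMap hφ) ψ

/-- The operator `P(D) + V - z` on Schwartz functions, with values in `L²`. -/
def schrodingerOp (hVc : Continuous V) {C : ℝ} (hV : ∀ x, |V x| ≤ C) (z : ℂ) :
    𝓢(Plane, ℂ) →ₗ[ℂ] Lp ℂ 2 (volume : Measure Plane) where
  toFun ψ := (memLp_schrodinger hVc hV z ψ).toLp _
  map_add' ψ φ := by
    rw [← MemLp.toLp_add]
    congr 1
    ext1 x
    have h1 := contHamiltonian_add (contDiff_schwartz ψ) (contDiff_schwartz φ) x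
    have h2 : (⇑(ψ + φ) : Plane → ℂ) = fun x => ψ x + φ x := rfl
    simp only [Pi.add_apply]
    rw [h2, h1]
    ring
  map_smul' c ψ := by
    rw [RingHom.id_apply, ← MemLp.toLp_const_smul]
    congr 1
    ext1 x
    have h1 := contHamiltonian_const_mul (contDiff_schwartz ψ) c x
    have h2 : (⇑(c • ψ) : Plane → ℂ) = fun x => c * ψ x := rfl
    simp only [Pi.smul_apply, smul_eq_mul]
    rw [h2, h1]
    ring

/-- The smooth functions with compact support. -/
def testFunctions : Submodule ℂ 𝓢(Plane, ℂ) where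
  carrier := {ψ | HasCompactSupport ψ}
  add_mem' ha hb := HasCompactSupport.add ha hb
  zero_mem' := HasCompactSupport.zero
  smul_mem' c _ hψ := HasCompactSupport.smul_left (f := fun _ => c) hψ

/-- If `k` is orthogonal to the range then its conjugate is a weak solution of the homogeneous
equation with the same `z`, the inner product being conjugate-linear in `k`; uniqueness makes it
vanish. -/
theorem dense_range_schrodingerOp (hVc : Continuous V) {C : ℝ} (hV : ∀ x, |V x| ≤ C) {z : ℂ}
    (hz : z.im ≠ 0) :
    (testFunctions.map (schrodingerOp hVc hV z)).topologicalClosure = ⊤ := by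
  rw [Submodule.topologicalClosure_eq_top_iff, Submodule.eq_bot_iff]
  intro k hk
  rw [Submodule.mem_orthogonal'] at hk
  have hk2 : MemLp (fun x => (starRingEnd ℂ) (k x)) 2 (volume : Measure Plane) :=
    (Lp.memLp k).star
  have h1 : (fun x => (starRingEnd ℂ) (k x)) =ᵐ[volume] 0 := by
    refine ae_eq_zero_of_weak hVc hV hz hk2 fun φ hφ hc => ?_
    have h2 := hk _ (Submodule.mem_map_of_mem (f := schrodingerOp hVc hV z)
      (show hc.toSchwartzMap hφ ∈ testFunctions from hc))
    rw [L2.inner_def] at h2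
    rw [← h2]
    refine integral_congr_ae ?_
    filter_upwards [(memLp_schrodinger hVc hV z (hc.toSchwartzMap hφ)).coeFn_toLp] with x hx
    change _ = inner ℂ (k x) ((memLp_schrodinger hVc hV z (hc.toSchwartzMap hφ)).toLp _ x)
    rw [hx]
    rfl
  refine Lp.ext ?_
  filter_upwards [h1, Lp.coeFn_zero ℂ 2 (volume : Measure Plane)] with x hx h0
  rw [h0]
  simpa using hx

/-- Approximate `g` by images of test functions; the a priori bound makes the preimages Cauchy, and
their limit is the solution. The second conclusion retains these approximants, which are the
profiles later placed on the lattice. -/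
theorem exists_weak_solution (hVc : Continuous V) {C : ℝ} (hV : ∀ x, |V x| ≤ C) {z : ℂ}
    (hz : z.im ≠ 0) {g : Plane → ℂ} (hg : MemLp g 2 (volume : Measure Plane)) :
    ∃ v : Lp ℂ 2 (volume : Measure Plane),
      (∀ φ : Plane → ℂ, ContDiff ℝ ∞ φ → HasCompactSupport φ →
        ∫ x, (contHamiltonian φ x + ((V x : ℂ) - z) * φ x) • v x = ∫ x, φ x • g x) ∧
      ∀ ε : ℝ, 0 < ε → ∃ φ : 𝓢(Plane, ℂ), HasCompactSupport φ ∧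
        ‖(memLp_schrodinger hVc hV z φ).toLp _ - hg.toLp g‖ < ε ∧
        ‖(memLp_schwartz φ).toLp φ - v‖ < ε := by
  have hmem : hg.toLp g ∈ closure
      (testFunctions.map (schrodingerOp hVc hV z) : Set (Lp ℂ 2 (volume : Measure Plane))) := by
    rw [← Submodule.topologicalClosure_coe, dense_range_schrodingerOp hVc hV hz]
    trivial
  obtain ⟨y, hy, hylim⟩ := mem_closure_iff_seq_limit.1 hmem
  choose φ hφc hφy using hy
  have hsub : ∀ m n, |z.im| * ‖(memLp_schwartz (φ m)).toLp _ - (memLp_schwartz (φ n)).toLp _‖ ≤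
      ‖y m - y n‖ := fun m n => by
    have h1 := schwartz_im_mul_norm_le hVc hV z (φ m - φ n)
    have h2 : (memLp_schrodinger hVc hV z (φ m - φ n)).toLp _ = y m - y n := by
      rw [← hφy, ← hφy, ← map_sub]
      rfl
    rw [h2] at h1
    exact h1
  have hz' := abs_pos.2 hz
  have hcauchy : CauchySeq fun n => (memLp_schwartz (φ n)).toLp (φ n) := by
    rw [Metric.cauchySeq_iff]
    intro ε hε
    obtain ⟨N, hN⟩ := Metric.cauchySeq_iff.1 hylim.cauchySeq (|z.im| * ε) (by positivity)
    refine ⟨N, fun m hm n hn => ?_⟩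
    have h1 := hN m hm n hn
    rw [dist_eq_norm] at h1 ⊢
    exact lt_of_mul_lt_mul_left ((hsub m n).trans_lt h1) hz'.le
  obtain ⟨v, hv⟩ := cauchySeq_tendsto_of_complete hcauchy
  refine ⟨v, fun θ hθ hθc => ?_, fun ε hε => ?_⟩
  -- The pairing is bilinear, without conjugation, so `P(D) + V - z` is its own transpose with the
  -- same `z`. Its continuity passes the weak equation to the limit.
  · let B : Lp ℂ 2 (volume : Measure Plane) →L[ℂ] Lp ℂ 2 (volume : Measure Plane) →L[ℂ] ℂ :=
      (ContinuousLinearMap.mul ℂ ℂ).lpPairing volume 2 2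
    have hB : ∀ {a b : Plane → ℂ} (ha : MemLp a 2 (volume : Measure Plane))
        (b : Lp ℂ 2 (volume : Measure Plane)), B (ha.toLp a) b = ∫ x, a x * b x := fun ha b => by
      rw [ContinuousLinearMap.lpPairing_eq_integral]
      refine integral_congr_ae ?_
      filter_upwards [ha.coeFn_toLp] with x hx
      rw [hx]
      rfl
    let Θ : 𝓢(Plane, ℂ) := hθc.toSchwartzMap hθ
    have hsymm : ∀ n,
        B ((memLp_schrodinger hVc hV z Θ).toLp _) ((memLp_schwartz (φ n)).toLp (φ n)) =
        B ((memLp_schwartz Θ).toLp Θ) (y n) := fun n => by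
      rw [hB (b := 0), hB (b := 0), ← hφy]
      have e1 : ∫ x, (contHamiltonian Θ x + ((V x : ℂ) - z) * Θ x) *
          (memLp_schwartz (φ n)).toLp (φ n) x =
          ∫ x, (contHamiltonian Θ x + ((V x : ℂ) - z) * Θ x) * φ n x := by
        refine integral_congr_ae ?_
        filter_upwards [(memLp_schwartz (φ n)).coeFn_toLp] with x hx
        rw [hx]
      have e2 : ∫ x, Θ x * schrodingerOp hVc hV z (φ n) x =
          ∫ x, Θ x * (contHamiltonian (φ n) x + ((V x : ℂ) - z) * φ n x) := by
        refine integral_congr_ae ?_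
        filter_upwards [(memLp_schrodinger hVc hV z (φ n)).coeFn_toLp] with x hx
        exact congrArg (Θ x * ·) hx
      rw [e1, e2]
      have hVz : Continuous fun x => (V x : ℂ) - z :=
        (Complex.continuous_ofReal.comp hVc).sub continuous_const
      have hb : MemLp (fun x => ((V x : ℂ) - z) • φ n x) 2 (volume : Measure Plane) := by
        refine memLp_bounded_smul hVz (C := C + ‖z‖) (fun x => ?_) (memLp_schwartz (φ n))
        refine (norm_sub_le _ _).trans ?_
        gcongr
        simpa using hV x
      have i1 : Integrable fun x => schwartzHamiltonian Θ x * φ n x :=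
        integrable_smul_of_memLp_two (memLp_schwartz _) (memLp_schwartz _)
      have i2 : Integrable fun x => Θ x * schwartzHamiltonian (φ n) x :=
        integrable_smul_of_memLp_two (memLp_schwartz _) (memLp_schwartz _)
      have i3 : Integrable fun x => Θ x * (((V x : ℂ) - z) * φ n x) :=
        integrable_smul_of_memLp_two (memLp_schwartz _) hb
      calc _ = ∫ x, (schwartzHamiltonian Θ x * φ n x + Θ x * (((V x : ℂ) - z) * φ n x)) := by
            refine integral_congr_ae (.of_forall fun x => ?_)
            simp only [schwartzHamiltonian_apply]
            ring
        _ = ∫ x, (Θ x * schwartzHamiltonian (φ n) x + Θ x * (((V x : ℂ) - z) * φ n x)) := by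
            rw [integral_add i1 i3, integral_add i2 i3, integral_schwartzHamiltonian_mul]
        _ = _ := by
            refine integral_congr_ae (.of_forall fun x => ?_)
            simp only [schwartzHamiltonian_apply]
            ring
    have l1 := ((B ((memLp_schrodinger hVc hV z Θ).toLp _)).continuous.tendsto v).comp hv
    have l2 := ((B ((memLp_schwartz Θ).toLp Θ)).continuous.tendsto (hg.toLp g)).comp hylim
    have l3 := tendsto_nhds_unique l1 (l2.congr fun n => (hsymm n).symm)
    rw [hB (b := 0), hB (b := 0)] at l3
    refine l3.trans (integral_congr_ae ?_)
    filter_upwards [hg.coeFn_toLp] with x hx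
    rw [hx]
    rfl
  · have h1 := (Metric.tendsto_nhds.1 hylim ε hε).and (Metric.tendsto_nhds.1 hv ε hε)
    obtain ⟨n, hn1, hn2⟩ := h1.exists
    rw [dist_eq_norm] at hn1 hn2
    refine ⟨φ n, hφc n, ?_, hn2⟩
    have : (memLp_schrodinger hVc hV z (φ n)).toLp _ = y n := hφy n
    rwa [this]

end

/-! ### Regularity of the solution -/

section

open FourierTransform

/-- Ellipticity: the quadratic form is at least `|η|²/2`, and `2π²/9 ≥ 1` follows from `π > 3`. -/
theorem contSymbol_ge (η : Plane) : ‖η‖ ^ 2 ≤ contSymbol η := by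
  have h1 : (3 : ℝ) ^ 2 ≤ Real.pi ^ 2 := pow_le_pow_left₀ (by norm_num) Real.pi_gt_three.le 2
  rw [contSymbol, EuclideanSpace.norm_sq_eq, Fin.sum_univ_two, Real.norm_eq_abs, Real.norm_eq_abs,
    sq_abs, sq_abs]
  have h2 : 0 ≤ η 0 ^ 2 - η 0 * η 1 + η 1 ^ 2 := by
    nlinarith [sq_nonneg (η 0 - η 1), sq_nonneg (η 0 + η 1)]
  have h3 : η 0 ^ 2 + η 1 ^ 2 ≤ 2 * (η 0 ^ 2 - η 0 * η 1 + η 1 ^ 2) := by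
    nlinarith [sq_nonneg (η 0 - η 1)]
  nlinarith

/-- `H²` regularity: `|η|²|v̂|` is dominated by the symbol times `|v̂|`, which is `|ŵ|`. -/
theorem memLp_weight_smul_fourier {v w : Lp ℂ 2 (volume : Measure Plane)}
    (h : WeakHamiltonian (v : Plane → ℂ) w) :
    MemLp (fun η => ((1 + ‖η‖ ^ 2 : ℝ) : ℂ) • (𝓕 v : Lp ℂ 2 (volume : Measure Plane)) η) 2
      (volume : Measure Plane) := by
  set v' := (𝓕 v : Lp ℂ 2 (volume : Measure Plane))
  set w' := (𝓕 w : Lp ℂ 2 (volume : Measure Plane))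
  refine ((Lp.memLp v').norm.add (Lp.memLp w').norm).mono' ?_ ?_
  · have : Continuous fun η : Plane => ((1 + ‖η‖ ^ 2 : ℝ) : ℂ) := by fun_prop
    exact this.aestronglyMeasurable.smul (Lp.aestronglyMeasurable v')
  · filter_upwards [h.fourier] with η hη
    rw [Pi.add_apply, norm_smul, Complex.norm_real, Real.norm_of_nonneg (by positivity), hη,
      norm_smul, Complex.norm_real, add_mul, one_mul]
    gcongr
    exact (contSymbol_ge η).trans (le_abs_self _)

end

/-! ### Consistency of the difference operator -/

section

variable {E : Type*} [NormedAddCommGroup E] {t : ℝ}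

theorem Decays.of_bound {f : Plane → E} (hf : Continuous f) {C : ℝ}
    (hC : ∀ x, ‖f x‖ ≤ C * bracketPow (-t) x) : Decays t fun _ => f :=
  ⟨by fun_prop, C, fun _ _ => hC⟩

theorem exists_bracketPow_bound (t : ℝ) {f : Plane → E} (hf : Continuous f)
    (hc : HasCompactSupport f) : ∃ C, ∀ x, ‖f x‖ ≤ C * bracketPow (-t) x := by
  have h1 : Continuous fun x => ‖f x‖ * bracketPow t x := hf.norm.mul (continuous_bracketPow t)
  have h2 : HasCompactSupport fun x => ‖f x‖ * bracketPow t x := hc.norm.mul_right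
  obtain ⟨C, hC⟩ := h2.exists_bound_of_continuous h1
  refine ⟨C, fun x => ?_⟩
  have h3 : ‖f x‖ * bracketPow t x * bracketPow (-t) x = ‖f x‖ := by
    rw [mul_assoc, bracketPow_mul_bracketPow, add_neg_cancel]
    simp [bracketPow]
  rw [← h3]
  exact mul_le_mul_of_nonneg_right ((le_abs_self _).trans (hC x)) (bracketPow_nonneg _ _)

theorem Decays.add {G H : ℝ → Plane → E} (hG : Decays t G) (hH : Decays t H) :
    Decays t fun h x => G h x + H h x := by
  obtain ⟨C, hC⟩ := hG.2
  obtain ⟨D, hD⟩ := hH.2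
  refine ⟨hG.1.add hH.1, C + D, fun h hh x => ?_⟩
  rw [add_mul]
  exact (norm_add_le _ _).trans (add_le_add (hC h hh x) (hD h hh x))

theorem Decays.sub {G H : ℝ → Plane → E} (hG : Decays t G) (hH : Decays t H) :
    Decays t fun h x => G h x - H h x := by
  obtain ⟨C, hC⟩ := hG.2
  obtain ⟨D, hD⟩ := hH.2
  refine ⟨hG.1.sub hH.1, C + D, fun h hh x => ?_⟩
  rw [add_mul]
  exact (norm_sub_le _ _).trans (add_le_add (hC h hh x) (hD h hh x))

theorem Decays.neg_scale {G : ℝ → Plane → E} (hG : Decays t G) : Decays t fun h => G (-h) := by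
  obtain ⟨C, hC⟩ := hG.2
  refine ⟨hG.1.comp (by fun_prop : Continuous fun p : ℝ × Plane => (-p.1, p.2)), C,
    fun h hh x => hC (-h) (by rwa [abs_neg]) x⟩

theorem Decays.shift {G : Plane → E} (ht : 0 ≤ t) (hG : Decays t fun _ => G) {e : Plane}
    (he : ‖e‖ ≤ 1) : Decays t fun h x => G (x + h • e) := by
  obtain ⟨C, hC⟩ := hG.2
  have hC := hC 0 (by simp)
  have hC0 : 0 ≤ C := nonneg_of_mul_nonneg_left ((norm_nonneg _).trans (hC 0)) (bracketPow_pos _ _)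
  refine ⟨(hG.continuous_apply 0).comp (by fun_prop : Continuous fun p : ℝ × Plane => p.2 + p.1 • e),
    C * (2 * (1 + 1 ^ 2)) ^ (t / 2), fun h hh x => (hC _).trans ?_⟩
  rw [mul_assoc]
  refine mul_le_mul_of_nonneg_left (bracketPow_neg_le ht ?_) hC0
  rw [sub_add_cancel_left, norm_neg, norm_smul]
  exact mul_le_one₀ hh (norm_nonneg _) he

variable [NormedSpace ℂ E]

theorem Decays.smul {c : ℝ → Plane → ℂ} (hc : Continuous fun p : ℝ × Plane => c p.1 p.2) {B : ℝ}
    (hB : ∀ h, |h| ≤ 1 → ∀ x, ‖c h x‖ ≤ B) {G : ℝ → Plane → E} (hG : Decays t G) :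
    Decays t fun h x => c h x • G h x := by
  obtain ⟨C, hC⟩ := hG.2
  refine ⟨hc.smul hG.1, B * C, fun h hh x => ?_⟩
  rw [norm_smul, mul_assoc]
  exact mul_le_mul (hB h hh x) (hC h hh x) (norm_nonneg _) ((norm_nonneg _).trans (hB h hh x))

theorem Decays.const_smul (c : ℂ) {G : ℝ → Plane → E} (hG : Decays t G) :
    Decays t fun h x => c • G h x :=
  hG.smul continuous_const (B := ‖c‖) fun _ _ _ => le_rfl

theorem Decays.scale_smul {G : ℝ → Plane → E} (hG : Decays t G) :
    Decays t fun h x => (h : ℂ) • G h x :=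
  hG.smul (c := fun h _ => (h : ℂ)) (by fun_prop) (B := 1) fun h hh _ => by simpa using hh

/-- The average `∫₀¹ κ(τ) G(x + τ h e) dτ` along a segment. -/
def segmentAverage (κ : ℝ → ℝ) (e : Plane) (G : Plane → ℂ) (h : ℝ) (x : Plane) : ℂ :=
  ∫ τ in (0 : ℝ)..1, (κ τ : ℂ) * G (x + (τ * h) • e)

theorem Decays.segmentAverage {κ : ℝ → ℝ} (hκ : Continuous κ)
    (hκ1 : ∀ τ ∈ Set.Icc (0 : ℝ) 1, |κ τ| ≤ 1) {G : Plane → ℂ} (ht : 0 ≤ t)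
    (hG : Decays t fun _ => G) {e : Plane} (he : ‖e‖ ≤ 1) :
    Decays t (segmentAverage κ e G) := by
  have hGc : Continuous G := hG.continuous_apply 0
  obtain ⟨C, hC⟩ := (hG.shift ht he).2
  refine ⟨?_, C, fun h hh x => ?_⟩
  · refine intervalIntegral.continuous_parametric_intervalIntegral_of_continuous'
      (f := fun (p : ℝ × Plane) τ => (κ τ : ℂ) * G (p.2 + (τ * p.1) • e)) ?_ 0 1
    have h1 : Continuous fun p : (ℝ × Plane) × ℝ => G (p.1.2 + (p.2 * p.1.1) • e) :=
      hGc.comp (by fun_prop)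
    exact (Complex.continuous_ofReal.comp (hκ.comp continuous_snd)).mul h1
  · have h1 : ∀ τ ∈ Set.uIoc (0 : ℝ) 1, ‖(κ τ : ℂ) * G (x + (τ * h) • e)‖ ≤
        C * bracketPow (-t) x := fun τ hτ => by
      rw [Set.uIoc_of_le zero_le_one] at hτ
      rw [norm_mul, Complex.norm_real]
      have h2 : |τ * h| ≤ 1 := by
        rw [abs_mul, abs_of_pos hτ.1]
        exact mul_le_one₀ hτ.2 (abs_nonneg _) hh
      exact (mul_le_of_le_one_left (norm_nonneg _) (hκ1 τ ⟨hτ.1.le, hτ.2⟩)).trans (hC _ h2 x)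
    have h3 := intervalIntegral.norm_integral_le_of_norm_le_const h1
    rw [sub_zero, abs_one, mul_one] at h3
    exact h3

end

/-! ### Taylor formulas along the lattice directions. -/

theorem hasDerivAt_segment {φ : Plane → ℂ} (hφ : ContDiff ℝ ∞ φ) (j : Fin 2) (h τ : ℝ) (x : Plane) :
    HasDerivAt (fun τ : ℝ => φ (x + (τ * h) • EuclideanSpace.single j 1))
      (h * partialDeriv j φ (x + (τ * h) • EuclideanSpace.single j 1)) τ := by
  have h1 : HasDerivAt (fun τ : ℝ => x + (τ * h) • (EuclideanSpace.single j 1 : Plane))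
      ((1 * h) • EuclideanSpace.single j 1) τ :=
    (((hasDerivAt_id τ).mul_const h).smul_const _).const_add x
  have h2 := (ContDiff.differentiable_infty hφ
    (x + (τ * h) • EuclideanSpace.single j 1)).hasFDerivAt.comp_hasDerivAt τ h1
  rw [one_mul, map_smul, Complex.real_smul] at h2
  exact h2

theorem taylor_one {φ : Plane → ℂ} (hφ : ContDiff ℝ ∞ φ) (j : Fin 2) (h : ℝ) (x : Plane) :
    φ (x + h • EuclideanSpace.single j 1) = φ x +
      h * segmentAverage (fun _ => 1) (EuclideanSpace.single j 1) (partialDeriv j φ) h x := by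
  have hc : Continuous fun τ : ℝ =>
      (h : ℂ) * partialDeriv j φ (x + (τ * h) • EuclideanSpace.single j 1) :=
    continuous_const.mul ((contDiff_partialDeriv hφ j).continuous.comp (by fun_prop))
  have h1 := intervalIntegral.integral_eq_sub_of_hasDerivAt (a := 0) (b := 1)
    (fun τ _ => hasDerivAt_segment hφ j h τ x) (hc.intervalIntegrable _ _)
  rw [intervalIntegral.integral_const_mul, one_mul, zero_mul, zero_smul, add_zero] at h1
  simp only [segmentAverage, Complex.ofReal_one, one_mul]
  rw [h1]
  ring

/-- The integral remainder is jointly continuous in `(h, x)` down to `h = 0`, as `Decays` requires,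
and remains meaningful for the negative steps of `S_j`. -/
theorem taylor_two {φ : Plane → ℂ} (hφ : ContDiff ℝ ∞ φ) (j : Fin 2) (h : ℝ) (x : Plane) :
    φ (x + h • EuclideanSpace.single j 1) = φ x + h * partialDeriv j φ x + h ^ 2 *
      segmentAverage (fun τ => 1 - τ) (EuclideanSpace.single j 1)
        (partialDeriv j (partialDeriv j φ)) h x := by
  have hφ' := contDiff_partialDeriv hφ j
  have hc : Continuous fun τ : ℝ => (h : ℂ) ^ 2 * (((1 - τ : ℝ) : ℂ) *
      partialDeriv j (partialDeriv j φ) (x + (τ * h) • EuclideanSpace.single j 1)) := by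
    have := (contDiff_partialDeriv hφ' j).continuous.comp
      (by fun_prop : Continuous fun τ : ℝ => x + (τ * h) • (EuclideanSpace.single j 1 : Plane))
    exact continuous_const.mul ((by fun_prop : Continuous fun τ : ℝ => ((1 - τ : ℝ) : ℂ)).mul this)
  -- An explicit primitive of the remainder integrand, in place of an integration by parts.
  have hd : ∀ τ : ℝ, HasDerivAt (fun τ : ℝ =>
      ((1 - τ : ℝ) : ℂ) * (h * partialDeriv j φ (x + (τ * h) • EuclideanSpace.single j 1)) +
        φ (x + (τ * h) • EuclideanSpace.single j 1))
      ((h : ℂ) ^ 2 * (((1 - τ : ℝ) : ℂ) *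
        partialDeriv j (partialDeriv j φ) (x + (τ * h) • EuclideanSpace.single j 1))) τ := fun τ => by
    have h1 : HasDerivAt (fun τ : ℝ => ((1 - τ : ℝ) : ℂ)) ((-1 : ℝ) : ℂ) τ :=
      ((hasDerivAt_id τ).const_sub 1).ofReal_comp
    refine ((h1.mul ((hasDerivAt_segment hφ' j h τ x).const_mul (h : ℂ))).add
      (hasDerivAt_segment hφ j h τ x)).congr_deriv ?_
    push_cast
    ring
  have h1 := intervalIntegral.integral_eq_sub_of_hasDerivAt (a := 0) (b := 1)
    (fun τ _ => hd τ) (hc.intervalIntegrable _ _)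
  rw [intervalIntegral.integral_const_mul] at h1
  simp only [segmentAverage]
  rw [h1]
  simp only [sub_self, sub_zero, one_mul, zero_mul, zero_smul, add_zero, Complex.ofReal_zero,
    Complex.ofReal_one]
  ring

theorem segmentAverage_zero (κ : ℝ → ℝ) (e : Plane) (G : Plane → ℂ) (x : Plane) :
    segmentAverage κ e G 0 x = (∫ τ in (0 : ℝ)..1, κ τ : ℝ) * G x := by
  simp only [segmentAverage, mul_zero, zero_smul, add_zero]
  rw [intervalIntegral.integral_mul_const, intervalIntegral.integral_ofReal]

/-! ### The two-scale approximation and its residual. -/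

section

variable (φ q : Plane → ℂ) (V : Plane → ℝ) (f : Plane → Spinor) (z : ℂ)

/-- The derivative of `φ` along `(1, 1)`. -/
def diagDeriv : Plane → ℂ := fun x => partialDeriv 0 φ x + partialDeriv 1 φ x

/-- The second-order Taylor remainder, divided by `h²`, of the sum of `φ - (h/6)(∂₁ + ∂₂)φ` over
the three neighbours of a vertex. -/
def hoppingRemainder (h : ℝ) (x : Plane) : ℂ :=
  ∑ j, (segmentAverage (fun τ => 1 - τ) (EuclideanSpace.single j 1)
      (partialDeriv j (partialDeriv j φ)) h x -
    1 / 6 * segmentAverage (fun _ => 1) (EuclideanSpace.single j 1)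
      (partialDeriv j (diagDeriv φ)) h x)

/-- The two-scale approximation of the solution on the lattice built from a profile `φ` and a
second-order corrector `q`. -/
def ansatz (h : ℝ) (x : Plane) : Spinor :=
  WithLp.toLp 2 ![φ x + h / 6 * diagDeriv φ x + h ^ 2 * q x, φ x - h / 6 * diagDeriv φ x]

/-- The residual of the two-scale approximation. -/
def residual (h : ℝ) (x : Plane) : Spinor :=
  WithLp.toLp 2
    ![q x - 1 / 3 * hoppingRemainder φ h x + ((V x : ℂ) - z) * ansatz φ q h x 0 - f x 0,
      -(1 / 3) * (hoppingRemainder φ (-h) x + (q x + q (x + (-h) • EuclideanSpace.single 0 1) +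
        q (x + (-h) • EuclideanSpace.single 1 1))) + ((V x : ℂ) - z) * ansatz φ q h x 1 - f x 1]

variable {φ}

theorem contDiff_diagDeriv (hφ : ContDiff ℝ ∞ φ) : ContDiff ℝ ∞ (diagDeriv φ) :=
  (contDiff_partialDeriv hφ 0).add (contDiff_partialDeriv hφ 1)

theorem hasCompactSupport_diagDeriv (hc : HasCompactSupport φ) :
    HasCompactSupport (diagDeriv φ) :=
  (hasCompactSupport_partialDeriv hc 0).add (hasCompactSupport_partialDeriv hc 1)

theorem node_add_single (h : ℝ) (n : Cell) (j : Fin 2) :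
    node h (n + Pi.single j 1) = node h n + h • EuclideanSpace.single j 1 := by
  ext i
  simp only [node, Pi.add_apply, PiLp.add_apply, PiLp.smul_apply, smul_eq_mul]
  rcases eq_or_ne i j with rfl | hij
  · simp [mul_add]
  · simp [hij]

theorem node_sub_single (h : ℝ) (n : Cell) (j : Fin 2) :
    node h (n - Pi.single j 1) = node h n + (-h) • EuclideanSpace.single j 1 := by
  ext i
  simp only [node, Pi.sub_apply, PiLp.add_apply, PiLp.smul_apply, smul_eq_mul]
  rcases eq_or_ne i j with rfl | hij
  · simp [mul_add, sub_eq_add_neg]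
  · simp [hij]

/-- An exact identity. The neighbours of a first-type vertex contribute `3φ + h(1 - 3/6)(∂₁ + ∂₂)φ`,
and the vertex itself `-3φ - (3h/6)(∂₁ + ∂₂)φ`: orders `h⁻²` and `h⁻¹` cancel. The second row is the
same computation with `-h`. -/
theorem negLaplacian_ansatz (hφ : ContDiff ℝ ∞ φ) {h : ℝ} (hh : h ≠ 0) (n : Cell) :
    negLaplacian h (fun n => ansatz φ q h (node h n)) n +
      (V (node h n) : ℂ) • ansatz φ q h (node h n) - z • ansatz φ q h (node h n) =
        f (node h n) + residual φ q V f z h (node h n) := by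
  have hD := contDiff_diagDeriv hφ
  have hhC : (h : ℂ) ≠ 0 := by exact_mod_cast hh
  ext i
  fin_cases i
  · simp only [negLaplacian, shiftStar, node_add_single, ansatz, residual, hoppingRemainder,
      Fin.sum_univ_two]
    simp [taylor_two hφ 0 h, taylor_two hφ 1 h, taylor_one hD 0 h, taylor_one hD 1 h]
    rw [show diagDeriv φ (node h n) = partialDeriv 0 φ (node h n) + partialDeriv 1 φ (node h n)
      from rfl]
    field_simp
    ring
  · simp only [negLaplacian, HexLattice.shift, node_sub_single, ansatz, residual, hoppingRemainder,
      Fin.sum_univ_two]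
    simp only [taylor_two hφ 0 (-h), taylor_two hφ 1 (-h), taylor_one hD 0 (-h),
      taylor_one hD 1 (-h)]
    simp
    rw [show diagDeriv φ (node h n) = partialDeriv 0 φ (node h n) + partialDeriv 1 φ (node h n)
      from rfl]
    field_simp
    ring

/-- The limit operator appears here: `½(∂₁² + ∂₂²) - (1/6)(∂₁ + ∂₂)²` equals `(1/3)(∂₁² - ∂₁∂₂ +
∂₂²)`. -/
theorem hoppingRemainder_zero (hφ : ContDiff ℝ ∞ φ) (x : Plane) :
    -(1 / 3) * hoppingRemainder φ 0 x = contHamiltonian φ x := by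
  have h1 : ∫ τ in (0 : ℝ)..1, (1 - τ) = 1 / 2 := by
    rw [intervalIntegral.integral_sub (by simp) (by simp)]
    norm_num
  have h2 : ∀ j, partialDeriv j (diagDeriv φ) x =
      partialDeriv j (partialDeriv 0 φ) x + partialDeriv j (partialDeriv 1 φ) x := fun j =>
    congrFun (partialDeriv_add (contDiff_partialDeriv hφ 0) (contDiff_partialDeriv hφ 1) j) x
  simp only [hoppingRemainder, contHamiltonian, Fin.sum_univ_two, segmentAverage_zero, h1, h2]
  rw [congrFun (partialDeriv_comm hφ 1 0) x]
  simp
  ring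

/-- At `h = 0` the corrector enters the two rows as `q` and `-q`. The choice `q = (f₀ - f₁)/2`
replaces both `f₀` and `f₁` by their mean, so a single scalar equation is left. -/
theorem residual_zero (hφ : ContDiff ℝ ∞ φ) (x : Plane) :
    residual φ (fun x => (f x 0 - f x 1) / 2) V f z 0 x =
      WithLp.toLp 2 fun _ => contHamiltonian φ x + ((V x : ℂ) - z) * φ x - (f x 0 + f x 1) / 2 := by
  have h1 := hoppingRemainder_zero hφ x
  ext i
  fin_cases i
  · simp only [residual, ansatz]
    simp
    linear_combination h1
  · simp only [residual, ansatz]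
    simp
    linear_combination h1

theorem Decays.spinor {t : ℝ} {a b : ℝ → Plane → ℂ} (ha : Decays t a) (hb : Decays t b) :
    Decays t fun h x => (WithLp.toLp 2 ![a h x, b h x] : Spinor) := by
  obtain ⟨C, hC⟩ := ha.2
  obtain ⟨D, hD⟩ := hb.2
  refine ⟨?_, C + D, fun h hh x => ?_⟩
  · refine (PiLp.continuous_toLp 2 _).comp (continuous_pi fun i => ?_)
    fin_cases i
    · exact ha.1
    · exact hb.1
  · have h1 : (WithLp.toLp 2 ![a h x, b h x] : Spinor) =
        EuclideanSpace.single 0 (a h x) + EuclideanSpace.single 1 (b h x) := by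
      ext i
      fin_cases i <;> simp
    change ‖(WithLp.toLp 2 ![a h x, b h x] : Spinor)‖ ≤ _
    rw [h1, add_mul]
    refine (norm_add_le _ _).trans ?_
    rw [PiLp.norm_single, PiLp.norm_single]
    exact add_le_add (hC h hh x) (hD h hh x)

variable {q V f} {t : ℝ}

theorem decays_const_of_contDiff (t : ℝ) (hφ : ContDiff ℝ ∞ φ) (hc : HasCompactSupport φ) :
    Decays t fun _ => φ :=
  .of_bound hφ.continuous (exists_bracketPow_bound t hφ.continuous hc).choose_spec

theorem decays_hoppingRemainder (ht : 0 ≤ t) (hφ : ContDiff ℝ ∞ φ) (hc : HasCompactSupport φ) :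
    Decays t (hoppingRemainder φ) := by
  have h1 : ∀ j, Decays t fun _ => partialDeriv j (partialDeriv j φ) := fun j =>
    decays_const_of_contDiff t (contDiff_partialDeriv (contDiff_partialDeriv hφ j) j)
      (hasCompactSupport_partialDeriv (hasCompactSupport_partialDeriv hc j) j)
  have h2 : ∀ j, Decays t fun _ => partialDeriv j (diagDeriv φ) := fun j =>
    decays_const_of_contDiff t (contDiff_partialDeriv (contDiff_diagDeriv hφ) j)
      (hasCompactSupport_partialDeriv (hasCompactSupport_diagDeriv hc) j)
  have h3 : ∀ j : Fin 2, ‖(EuclideanSpace.single j 1 : Plane)‖ ≤ 1 := fun j => by simp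
  have h4 := fun j : Fin 2 =>
    (Decays.segmentAverage (κ := fun τ => 1 - τ) (by fun_prop) (fun τ hτ => by
        rw [abs_of_nonneg (by linarith [hτ.2])]
        linarith [hτ.1]) ht (h1 j) (h3 j)).sub
      ((Decays.segmentAverage (κ := fun _ => 1) (by fun_prop) (by simp) ht
        (h2 j) (h3 j)).const_smul (1 / 6))
  have h5 := (h4 0).add (h4 1)
  simp only [smul_eq_mul] at h5
  have h6 : hoppingRemainder φ = _ := funext₂ fun h x => Fin.sum_univ_two _
  rw [h6]
  exact h5

theorem decays_ansatz (hφ : ContDiff ℝ ∞ φ) (hc : HasCompactSupport φ)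
    (hq : Decays t fun _ => q) : Decays t (ansatz φ q) := by
  have h1 := decays_const_of_contDiff t hφ hc
  have h2 := ((decays_const_of_contDiff t (contDiff_diagDeriv hφ)
    (hasCompactSupport_diagDeriv hc)).const_smul (1 / 6)).scale_smul
  have h3 := (h1.add h2).add hq.scale_smul.scale_smul
  have h4 := h3.spinor (h1.sub h2)
  refine cast (congrArg (Decays t) (funext₂ fun h x => ?_)) h4
  simp only [ansatz, smul_eq_mul]
  ring_nf

theorem Decays.apply {G : ℝ → Plane → Spinor} (hG : Decays t G) (j : Fin 2) :
    Decays t fun h x => G h x j := by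
  obtain ⟨C, hC⟩ := hG.2
  refine ⟨?_, C, fun h hh x => (PiLp.norm_apply_le _ j).trans (hC h hh x)⟩
  have := hG.1
  fun_prop

theorem decays_residual (ht : 0 ≤ t) (hφ : ContDiff ℝ ∞ φ) (hc : HasCompactSupport φ)
    (hq : Decays t fun _ => q) (hf : Decays t fun _ => f) (hVc : Continuous V) {C : ℝ}
    (hV : ∀ x, |V x| ≤ C) : Decays t (residual φ q V f z) := by
  have h1 := decays_hoppingRemainder ht hφ hc
  have h2 : ∀ j, Decays t fun h x => ((V x : ℂ) - z) • ansatz φ q h x j := fun j =>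
    ((decays_ansatz hφ hc hq).apply j).smul (c := fun _ x => (V x : ℂ) - z) (by fun_prop)
      (B := C + ‖z‖) fun h _ x => (norm_sub_le _ _).trans (by
        gcongr
        simpa using hV x)
  have h3 : ∀ j : Fin 2, Decays t fun h x => q (x + (-h) • EuclideanSpace.single j 1) := fun j =>
    (hq.shift ht (e := EuclideanSpace.single j 1) (by simp)).neg_scale
  have h4 := ((hq.sub (h1.const_smul (1 / 3))).add (h2 0)).sub (hf.apply 0)
  have h5 := (((h1.neg_scale.add ((hq.add (h3 0)).add (h3 1))).const_smul (-(1 / 3))).add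
    (h2 1)).sub (hf.apply 1)
  exact h4.spinor h5

end

/-! ### Discrete Fourier transforms of samples of a test function -/

section

open SchwartzMap FourierTransform

theorem finite_setOf_node_mem {h : ℝ} (hh : 0 < h) {K : Set Plane} (hK : IsCompact K) :
    {n : Cell | node h n ∈ K}.Finite := by
  obtain ⟨R, hR⟩ := hK.isBounded.exists_norm_le
  refine (Set.finite_Icc (fun _ => -⌈R / h⌉ : Cell) (fun _ => ⌈R / h⌉)).subset fun n hn => ?_
  have h1 : ∀ j, |(n j : ℝ)| ≤ ⌈R / h⌉ := fun j => by
    have h2 : ‖node h n j‖ ≤ R := (PiLp.norm_apply_le _ j).trans (hR _ hn)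
    have h3 : h * |(n j : ℝ)| ≤ R := by
      simpa [node, abs_mul, abs_of_pos hh] using h2
    exact ((le_div_iff₀' hh).2 h3).trans (Int.le_ceil _)
  refine ⟨fun j => ?_, fun j => ?_⟩
  · exact_mod_cast (abs_le.1 (h1 j)).1
  · exact_mod_cast (abs_le.1 (h1 j)).2

theorem fourierSeries_ae_eq_sum {h : ℝ} {u : Cell → Spinor} {s : Finset Cell}
    (hs : ∀ n ∉ s, u n = 0) : fourierSeries h u =ᵐ[volume.restrict (torus h)]
      fun ξ => ∑ n ∈ s, mode h n (u n) ξ := by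
  have h1 : fourierSeries h u = ∑ n ∈ s, (memLp_mode h n (u n)).toLp (mode h n (u n)) := by
    refine tsum_eq_sum fun n hn => ?_
    have : mode h n (u n) = 0 := by
      ext1 ξ
      rw [mode, hs n hn, smul_zero]
      rfl
    exact Lp.eq_zero_iff_ae_eq_zero.2 ((memLp_mode h n (u n)).coeFn_toLp.trans (.of_eq this))
  rw [h1]
  clear hs h1
  induction s using Finset.induction_on with
  | empty =>
    simp only [Finset.sum_empty]
    exact Lp.coeFn_zero _ _ _
  | insert a s ha ih =>
    rw [Finset.sum_insert ha]
    filter_upwards [Lp.coeFn_add ((memLp_mode h a (u a)).toLp _)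
      (∑ n ∈ s, (memLp_mode h n (u n)).toLp (mode h n (u n))), ih,
      (memLp_mode h a (u a)).coeFn_toLp] with ξ h1 h2 h3
    rw [h1, Pi.add_apply, h2, h3, Finset.sum_insert ha]

/-- The plane wave `x ↦ e^{-2πi x·η}` times `G`. -/
def modulate (η : Plane) (G : Plane → Spinor) (x : Plane) : Spinor :=
  Complex.exp (-(2 * Real.pi * inner ℝ x η : ℝ) * Complex.I) • G x

theorem norm_modulate (η : Plane) (G : Plane → Spinor) (x : Plane) :
    ‖modulate η G x‖ = ‖G x‖ := by
  rw [modulate, norm_smul, ← Complex.ofReal_neg, Complex.norm_exp_ofReal_mul_I, one_mul]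

theorem fourier_eq_integral_modulate (G : Plane → Spinor) (η : Plane) :
    𝓕 G η = ∫ x, modulate η G x := by
  rw [Real.fourier_eq']
  refine integral_congr_ae (.of_forall fun x => ?_)
  simp only [modulate]
  congr 2
  push_cast
  ring

/-- Inside the torus the discrete transform of samples is the Riemann sum of the Fourier integral;
compact support makes the sum finite, so the `L²` series can be evaluated pointwise. -/
theorem spec_samples {h : ℝ} (hh : 0 < h) {G : Plane → Spinor} (hG : HasCompactSupport G) :
    ∀ᵐ η : Plane, (2 * Real.pi) • η ∈ torus h →
      spec h (fun n => G (node h n)) η = h ^ 2 • ∑' n, modulate η G (node h n) := by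
  set s := (finite_setOf_node_mem hh hG).toFinset with hs
  have h0 : ∀ n ∉ s, G (node h n) = 0 := fun n hn => by
    by_contra hne
    exact hn (by simpa [hs] using subset_tsupport _ hne)
  filter_upwards [ae_comp_two_pi_smul (fourierSeries_ae_eq_sum (h := h) h0)] with η hη hm
  rw [spec_of_mem _ hm, hη hm, tsum_eq_sum (s := s) fun n hn => by
    rw [modulate, h0 n hn, smul_zero], Finset.smul_sum, Finset.smul_sum]
  refine Finset.sum_congr rfl fun n _ => ?_
  rw [mode, modulate, ← Complex.coe_smul, smul_smul, smul_smul, ← mul_assoc, ← Complex.ofReal_mul,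
    inner_smul_right]
  congr 3
  · have := Real.pi_ne_zero
    field_simp
  · push_cast
    ring

theorem eventually_mem_torus (η : Plane) :
    ∀ᶠ h : ℝ in 𝓝[>] 0, (2 * Real.pi) • η ∈ torus h := by
  have h1 : ∀ j, ∀ᶠ h : ℝ in 𝓝[>] 0, 2 * Real.pi * |η j| ≤ Real.pi / h := fun j =>
    ((tendsto_inv_nhdsGT_zero (𝕜 := ℝ)).const_mul_atTop Real.pi_pos).eventually_ge_atTop _
  filter_upwards [eventually_all.2 h1] with h hh j
  rw [Set.mem_Icc, ← abs_le]
  refine le_trans (le_of_eq ?_) (hh j)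
  simp [abs_mul, abs_of_pos Real.pi_pos]

theorem memLp_two_norm_sq_sub {α E : Type*} [MeasurableSpace α] {μ : Measure α}
    [NormedAddCommGroup E] [InnerProductSpace ℂ E] {a b : α → E} (ha : MemLp a 2 μ)
    (hb : MemLp b 2 μ) : ∫ x, ‖a x - b x‖ ^ 2 ∂μ =
      ∫ x, ‖a x‖ ^ 2 ∂μ - 2 * ∫ x, (inner ℂ (a x) (b x)).re ∂μ + ∫ x, ‖b x‖ ^ 2 ∂μ := by
  have i1 := ha.integrable_norm_pow (by norm_num)
  have i2 := hb.integrable_norm_pow (by norm_num)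
  have i3 : Integrable (fun x => 2 * (inner ℂ (a x) (b x)).re) μ := by
    refine (i1.add i2).mono' ?_ (.of_forall fun x => ?_)
    · exact (Complex.continuous_re.comp_aestronglyMeasurable (ha.1.inner hb.1)).const_mul 2
    · have h1 := (Complex.abs_re_le_norm _).trans (norm_inner_le_norm (𝕜 := ℂ) (a x) (b x))
      rw [Pi.add_apply, norm_mul, Real.norm_two, Real.norm_eq_abs]
      nlinarith [sq_nonneg (‖a x‖ - ‖b x‖)]
  have i4 : Integrable (fun x => ‖a x‖ ^ 2 - 2 * (inner ℂ (a x) (b x)).re) μ := i1.sub i3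
  rw [← integral_const_mul, ← integral_sub i1 i3, ← integral_add i4 i2]
  refine integral_congr_ae (.of_forall fun x => ?_)
  exact norm_sub_sq (𝕜 := ℂ) (a x) (b x)

theorem eLpNorm_two_eq_ofReal {α E : Type*} [MeasurableSpace α] {μ : Measure α}
    [NormedAddCommGroup E] {g : α → E} (hg : MemLp g 2 μ) :
    eLpNorm g 2 μ = ENNReal.ofReal (√(∫ x, ‖g x‖ ^ 2 ∂μ)) := by
  rw [hg.eLpNorm_eq_integral_rpow_norm (by norm_num) (by norm_num), Real.sqrt_eq_rpow]
  simp

theorem Decays.norm_sq_node {t : ℝ} (ht : 1 < t) {G : ℝ → Plane → Spinor} (hG : Decays t G) {h : ℝ}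
    (h0 : 0 < h) (h1 : h ≤ 1) : ∃ w : SqSum, (∀ n, w n = G h (node h n)) ∧
      ‖w‖ ^ 2 = ∑' n, ‖G h (node h n)‖ ^ 2 :=
  ⟨⟨fun n => G h (node h n), memℓp_two_iff.2 (hG.summable_norm_sq ht h0 h1)⟩, fun _ => rfl,
    (SqSum.hasSum_norm_sq _).tsum_eq.symm⟩

/-- Expand `‖F_h - F‖²`. The norms `‖F_h‖²` are Riemann sums of `|G|²` and converge to `‖F‖²` by
Plancherel. For the cross term, `F_h → F` pointwise, `F_h` is bounded uniformly in `h`, and `F` is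
integrable. No estimate of aliasing is needed. -/
theorem tendsto_eLpNorm_spec_samples (G : 𝓢(Plane, Spinor)) (hG : HasCompactSupport G) :
    Tendsto (fun h => eLpNorm (fun η => spec h (fun n => G (node h n)) η - 𝓕 (G : Plane → Spinor) η)
      2 volume) (𝓝[>] 0) (𝓝 0) := by
  have hF2 : MemLp (𝓕 (G : Plane → Spinor)) 2 (volume : Measure Plane) := by
    rw [← SchwartzMap.fourier_coe]
    exact (𝓕 G).memLp 2
  have hF1 : Integrable (𝓕 (G : Plane → Spinor)) (volume : Measure Plane) := by
    rw [← SchwartzMap.fourier_coe]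
    exact (𝓕 G).integrable
  have hd : Decays 3 fun _ => (G : Plane → Spinor) :=
    .of_bound G.continuous (exists_bracketPow_bound 3 G.continuous hG).choose_spec
  have hsmall : ∀ᶠ h : ℝ in 𝓝[>] 0, 0 < h ∧ h ≤ 1 := by
    filter_upwards [Ioc_mem_nhdsGT (zero_lt_one' ℝ)] with h hh using hh
  have hmod : ∀ η, Decays 3 fun _ => modulate η G := fun η =>
    hd.smul (c := fun _ x => Complex.exp (-(2 * Real.pi * inner ℝ x η : ℝ) * Complex.I))
      (by fun_prop) (B := 1) fun _ _ x => by
        rw [← Complex.ofReal_neg, Complex.norm_exp_ofReal_mul_I]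
  have hdn : Decays 3 fun _ x => ‖G x‖ := by
    obtain ⟨hc, C, hC⟩ := hd
    exact ⟨hc.norm, C, fun h hh x => by simpa using hC h hh x⟩
  have hspec2 : ∀ᶠ h : ℝ in 𝓝[>] 0, MemLp (spec h fun n => G (node h n)) 2 volume ∧
      ∫ η, ‖spec h (fun n => G (node h n)) η‖ ^ 2 = h ^ 2 * ∑' n, ‖G (node h n)‖ ^ 2 := by
    filter_upwards [hsmall] with h hh
    obtain ⟨w, hw, hwn⟩ := hd.norm_sq_node (by norm_num) hh.1 hh.2
    have e : (fun n => G (node h n)) = w := funext fun n => (hw n).symm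
    rw [e]
    refine ⟨memLp_spec hh.1 w, ?_⟩
    have h1 := eLpNorm_two_eq_ofReal (memLp_spec hh.1 w)
    rw [eLpNorm_spec hh.1, ENNReal.ofReal_eq_ofReal_iff (by have := hh.1; positivity)
      (Real.sqrt_nonneg _)] at h1
    rw [← Real.sq_sqrt (integral_nonneg fun η => sq_nonneg _), ← h1, mul_pow, hwn]
  have l1 : Tendsto (fun h => ∫ η, ‖spec h (fun n => G (node h n)) η‖ ^ 2) (𝓝[>] 0)
      (𝓝 (∫ η, ‖𝓕 (G : Plane → Spinor) η‖ ^ 2)) := by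
    have h1 : ∫ η, ‖𝓕 (G : Plane → Spinor) η‖ ^ 2 = ∫ x, ‖G x‖ ^ 2 :=
      SchwartzMap.integral_norm_sq_fourier G
    rw [h1]
    exact (hd.tendsto_riemannSum_norm_sq (by norm_num)).congr'
      (hspec2.mono fun h hh => hh.2.symm)
  have l2 : Tendsto (fun h => ∫ η, (inner ℂ (spec h (fun n => G (node h n)) η)
      (𝓕 (G : Plane → Spinor) η)).re) (𝓝[>] 0) (𝓝 (∫ η, ‖𝓕 (G : Plane → Spinor) η‖ ^ 2)) := by
    obtain ⟨C, hC⟩ : ∃ C, ∀ᶠ h : ℝ in 𝓝[>] 0, h ^ 2 • ∑' n, ‖G (node h n)‖ ≤ C :=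
      ⟨_, (hdn.tendsto_riemannSum (by norm_num)).eventually_le_const (lt_add_one _)⟩
    classical
    -- A representative of `spec` given by a formula at every frequency: the null set where the two
    -- differ depends on `h`, whereas the limit `h → 0` is taken at fixed `η`.
    let S : ℝ → Plane → Spinor := fun h η => if (2 * Real.pi) • η ∈ torus h then
      h ^ 2 • ∑' n, modulate η G (node h n) else 0
    have hSspec : ∀ h : ℝ, 0 < h → spec h (fun n => G (node h n)) =ᵐ[volume] S h := fun h hh => by
      filter_upwards [spec_samples hh hG] with η hη
      by_cases hm : (2 * Real.pi) • η ∈ torus h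
      · rw [hη hm]
        exact (if_pos hm).symm
      · rw [spec_of_notMem _ hm]
        exact (if_neg hm).symm
    have hSlim : ∀ η, Tendsto (fun h => S h η) (𝓝[>] 0)
        (𝓝 (𝓕 (G : Plane → Spinor) η)) := fun η => by
      rw [fourier_eq_integral_modulate]
      refine ((hmod η).tendsto_riemannSum (by norm_num)).congr' ?_
      filter_upwards [eventually_mem_torus η] with h hh
      exact (if_pos hh).symm
    have hSbound : ∀ᶠ h : ℝ in 𝓝[>] 0, ∀ η, ‖S h η‖ ≤ C := by
      filter_upwards [hC, hsmall] with h hh h0 η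
      have hsum : Summable fun n => ‖modulate η G (node h n)‖ := by
        obtain ⟨D, hD⟩ := (hmod η).2
        exact summable_norm_node (by norm_num) h0.1 (hD 0 (by simp))
      have hle : ‖S h η‖ ≤ ‖h ^ 2 • ∑' n, modulate η G (node h n)‖ := by
        by_cases hm : (2 * Real.pi) • η ∈ torus h
        · exact (congrArg norm (if_pos hm)).le
        · exact (congrArg norm (if_neg hm)).le.trans (norm_zero.le.trans (norm_nonneg _))
      refine hle.trans (le_trans ?_ hh)
      rw [norm_smul, Real.norm_of_nonneg (sq_nonneg h), smul_eq_mul]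
      refine mul_le_mul_of_nonneg_left ((norm_tsum_le_tsum_norm hsum).trans_eq ?_) (sq_nonneg h)
      simp_rw [norm_modulate]
    have l5 : Tendsto (fun h => ∫ η, (inner ℂ (S h η) (𝓕 (G : Plane → Spinor) η)).re) (𝓝[>] 0)
        (𝓝 (∫ η, ‖𝓕 (G : Plane → Spinor) η‖ ^ 2)) := by
      refine tendsto_integral_filter_of_dominated_convergence
        (fun η => C * ‖𝓕 (G : Plane → Spinor) η‖) ?_ ?_ (hF1.norm.const_mul C)
        (.of_forall fun η => ?_)
      · filter_upwards [hsmall] with h hh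
        exact Complex.continuous_re.comp_aestronglyMeasurable
          (((aestronglyMeasurable_spec h _).congr (hSspec h hh.1)).inner hF2.1)
      · filter_upwards [hSbound] with h hh
        refine .of_forall fun η => (Complex.abs_re_le_norm _).trans ?_
        exact (norm_inner_le_norm _ _).trans
          (mul_le_mul_of_nonneg_right (hh η) (norm_nonneg _))
      · have e : ‖𝓕 (G : Plane → Spinor) η‖ ^ 2 =
            (inner ℂ (𝓕 (G : Plane → Spinor) η) (𝓕 (G : Plane → Spinor) η)).re :=
          norm_sq_eq_re_inner (𝕜 := ℂ) _
        rw [e]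
        exact (Complex.continuous_re.tendsto _).comp ((hSlim η).inner tendsto_const_nhds)
    refine l5.congr' ?_
    filter_upwards [hsmall] with h hh
    refine integral_congr_ae ?_
    filter_upwards [hSspec h hh.1] with η hη
    rw [hη]
  have l3 := ((l1.sub (l2.const_mul 2)).add_const (∫ η, ‖𝓕 (G : Plane → Spinor) η‖ ^ 2))
  have l4 : Tendsto (fun h => ∫ η, ‖spec h (fun n => G (node h n)) η -
      𝓕 (G : Plane → Spinor) η‖ ^ 2) (𝓝[>] 0) (𝓝 0) := by
    have e : ∀ a : ℝ, a - 2 * a + a = 0 := fun a => by ring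
    rw [e] at l3
    exact l3.congr' (hspec2.mono fun h hh => (memLp_two_norm_sq_sub hh.1 hF2).symm)
  have l5 := ENNReal.tendsto_ofReal (l4.sqrt)
  rw [Real.sqrt_zero, ENNReal.ofReal_zero] at l5
  exact l5.congr' (hspec2.mono fun h hh => (eLpNorm_two_eq_ofReal (hh.1.sub hF2)).symm)

end

/-! ### Convergence of the discrete Fourier transforms -/

section

open SchwartzMap FourierTransform

theorem fourierInv_sub_apply {F : Type*} [NormedAddCommGroup F] [NormedSpace ℂ F]
    {g k : Plane → F} (hg : Integrable g) (hk : Integrable k) (x : Plane) :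
    𝓕⁻ (fun η => g η - k η) x = 𝓕⁻ g x - 𝓕⁻ k x := by
  rw [Real.fourierInv_eq, Real.fourierInv_eq, Real.fourierInv_eq, ← integral_sub]
  · simp_rw [smul_sub]
  all_goals
    have := fun {g : Plane → F} (hg : Integrable g) =>
      (Real.fourierIntegral_convergent_iff (-x)).2 hg
    simp only [inner_neg_right, neg_neg] at this
    first | exact this hg | exact this hk

theorem fourierInv_smul_const (c : Plane → ℂ) (e : Spinor) (x : Plane) :
    𝓕⁻ (fun η => c η • e) x = 𝓕⁻ c x • e := by
  rw [Real.fourierInv_eq', Real.fourierInv_eq', ← integral_smul_const]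
  simp_rw [smul_smul, smul_eq_mul]

theorem fourier_smul_const (c : Plane → ℂ) (e : Spinor) (x : Plane) :
    𝓕 (fun η => c η • e) x = 𝓕 c x • e := by
  rw [Real.fourier_eq', Real.fourier_eq', ← integral_smul_const]
  simp_rw [smul_smul, smul_eq_mul]

/-- First `d ≤ εb⁻³ + ε⁻¹b³d²` by the arithmetic-geometric mean. Then `ε⁻¹b³ ≤ εb⁴ + ε⁻⁷`, by
comparing `b` with `ε⁻²`. With `b = ⟨η⟩` the exponent `3` is large enough for `b⁻³` to be integrable
in the plane and still below the `4` supplied by an `H²` bound. -/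
theorem le_weighted_square {ε b d : ℝ} (hε : 0 < ε) (hb : 0 < b) :
    d ≤ ε * (b ^ 3)⁻¹ + ε * (b ^ 2 * d) ^ 2 + (ε⁻¹) ^ 7 * d ^ 2 := by
  have h1 : d ≤ ε * (b ^ 3)⁻¹ + ε⁻¹ * b ^ 3 * d ^ 2 := by
    have h2 : 0 < ε⁻¹ * b ^ 3 := by positivity
    have h3 : ε * (b ^ 3)⁻¹ = (ε⁻¹ * b ^ 3)⁻¹ := by rw [mul_inv, inv_inv]
    rw [h3]
    set y := ε⁻¹ * b ^ 3
    have h4 : 0 < y⁻¹ := inv_pos.2 h2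
    have h5 : y * y⁻¹ = 1 := mul_inv_cancel₀ h2.ne'
    have h6 : 0 ≤ y * (d - y⁻¹ / 2) ^ 2 := by positivity
    have h7 : y * (d - y⁻¹ / 2) ^ 2 = y * d ^ 2 - (y * y⁻¹) * d + (y * y⁻¹) * y⁻¹ / 4 := by ring
    rw [h7, h5] at h6
    linarith
  have h2 : ε⁻¹ * b ^ 3 ≤ ε * b ^ 4 + (ε⁻¹) ^ 7 := by
    set e := ε⁻¹
    have he : ε * e = 1 := mul_inv_cancel₀ hε.ne'
    have he0 : 0 < e := inv_pos.2 hε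
    rcases le_total (e ^ 2) b with h | h
    · have : e * b ^ 3 ≤ ε * b ^ 4 := by
        calc e * b ^ 3 = (ε * e) * e * b ^ 3 := by rw [he, one_mul]
          _ = ε * b ^ 3 * e ^ 2 := by ring
          _ ≤ ε * b ^ 3 * b := by gcongr
          _ = _ := by ring
      have : 0 ≤ e ^ 7 := by positivity
      linarith
    · have : e * b ^ 3 ≤ e ^ 7 := by
        calc e * b ^ 3 ≤ e * (e ^ 2) ^ 3 := by gcongr
          _ = _ := by ring
      have : 0 ≤ ε * b ^ 4 := by positivity
      linarith
  calc d ≤ _ := h1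
    _ ≤ ε * (b ^ 3)⁻¹ + (ε * b ^ 4 + (ε⁻¹) ^ 7) * d ^ 2 := by gcongr
    _ = _ := by ring

theorem bracketPow_neg_three (η : Plane) : bracketPow (-3) η = (√(1 + ‖η‖ ^ 2) ^ 3)⁻¹ := by
  have h0 : 0 ≤ 1 + ‖η‖ ^ 2 := by positivity
  rw [bracketPow, neg_div, Real.rpow_neg h0, Real.sqrt_eq_rpow, ← Real.rpow_mul_natCast h0]
  norm_num

theorem integrable_of_memLp_weighted {E : Type*} [NormedAddCommGroup E] [NormedSpace ℂ E]
    {D : Plane → E} (h2 : MemLp D 2 (volume : Measure Plane))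
    (hw : MemLp (fun η => ((1 + ‖η‖ ^ 2 : ℝ) : ℂ) • D η) 2 (volume : Measure Plane)) {ε : ℝ}
    (hε : 0 < ε) : Integrable D ∧ ∫ η, ‖D η‖ ≤ ε * (∫ η, bracketPow (-3) η) +
      ε * (∫ η, ‖((1 + ‖η‖ ^ 2 : ℝ) : ℂ) • D η‖ ^ 2) + (ε⁻¹) ^ 7 * ∫ η, ‖D η‖ ^ 2 := by
  have i1 := (integrable_bracketPow (t := 3) (by norm_num)).const_mul ε
  have i2 := (hw.integrable_norm_pow (by norm_num)).const_mul ε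
  have i3 := (h2.integrable_norm_pow (by norm_num)).const_mul ((ε⁻¹) ^ 7)
  have i12 : Integrable fun η => ε * bracketPow (-3) η +
    ε * ‖((1 + ‖η‖ ^ 2 : ℝ) : ℂ) • D η‖ ^ 2 := i1.add i2
  have i4 : Integrable fun η => ε * bracketPow (-3) η +
    ε * ‖((1 + ‖η‖ ^ 2 : ℝ) : ℂ) • D η‖ ^ 2 + (ε⁻¹) ^ 7 * ‖D η‖ ^ 2 := i12.add i3
  have hle : ∀ η, ‖D η‖ ≤ ε * bracketPow (-3) η +
      ε * ‖((1 + ‖η‖ ^ 2 : ℝ) : ℂ) • D η‖ ^ 2 + (ε⁻¹) ^ 7 * ‖D η‖ ^ 2 := fun η => by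
    have h0 : 0 < 1 + ‖η‖ ^ 2 := by positivity
    have h1 := le_weighted_square (d := ‖D η‖) hε (Real.sqrt_pos.2 h0)
    rw [norm_smul, Complex.norm_real, Real.norm_of_nonneg h0.le, bracketPow_neg_three]
    rwa [Real.sq_sqrt h0.le] at h1
  have hD : Integrable D := i4.mono' h2.1 (.of_forall hle)
  refine ⟨hD, (integral_mono hD.norm i4 hle).trans_eq ?_⟩
  rw [integral_add i12 i3, integral_add i1 i2, integral_const_mul, integral_const_mul,
    integral_const_mul]

theorem integral_norm_sq_le_of_eLpNorm_le {α E : Type*} [MeasurableSpace α] {μ : Measure α}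
    [NormedAddCommGroup E] {g : α → E} (hg : MemLp g 2 μ) {B : ℝ} (hB : 0 ≤ B)
    (h : eLpNorm g 2 μ ≤ ENNReal.ofReal B) : ∫ x, ‖g x‖ ^ 2 ∂μ ≤ B ^ 2 := by
  rw [eLpNorm_two_eq_ofReal hg, ENNReal.ofReal_le_ofReal_iff hB] at h
  exact (Real.sqrt_le_left hB).1 h

/-- The weighted bound controls high frequencies and `L²` convergence the remaining ones, so the
transforms converge in `L¹`. -/
theorem tendsto_integral_norm_of_weighted {E : Type*} [NormedAddCommGroup E] [NormedSpace ℂ E]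
    {l : Filter ℝ} {D : ℝ → Plane → E} (h2 : ∀ᶠ h in l, MemLp (D h) 2 (volume : Measure Plane))
    (hlim : Tendsto (fun h => eLpNorm (D h) 2 volume) l (𝓝 0)) {B : ℝ} (hB : 0 ≤ B)
    (hw : ∀ᶠ h in l, MemLp (fun η => ((1 + ‖η‖ ^ 2 : ℝ) : ℂ) • D h η) 2 (volume : Measure Plane) ∧
      eLpNorm (fun η => ((1 + ‖η‖ ^ 2 : ℝ) : ℂ) • D h η) 2 volume ≤ ENNReal.ofReal B) :
    Tendsto (fun h => ∫ η, ‖D h η‖) l (𝓝 0) := by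
  set K := ∫ η, bracketPow (-3) η
  have hK : 0 ≤ K := integral_nonneg fun η => bracketPow_nonneg _ _
  rw [Metric.tendsto_nhds]
  intro δ hδ
  -- The three terms of `integrable_of_memLp_weighted` are at most `εK`, `εB²` and `ε`, with sum
  -- `δ/2`. The last needs `‖D‖² ≤ ε⁸` against the factor `ε⁻⁷`, which fixes `ρ`.
  set ε := δ / (2 * (K + B ^ 2 + 1)) with hε'
  have hε : 0 < ε := by positivity
  set ρ := √(ε * ε ^ 7) with hρ
  have hρ0 : 0 < ρ := Real.sqrt_pos.2 (by positivity)
  filter_upwards [h2, hw, (ENNReal.tendsto_nhds_zero.1 hlim) (ENNReal.ofReal ρ)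
    (ENNReal.ofReal_pos.2 hρ0)] with h hh hhw hl
  have h3 := (integrable_of_memLp_weighted hh hhw.1 hε).2
  have h4 := integral_norm_sq_le_of_eLpNorm_le hhw.1 hB hhw.2
  have h5 := integral_norm_sq_le_of_eLpNorm_le hh hρ0.le hl
  rw [hρ, Real.sq_sqrt (by positivity)] at h5
  have h6 : (ε⁻¹) ^ 7 * ∫ η, ‖D h η‖ ^ 2 ≤ ε := by
    calc _ ≤ (ε⁻¹) ^ 7 * (ε * ε ^ 7) := by gcongr
      _ = ε * (ε⁻¹ * ε) ^ 7 := by ring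
      _ = ε := by rw [inv_mul_cancel₀ hε.ne', one_pow, mul_one]
  have h7 : ε * (∫ η, ‖((1 + ‖η‖ ^ 2 : ℝ) : ℂ) • D h η‖ ^ 2) ≤ ε * B ^ 2 := by gcongr
  rw [Real.dist_0_eq_abs, abs_of_nonneg (integral_nonneg fun η => norm_nonneg _)]
  have h8 : ε * (2 * (K + B ^ 2 + 1)) = δ := div_mul_cancel₀ _ (by positivity)
  linarith

theorem norm_potentialL2_le (v : Cell → ℝ) {C : ℝ} (hv : ∀ n, |v n| ≤ C) (u : SqSum) :
    ‖potentialL2 v hv u‖ ≤ C * ‖u‖ := by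
  refine ContinuousLinearMap.le_of_opNorm_le _ ?_ u
  unfold potentialL2 fiberwise
  exact LinearMap.mkContinuous_norm_le _ ((abs_nonneg _).trans (hv 0)) _

theorem Decays.tendsto_sqrt {t : ℝ} (ht : 1 < t) {G : ℝ → Plane → Spinor} (hG : Decays t G) :
    Tendsto (fun h : ℝ => √(h ^ 2 * ∑' n, ‖G h (node h n)‖ ^ 2)) (𝓝[>] 0)
      (𝓝 (√(∫ x, ‖G 0 x‖ ^ 2))) :=
  (hG.tendsto_riemannSum_norm_sq ht).sqrt

/-- The samples of a decaying family, as an element of `ℓ²`. -/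
def samples {t : ℝ} (ht : 1 < t) {G : ℝ → Plane → Spinor} (hG : Decays t G) {h : ℝ}
    (h0 : 0 < h ∧ h ≤ 1) : SqSum :=
  ⟨fun n => G h (node h n), memℓp_two_iff.2 (hG.summable_norm_sq ht h0.1 h0.2)⟩

theorem mul_norm_samples {t : ℝ} (ht : 1 < t) {G : ℝ → Plane → Spinor} (hG : Decays t G) {h : ℝ}
    (h0 : 0 < h ∧ h ≤ 1) : h * ‖samples ht hG h0‖ = √(h ^ 2 * ∑' n, ‖G h (node h n)‖ ^ 2) := by
  have h1 := (SqSum.hasSum_norm_sq (samples ht hG h0)).tsum_eq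
  rw [show ∑' n, ‖G h (node h n)‖ ^ 2 = ‖samples ht hG h0‖ ^ 2 from h1, ← mul_pow,
    Real.sqrt_sq (mul_nonneg h0.1.le (norm_nonneg _))]

end

/-! ### Convergence of the lattice solutions in frequency space -/

section

open SchwartzMap FourierTransform

/-- The vector `(1, 1)`. -/
def ones : Spinor := WithLp.toLp 2 fun _ => 1

theorem smul_ones (c : ℂ) : c • ones = WithLp.toLp 2 fun _ => c := by
  ext i
  simp [ones]

theorem groundProj_eq (c : Spinor) : groundProj c = ((c 0 + c 1) / 2) • ones := by
  rw [smul_ones, groundProj]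
  ext i
  fin_cases i <;> rfl

theorem groundProj_smul_ones (c : ℂ) : groundProj (c • ones) = c • ones := by
  rw [groundProj_eq]
  congr 1
  simp [ones]

theorem norm_toLp_two {F : Type*} [NormedAddCommGroup F] {g : Plane → F}
    (hg : MemLp g 2 (volume : Measure Plane)) : ‖hg.toLp g‖ = √(∫ x, ‖g x‖ ^ 2) := by
  rw [Lp.norm_toLp, eLpNorm_two_eq_ofReal hg, ENNReal.toReal_ofReal (Real.sqrt_nonneg _)]

theorem eLpNorm_coeFn {F : Type*} [NormedAddCommGroup F] (v : Lp F 2 (volume : Measure Plane)) :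
    eLpNorm v 2 volume = ENNReal.ofReal ‖v‖ := by
  rw [← Lp.enorm_def, ofReal_norm]

theorem eventually_unit : ∀ᶠ h : ℝ in 𝓝[>] 0, 0 < h ∧ h ≤ 1 := by
  filter_upwards [Ioc_mem_nhdsGT (zero_lt_one' ℝ)] with h hh using hh

variable {V : Plane → ℝ} {f : Plane → Spinor} {s C : ℝ} {z : ℂ}

theorem memLp_groundComponent (hs : 1 < s) (hf : Decays s fun _ => f) :
    MemLp (fun x => (f x 0 + f x 1) / 2) 2 (volume : Measure Plane) := by
  have h1 := ((hf.apply 0).add (hf.apply 1)).const_smul 2⁻¹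
  refine (h1.memLp_two hs (h := 0) (by simp)).congr_norm ?_ (.of_forall fun x => ?_)
  · have := hf.continuous_apply 0
    have : Continuous fun x => (f x 0 + f x 1) / 2 := by fun_prop
    exact this.aestronglyMeasurable
  · rw [smul_eq_mul, div_eq_inv_mul]

/-- Stability meets consistency: the difference of the approximate and exact lattice solutions
solves the lattice equation with the residual as right side. -/
theorem im_mul_norm_ansatz_sub_le (hs : 1 < s) (hf : Decays s fun _ => f) (hV : ∀ x, |V x| ≤ C)
    {φ q : Plane → ℂ} (hφ : ContDiff ℝ ∞ φ) (hA : Decays s (ansatz φ q))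
    (hR : Decays s (residual φ q V f z)) {h : ℝ} (h0 : 0 < h ∧ h ≤ 1) {u : SqSum}
    (hu : IsLatticeSolution h V f z u) :
    |z.im| * ‖samples hs hA h0 - u‖ ≤ ‖samples hs hR h0‖ := by
  have h1 := (isLatticeSolution_iff hV (memℓp_two_iff.2 (hf.summable_norm_sq hs h0.1 h0.2)) u).1 hu
  set A := schrodingerL2 h (fun n => V (node h n)) (fun _ => hV _) with hA'
  have h2 : A (samples hs hA h0) - z • samples hs hA h0 = samples hs hf h0 + samples hs hR h0 := by
    ext n : 2
    exact (congrArg (· - z • ansatz φ q h (node h n)) (schrodingerL2_apply h _ _ _ n)).trans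
      (negLaplacian_ansatz q V f z hφ h0.1.ne' n)
  have h3 : A (samples hs hA h0 - u) - z • (samples hs hA h0 - u) = samples hs hR h0 := by
    have h4 : A u - z • u = samples hs hf h0 := h1
    rw [map_sub, smul_sub, sub_sub_sub_comm, h2, h4, add_sub_cancel_left]
  rw [← h3]
  exact isSelfAdjoint_im_mul_norm_le (isSelfAdjoint_schrodingerL2 _ _ _) z _

theorem sqrt_integral_residual_zero (hs : 1 < s) (hf : Decays s fun _ => f) (hVc : Continuous V)
    (hV : ∀ x, |V x| ≤ C) (φ : 𝓢(Plane, ℂ)) :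
    √(∫ x, ‖residual φ (fun x => (f x 0 - f x 1) / 2) V f z 0 x‖ ^ 2) =
      ‖ones‖ * ‖(memLp_schrodinger hVc hV z φ).toLp _ - (memLp_groundComponent hs hf).toLp _‖ := by
  rw [← MemLp.toLp_sub, norm_toLp_two, ← Real.sqrt_sq (norm_nonneg ones),
    ← Real.sqrt_mul (sq_nonneg _), ← integral_const_mul]
  congr 2
  ext1 x
  rw [residual_zero V f z (contDiff_schwartz φ), ← smul_ones, norm_smul, mul_pow, mul_comm]
  rfl

/-- For a fixed profile `φ` the passage from `spec (U h)` to the limit goes through the ansatz, the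
samples of `φ(1, 1)` and the transform of `φ`. The profile is chosen before `h` tends to `0`. -/
theorem tendsto_eLpNorm_spec_sub (hs : 1 < s) (hf : Decays s fun _ => f) (hVc : Continuous V)
    (hV : ∀ x, |V x| ≤ C) (hz : z.im ≠ 0) {v : Lp ℂ 2 (volume : Measure Plane)}
    (happrox : ∀ ε : ℝ, 0 < ε → ∃ φ : 𝓢(Plane, ℂ), HasCompactSupport φ ∧
        ‖(memLp_schrodinger hVc hV z φ).toLp _ - (memLp_groundComponent hs hf).toLp _‖ < ε ∧
        ‖(memLp_schwartz φ).toLp φ - v‖ < ε)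
    {U : ℝ → Cell → Spinor} (hU : ∀ h : ℝ, 0 < h → IsLatticeSolution h V f z (U h)) :
    Tendsto (fun h => eLpNorm (fun η => spec h (U h) η -
      (𝓕 v : Lp ℂ 2 (volume : Measure Plane)) η • ones) 2 volume) (𝓝[>] 0) (𝓝 0) := by
  rw [ENNReal.tendsto_nhds_zero]
  intro δ' hδ'
  obtain ⟨δ, hδ0, hδ⟩ := ENNReal.lt_iff_exists_real_btwn.1 hδ'
  have hδ0 : 0 < δ := ENNReal.ofReal_pos.1 hδ.1
  set N := ‖ones‖
  have hz' := abs_pos.2 hz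
  -- One summand for each error: exact solution against ansatz, ansatz against samples of `φ(1, 1)`,
  -- discrete against continuous transform of `φ`, and `φ` against `v`.
  set ε := δ / (N / |z.im| + 1 + 1 + N)
  have hN1 : 0 < N := norm_pos_iff.2 fun h => by
    simpa [ones] using congrFun (congrArg WithLp.ofLp h) 0
  have hN0 : 0 ≤ N := hN1.le
  have hε : 0 < ε := by positivity
  obtain ⟨φ, hφc, hφ1, hφ2⟩ := happrox ε hε
  set q : Plane → ℂ := fun x => (f x 0 - f x 1) / 2
  have hφ := contDiff_schwartz φ
  have hq : Decays s fun _ => q := by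
    refine cast (congrArg (Decays s) (funext₂ fun h x => ?_))
      (((hf.apply 0).sub (hf.apply 1)).const_smul 2⁻¹)
    exact (div_eq_inv_mul _ _).symm
  have hs0 : 0 ≤ s := by linarith
  have hA := decays_ansatz hφ hφc hq
  have hR := decays_residual z hs0 hφ hφc hq hf hVc hV
  have hGc : HasCompactSupport fun x => φ x • ones := hφc.smul_right
  have hGs : ContDiff ℝ ∞ fun x => φ x • ones := hφ.smul contDiff_const
  have hP : Decays s fun _ x => φ x • ones :=
    .of_bound hGs.continuous (exists_bracketPow_bound s hGs.continuous hGc).choose_spec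
  have hK := hA.sub hP
  have lR : ∀ᶠ h : ℝ in 𝓝[>] 0,
      √(h ^ 2 * ∑' n, ‖residual φ q V f z h (node h n)‖ ^ 2) < N * ε := by
    refine (hR.tendsto_sqrt hs).eventually_lt_const ?_
    rw [sqrt_integral_residual_zero hs hf hVc hV φ]
    exact mul_lt_mul_of_pos_left hφ1 hN1
  have lK : ∀ᶠ h : ℝ in 𝓝[>] 0,
      √(h ^ 2 * ∑' n, ‖ansatz φ q h (node h n) - φ (node h n) • ones‖ ^ 2) < ε := by
    refine (hK.tendsto_sqrt hs).eventually_lt_const ?_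
    have e : ∀ x, ansatz φ q 0 x - φ x • ones = 0 := fun x => by
      rw [smul_ones, ansatz]
      ext i
      fin_cases i <;> simp
    simp [e, hε]
  have lP := ENNReal.tendsto_nhds_zero.1
    (tendsto_eLpNorm_spec_samples (hGc.toSchwartzMap hGs) hGc) _ (ENNReal.ofReal_pos.2 hε)
  filter_upwards [lR, lK, lP, eventually_unit] with h hR' hK' hP' h0
  set u : SqSum := ⟨U h, memℓp_two_iff.2 (hU h h0.1).1⟩ with hu
  set w := samples hs hA h0
  set k := samples hs hK h0
  set p := samples hs hP h0
  have b1 : eLpNorm (spec h (w - u : SqSum)) 2 volume ≤ ENNReal.ofReal (ε * (N / |z.im|)) := by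
    rw [eLpNorm_spec h0.1]
    refine ENNReal.ofReal_le_ofReal ?_
    have h1 := im_mul_norm_ansatz_sub_le hs hf hV hφ hA hR h0 (u := u) (hU h h0.1)
    have h2 := mul_norm_samples hs hR h0
    rw [← mul_div_assoc, le_div_iff₀ hz']
    have h3 := mul_le_mul_of_nonneg_left h1 h0.1.le
    linarith
  have b2 : eLpNorm (spec h (w - p : SqSum)) 2 volume ≤ ENNReal.ofReal (ε * 1) := by
    have h1 : w - p = k := rfl
    have h2 := mul_norm_samples hs hK h0
    rw [eLpNorm_spec h0.1, h1, h2, mul_one]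
    exact ENNReal.ofReal_le_ofReal hK'.le
  have b3 : eLpNorm (fun η => spec h p η - 𝓕 (φ : Plane → ℂ) η • ones) 2 volume ≤
      ENNReal.ofReal (ε * 1) := by
    rw [mul_one]
    refine le_trans (le_of_eq ?_) hP'
    congr 1
    ext1 η
    rw [← fourier_smul_const]
    rfl
  have hv4 : (fun η => 𝓕 (φ : Plane → ℂ) η - (𝓕 v : Lp ℂ 2 (volume : Measure Plane)) η) =ᵐ[volume]
      (𝓕 ((memLp_schwartz φ).toLp φ - v) : Lp ℂ 2 (volume : Measure Plane)) := by
    have h1 : (𝓕 ((memLp_schwartz φ).toLp φ - v) : Lp ℂ 2 (volume : Measure Plane)) =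
        (𝓕 φ).toLp 2 - 𝓕 v := by
      rw [← SchwartzMap.toLp_fourier_eq]
      exact map_sub (Lp.fourierTransformₗᵢ Plane ℂ) _ _
    rw [h1]
    filter_upwards [Lp.coeFn_sub ((𝓕 φ).toLp 2) (𝓕 v : Lp ℂ 2 (volume : Measure Plane)),
      (𝓕 φ).coeFn_toLp 2] with η h2 h3
    rw [h2, Pi.sub_apply, h3]
    rfl
  have b4 : eLpNorm (fun η => (𝓕 (φ : Plane → ℂ) η -
      (𝓕 v : Lp ℂ 2 (volume : Measure Plane)) η) • ones) 2 volume ≤ ENNReal.ofReal (ε * N) := by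
    refine (eLpNorm_le_mul_eLpNorm_of_ae_le_mul (c := N) (.of_forall fun η =>
      (norm_smul _ _).le.trans (mul_comm _ _).le) 2).trans ?_
    rw [eLpNorm_congr_ae hv4, eLpNorm_coeFn, Lp.norm_fourier_eq, ← ENNReal.ofReal_mul hN0]
    refine ENNReal.ofReal_le_ofReal ?_
    rw [mul_comm]
    exact mul_le_mul_of_nonneg_right hφ2.le hN0
  have m1 := aestronglyMeasurable_spec h (w - u : SqSum)
  have m2 := aestronglyMeasurable_spec h (w - p : SqSum)
  have mφ : AEStronglyMeasurable (𝓕 (φ : Plane → ℂ)) (volume : Measure Plane) := by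
    rw [← SchwartzMap.fourier_coe]
    exact (𝓕 φ).continuous.aestronglyMeasurable
  have mv := Lp.aestronglyMeasurable (𝓕 v : Lp ℂ 2 (volume : Measure Plane))
  have m3 : AEStronglyMeasurable (fun η => spec h p η - 𝓕 (φ : Plane → ℂ) η • ones) volume :=
    (aestronglyMeasurable_spec h p).sub (mφ.smul_const ones)
  have m4 : AEStronglyMeasurable (fun η => (𝓕 (φ : Plane → ℂ) η -
      (𝓕 v : Lp ℂ 2 (volume : Measure Plane)) η) • ones) volume := (mφ.sub mv).smul_const ones
  have key : (fun η => spec h (U h) η - (𝓕 v : Lp ℂ 2 (volume : Measure Plane)) η • ones)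
      =ᵐ[volume] spec h (w - p : SqSum) - spec h (w - u : SqSum) +
        (fun η => spec h p η - 𝓕 (φ : Plane → ℂ) η • ones) +
        (fun η => (𝓕 (φ : Plane → ℂ) η - (𝓕 v : Lp ℂ 2 (volume : Measure Plane)) η) • ones) := by
    filter_upwards [spec_sub h0.1 w u, spec_sub h0.1 w p] with η h1 h2
    simp only [Pi.add_apply, Pi.sub_apply, h1, h2, sub_smul]
    change spec h u η - _ = _
    abel
  rw [eLpNorm_congr_ae key]
  refine le_trans ?_ hδ.2.le
  have hsum : δ = ε * 1 + ε * (N / |z.im|) + ε * 1 + ε * N := by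
    have : ε * (N / |z.im| + 1 + 1 + N) = δ := div_mul_cancel₀ _ (by positivity)
    linarith
  rw [hsum, ENNReal.ofReal_add (by positivity) (by positivity),
    ENNReal.ofReal_add (by positivity) (by positivity),
    ENNReal.ofReal_add (by positivity) (by positivity)]
  refine (eLpNorm_add_le ((m2.sub m1).add m3) m4 (by norm_num)).trans (add_le_add ?_ b4)
  refine (eLpNorm_add_le (m2.sub m1) m3 (by norm_num)).trans (add_le_add ?_ b3)
  exact (eLpNorm_sub_le m2 m1 (by norm_num)).trans (add_le_add b2 b1)

end

/-! ### Uniform Sobolev bounds and conclusion -/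

section

open SchwartzMap FourierTransform

variable {V : Plane → ℝ} {f : Plane → Spinor} {s C : ℝ} {z : ℂ}

theorem memLp_smul_ones {c : Plane → ℂ} (hc : MemLp c 2 (volume : Measure Plane)) :
    MemLp (fun x => c x • ones) 2 (volume : Measure Plane) :=
  hc.of_le_mul (c := ‖ones‖) (hc.1.smul_const ones)
    (.of_forall fun _ => (norm_smul _ _).le.trans (mul_comm _ _).le)

/-- A discrete `H²` estimate; `9/8` is the inverse of the ellipticity constant in
`norm_spec_laplacianL2_ge`. -/
theorem memLp_weighted_spec {h : ℝ} (hh : 0 < h) (u : SqSum) :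
    MemLp (fun η => ((1 + ‖η‖ ^ 2 : ℝ) : ℂ) • spec h u η) 2 (volume : Measure Plane) ∧
      eLpNorm (fun η => ((1 + ‖η‖ ^ 2 : ℝ) : ℂ) • spec h u η) 2 (volume : Measure Plane) ≤
        ENNReal.ofReal (h * ‖u‖ + 9 / 8 * (h * ‖laplacianL2 h u‖)) := by
  have m1 := memLp_spec hh u
  have m2 := memLp_spec hh (laplacianL2 h u)
  have m3 : MemLp (fun η => (9 / 8 : ℝ) • ‖spec h (laplacianL2 h u : SqSum) η‖) 2
      (volume : Measure Plane) := m2.norm.const_smul (9 / 8 : ℝ)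
  have hle : ∀ᵐ η : Plane, ‖((1 + ‖η‖ ^ 2 : ℝ) : ℂ) • spec h u η‖ ≤
      ‖spec h u η‖ + (9 / 8 : ℝ) • ‖spec h (laplacianL2 h u : SqSum) η‖ := by
    filter_upwards [norm_spec_laplacianL2_ge hh u] with η hη
    rw [norm_smul, Complex.norm_real, Real.norm_of_nonneg (by positivity), smul_eq_mul]
    linarith
  have hc : Continuous fun η : Plane => ((1 + ‖η‖ ^ 2 : ℝ) : ℂ) := by fun_prop
  refine ⟨(m1.norm.add m3).mono' (hc.aestronglyMeasurable.smul m1.1) hle, ?_⟩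
  refine (eLpNorm_mono_ae_real hle).trans
    ((eLpNorm_add_le m1.norm.1 m3.1 (by norm_num)).trans_eq ?_)
  have e : eLpNorm (fun η => (9 / 8 : ℝ) • ‖spec h (laplacianL2 h u : SqSum) η‖) 2
      (volume : Measure Plane) = ENNReal.ofReal (9 / 8 * (h * ‖laplacianL2 h u‖)) := by
    rw [show (fun η => (9 / 8 : ℝ) • ‖spec h (laplacianL2 h u : SqSum) η‖) =
      (9 / 8 : ℝ) • fun η => ‖spec h (laplacianL2 h u : SqSum) η‖ from rfl,
      eLpNorm_const_smul, eLpNorm_norm, eLpNorm_spec hh, Real.enorm_eq_ofReal (by norm_num),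
      ← ENNReal.ofReal_mul (by norm_num)]
  rw [e, eLpNorm_norm, eLpNorm_spec hh, ENNReal.ofReal_add (by positivity) (by positivity)]

/-- The resolvent bound controls `h‖u‖` by the Riemann sum of `|f|²`. The equation itself expresses
the Laplacian of `u` as `f + zu - Vu`, so it is controlled too, uniformly in small `h`. -/
theorem eventually_norm_lattice_le (hs : 1 < s) (hf : Decays s fun _ => f)
    (hV : ∀ x, |V x| ≤ C) (hz : z.im ≠ 0) :
    ∃ B, 0 ≤ B ∧ ∀ᶠ h : ℝ in 𝓝[>] 0, ∀ u : SqSum, IsLatticeSolution h V f z u →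
      h * ‖u‖ + 9 / 8 * (h * ‖laplacianL2 h u‖) ≤ B := by
  have hz' := abs_pos.2 hz
  have hC : 0 ≤ C := (abs_nonneg _).trans (hV 0)
  set M := √(∫ x, ‖f x‖ ^ 2) + 1
  have hM : 0 ≤ M := by positivity
  refine ⟨M / |z.im| + 9 / 8 * (M + (‖z‖ + C) * (M / |z.im|)), by positivity, ?_⟩
  filter_upwards [(hf.tendsto_sqrt hs).eventually_lt_const (lt_add_one _), eventually_unit]
    with h hM' h0 u hu
  rw [← mul_norm_samples hs hf h0] at hM'
  have h1 := (isLatticeSolution_iff hV (memℓp_two_iff.2 (hf.summable_norm_sq hs h0.1 h0.2)) u).1 hu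
  set w := samples hs hf h0
  set Q := potentialL2 (fun n => V (node h n)) (fun _ => hV _)
  have h2 := isSelfAdjoint_im_mul_norm_le
    (isSelfAdjoint_schrodingerL2 h (fun n => V (node h n)) (fun _ => hV _)) z u
  rw [h1] at h2
  have h2 : |z.im| * ‖u‖ ≤ ‖w‖ := h2
  have h3 : laplacianL2 h u = w + z • u - Q u := by
    have h4 : laplacianL2 h u + Q u - z • u = w := h1
    rw [← h4]
    abel
  have h4 : ‖laplacianL2 h u‖ ≤ ‖w‖ + (‖z‖ + C) * ‖u‖ := by
    rw [h3]
    have h5 := norm_potentialL2_le (fun n => V (node h n)) (fun _ => hV _) u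
    have h6 := norm_sub_le (w + z • u) (Q u)
    have h7 := norm_add_le w (z • u)
    rw [norm_smul] at h7
    have h5 : ‖Q u‖ ≤ C * ‖u‖ := h5
    linarith
  have h5 : h * ‖u‖ ≤ M / |z.im| := by
    rw [le_div_iff₀ hz']
    have := mul_le_mul_of_nonneg_left h2 h0.1.le
    linarith
  have h6 : h * ‖laplacianL2 h u‖ ≤ M + (‖z‖ + C) * (M / |z.im|) := by
    calc _ ≤ h * (‖w‖ + (‖z‖ + C) * ‖u‖) := mul_le_mul_of_nonneg_left h4 h0.1.le
      _ = h * ‖w‖ + (‖z‖ + C) * (h * ‖u‖) := by ring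
      _ ≤ _ := by
        gcongr
  linarith

theorem tendsto_integral_norm_spec_sub (hs : 1 < s) (hf : Decays s fun _ => f)
    (hV : ∀ x, |V x| ≤ C) (hz : z.im ≠ 0) {v : Plane → ℂ}
    (hv : MemLp v 2 (volume : Measure Plane))
    (hw : MemLp (fun η => ((1 + ‖η‖ ^ 2 : ℝ) : ℂ) • v η) 2 (volume : Measure Plane))
    {U : ℝ → Cell → Spinor} (hU : ∀ h : ℝ, 0 < h → IsLatticeSolution h V f z (U h))
    (hlim : Tendsto (fun h => eLpNorm (fun η => spec h (U h) η - v η • ones) 2 volume)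
      (𝓝[>] 0) (𝓝 0)) :
    Tendsto (fun h => ∫ η, ‖spec h (U h) η - v η • ones‖) (𝓝[>] 0) (𝓝 0) := by
  obtain ⟨B, hB, hev⟩ := eventually_norm_lattice_le (z := z) hs hf hV hz
  have hwo : MemLp (fun η => ((1 + ‖η‖ ^ 2 : ℝ) : ℂ) • v η • ones) 2 (volume : Measure Plane) := by
    refine (memLp_smul_ones hw).ae_eq (.of_forall fun η => ?_)
    exact smul_assoc _ _ _
  refine tendsto_integral_norm_of_weighted ?_ hlim
    (B := B + (eLpNorm (fun η => ((1 + ‖η‖ ^ 2 : ℝ) : ℂ) • v η • ones) 2 volume).toReal)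
    (by positivity) ?_
  · filter_upwards [eventually_unit] with h h0
    exact (memLp_spec h0.1 ⟨U h, memℓp_two_iff.2 (hU h h0.1).1⟩).sub (memLp_smul_ones hv)
  · filter_upwards [hev, eventually_unit] with h hh h0
    have h1 := memLp_weighted_spec h0.1 ⟨U h, memℓp_two_iff.2 (hU h h0.1).1⟩
    have h2 := hh ⟨U h, memℓp_two_iff.2 (hU h h0.1).1⟩ (hU h h0.1)
    simp_rw [smul_sub]
    refine ⟨h1.1.sub hwo, (eLpNorm_sub_le h1.1.1 hwo.1 (by norm_num)).trans ?_⟩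
    rw [ENNReal.ofReal_add hB ENNReal.toReal_nonneg, ENNReal.ofReal_toReal hwo.2.ne]
    gcongr
    exact h1.2.trans (ENNReal.ofReal_le_ofReal h2)

theorem integrable_spec {h : ℝ} (hh : 0 < h) (u : SqSum) : Integrable (spec h u) :=
  (integrable_of_memLp_weighted (memLp_spec hh u) (memLp_weighted_spec hh u).1 one_pos).1

theorem bracketPow_neg_le_one {σ : ℝ} (hσ : 0 ≤ σ) (x : Plane) : bracketPow (-σ) x ≤ 1 :=
  Real.rpow_le_one_of_one_le_of_nonpos (by nlinarith [sq_nonneg ‖x‖]) (by linarith)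

/-- Plancherel turns `L²` convergence of the transforms into unweighted `L²` convergence, and the
weight is at most `1`. The sup norm of an inverse transform is bounded by the `L¹` norm, so the
second convergence is uniform on the whole plane. -/
theorem tendsto_interpolation {v : Plane → ℂ} (hv1 : Integrable v)
    (hv2 : MemLp v 2 (volume : Measure Plane)) {U : ℝ → Cell → Spinor}
    (hU : ∀ h : ℝ, 0 < h → Memℓp (U h) 2)
    (hlim2 : Tendsto (fun h => eLpNorm (fun η => spec h (U h) η - v η • ones) 2 volume)
      (𝓝[>] 0) (𝓝 0))
    (hlim1 : Tendsto (fun h => ∫ η, ‖spec h (U h) η - v η • ones‖) (𝓝[>] 0) (𝓝 0)) :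
    (∀ σ : ℝ, 0 < σ → Tendsto (fun h => eLpNorm (fun x => (bracketPow (-σ) x : ℂ) •
      (interpolation h (U h) x - 𝓕⁻ v x • ones)) 2 volume) (𝓝[>] 0) (𝓝 0)) ∧
      TendstoLocallyUniformly (fun h => interpolation h (U h)) (fun x => 𝓕⁻ v x • ones)
        (𝓝[>] 0) := by
  have hdiff : ∀ h : ℝ, 0 < h → ∀ x, interpolation h (U h) x - 𝓕⁻ v x • ones =
      𝓕⁻ (fun η => spec h (U h) η - v η • ones) x := fun h hh x => by
    rw [fourierInv_sub_apply (integrable_spec hh ⟨U h, hU h hh⟩) (hv1.smul_const ones),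
      interpolation_eq_fourierInv, fourierInv_smul_const]
  refine ⟨fun σ hσ => ?_, ?_⟩
  · refine tendsto_of_tendsto_of_tendsto_of_le_of_le' tendsto_const_nhds hlim2
      (.of_forall fun _ => zero_le) ?_
    filter_upwards [self_mem_nhdsWithin] with h (hh : 0 < h)
    have e : eLpNorm (𝓕⁻ fun η => spec h (U h) η - v η • ones) 2 volume =
        eLpNorm (fun η => spec h (U h) η - v η • ones) 2 volume :=
      eLpNorm_fourierInv ((integrable_spec hh ⟨U h, hU h hh⟩).sub (hv1.smul_const ones))
        ((memLp_spec hh ⟨U h, hU h hh⟩).sub (memLp_smul_ones hv2))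
    rw [← e]
    refine eLpNorm_mono fun x => ?_
    rw [hdiff h hh, norm_smul, Complex.norm_real, Real.norm_of_nonneg (bracketPow_nonneg _ _)]
    exact mul_le_of_le_one_left (norm_nonneg _) (bracketPow_neg_le_one hσ.le x)
  · refine TendstoUniformly.tendstoLocallyUniformly ?_
    rw [Metric.tendstoUniformly_iff]
    intro ε hε
    filter_upwards [self_mem_nhdsWithin, hlim1.eventually_lt_const hε] with h (hh : 0 < h) hlt x
    rw [dist_comm, dist_eq_norm, hdiff h hh]
    exact (norm_fourierInv_le _ x).trans_lt hlt

theorem MemWeightedH.exists_bound {m : ℝ} (hm : 1 < m) (hf : MemWeightedH m s f)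
    (hfc : Continuous f) : ∃ C, ∀ x, ‖f x‖ ≤ C * bracketPow (-s) x := by
  obtain ⟨C, hC⟩ := MemH.exists_bound hm hf
    ((Complex.continuous_ofReal.comp (continuous_bracketPow s)).smul hfc)
  refine ⟨C, fun x => ?_⟩
  have h1 : ‖f x‖ = ‖(bracketPow s x : ℂ) • f x‖ * bracketPow (-s) x := by
    rw [norm_smul, Complex.norm_real, Real.norm_of_nonneg (bracketPow_nonneg _ _), mul_right_comm,
      bracketPow_mul_bracketPow, add_neg_cancel]
    simp [bracketPow]
  rw [h1]
  exact mul_le_mul_of_nonneg_right (hC x) (bracketPow_nonneg _ _)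

theorem memℓp_node {h : ℝ} (hh : 0 < h) (hs : 1 < s) (hf : ∀ x, ‖f x‖ ≤ C * bracketPow (-s) x) :
    Memℓp (fun n => f (node h n)) 2 := by
  rw [memℓp_two_iff]
  have h1 : ∀ x, ‖‖f x‖ ^ 2‖ ≤ C ^ 2 * bracketPow (-(2 * s)) x := fun x => by
    rw [Real.norm_of_nonneg (sq_nonneg _), show -(2 * s) = -s + -s by ring,
      ← bracketPow_mul_bracketPow, ← sq, ← mul_pow]
    exact pow_le_pow_left₀ (norm_nonneg _) (hf x) 2
  simpa using summable_norm_node (by linarith) hh h1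

theorem IsContinuumSolution.ae_eq (hVc : Continuous V) (hV : ∀ x, |V x| ≤ C) (hz : z.im ≠ 0)
    {g u v : Plane → Spinor} (hu : IsContinuumSolution V g z u) (hv : IsContinuumSolution V g z v) :
    v =ᵐ[volume] u := by
  have h1 : v - u =ᵐ[volume] 0 := by
    refine ae_eq_zero_of_weak hVc hV hz (hv.1.sub hu.1) fun φ hφ hc => ?_
    have hm : MemLp (fun x => contHamiltonian φ x + ((V x : ℂ) - z) * φ x) 2
        (volume : Measure Plane) := memLp_schrodinger hVc hV z (hc.toSchwartzMap hφ)
    have e : ∀ x, (contHamiltonian φ x + ((V x : ℂ) - z) * φ x) • (v - u) x =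
        (contHamiltonian φ x + ((V x : ℂ) - z) * φ x) • v x -
          (contHamiltonian φ x + ((V x : ℂ) - z) * φ x) • u x := fun x => smul_sub _ _ _
    simp_rw [e]
    rw [integral_sub (integrable_smul_of_memLp_two hm hv.1) (integrable_smul_of_memLp_two hm hu.1),
      hu.2 φ hφ hc, hv.2 φ hφ hc, sub_self]
  filter_upwards [h1] with x hx
  exact sub_eq_zero.1 hx

end

end HexLattice

end

/-! ### Assembly of the main theorem. -/

open FourierTransform in
theorem mainTheorem11 (m s r : ℝ) (hm : 2 < m) (hs : 3 < s) (hr : 1 < r)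
    (f : HexLattice.Plane → HexLattice.Spinor) (hfc : Continuous f)
    (hf : HexLattice.MemWeightedH m s f)
    (V : HexLattice.Plane → ℝ) (hVc : Continuous V)
    (hV : HexLattice.MemH r (fun x => (V x : ℂ)))
    (z : ℂ) (hz : z.im ≠ 0) :
    (∀ h : ℝ, 0 < h → ∃! u, HexLattice.IsLatticeSolution h V f z u) ∧
    ∃ u : HexLattice.Plane → HexLattice.Spinor, Continuous u ∧
      (∀ x, HexLattice.groundProj (u x) = u x) ∧
      HexLattice.IsContinuumSolution V (fun x => HexLattice.groundProj (f x)) z u ∧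
      (∀ v, HexLattice.IsContinuumSolution V (fun x => HexLattice.groundProj (f x)) z v →
        v =ᵐ[volume] u) ∧
      ∀ U : ℝ → HexLattice.Cell → HexLattice.Spinor,
        (∀ h : ℝ, 0 < h → HexLattice.IsLatticeSolution h V f z (U h)) →
        (∀ σ : ℝ, 0 < σ → σ < 1 / 2 →
          Tendsto (fun h => eLpNorm
              (fun x => (HexLattice.bracketPow (-σ) x : ℂ) •
                (HexLattice.interpolation h (U h) x - u x)) 2 volume)
            (𝓝[>] 0) (𝓝 0)) ∧
        TendstoLocallyUniformly (fun h => HexLattice.interpolation h (U h)) u (𝓝[>] 0) := by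
  obtain ⟨A, hA⟩ := hf.exists_bound (by linarith) hfc
  obtain ⟨C, hC⟩ := hV.exists_bound hr (Complex.continuous_ofReal.comp hVc)
  have hC : ∀ x, |V x| ≤ C := by simpa using hC
  have hs1 : 1 < s := by linarith
  have hd : HexLattice.Decays s fun _ => f := .of_bound hfc hA
  refine ⟨fun h hh => HexLattice.existsUnique_isLatticeSolution hC
    (HexLattice.memℓp_node hh hs1 hA) hz, ?_⟩
  have hg := HexLattice.memLp_groundComponent hs1 hd
  obtain ⟨v, hv, happrox⟩ := HexLattice.exists_weak_solution hVc hC hz hg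
  set w : Lp ℂ 2 (volume : Measure HexLattice.Plane) := 𝓕 v with hw
  -- By the equation `P(D)v` is in `L²`, so the transform `w` of `v` has a square-integrable
  -- weighted form and is integrable. The inverse transform of `w` is therefore the continuous
  -- representative used as the solution.
  have hweight : MemLp (fun η => ((1 + ‖η‖ ^ 2 : ℝ) : ℂ) • w η) 2
      (volume : Measure HexLattice.Plane) := by
    have hVv := HexLattice.memLp_bounded_smul (Complex.continuous_ofReal.comp hVc)
      (by simpa using hC) (Lp.memLp v)
    have hrhs : MemLp (fun x => z • v x - (V x : ℂ) • v x + (f x 0 + f x 1) / 2) 2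
      (volume : Measure HexLattice.Plane) := (((Lp.memLp v).const_smul z).sub hVv).add hg
    exact HexLattice.memLp_weight_smul_fourier (w := hrhs.toLp _)
      (((HexLattice.weakHamiltonian_iff hVc hC (Lp.memLp v) hg).2 hv).congr .rfl
        hrhs.coeFn_toLp.symm)
  have hw1 : Integrable (w : HexLattice.Plane → ℂ) :=
    (HexLattice.integrable_of_memLp_weighted (Lp.memLp w) hweight one_pos).1
  have hwv : 𝓕⁻ (w : HexLattice.Plane → ℂ) =ᵐ[volume] v := by
    have h1 := HexLattice.coeFn_fourierInv_toLp hw1 (Lp.memLp w)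
    rw [Lp.toLp_coeFn, hw, FourierTransform.fourierInv_fourier_eq] at h1
    exact h1.symm
  have hsol : HexLattice.IsContinuumSolution V (fun x => HexLattice.groundProj (f x)) z
      fun x => 𝓕⁻ (w : HexLattice.Plane → ℂ) x • HexLattice.ones := by
    refine ⟨HexLattice.memLp_smul_ones ((Lp.memLp v).ae_eq hwv.symm), fun φ hφ hc => ?_⟩
    simp_rw [HexLattice.groundProj_eq, ← smul_assoc]
    rw [integral_smul_const, integral_smul_const, ← hv φ hφ hc]
    congr 1
    refine integral_congr_ae ?_
    filter_upwards [hwv] with x hx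
    rw [hx]
  refine ⟨_, (HexLattice.continuous_fourierInv hw1).smul continuous_const,
    fun x => HexLattice.groundProj_smul_ones _, hsol, fun v hv => hsol.ae_eq hVc hC hz hv,
    fun U hU => ?_⟩
  have h2 := HexLattice.tendsto_eLpNorm_spec_sub hs1 hd hVc hC hz happrox hU
  have h1 := HexLattice.tendsto_integral_norm_spec_sub hs1 hd hC hz (Lp.memLp w) hweight hU h2
  have h3 := HexLattice.tendsto_interpolation hw1 (Lp.memLp w)
    (fun h hh => HexLattice.memℓp_two_iff.2 (hU h hh).1) h2 h1
  exact ⟨fun σ hσ _ => h3.1 σ hσ, h3.2⟩
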